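/- Let $k$ be a field with the trivial absolute value, let $M$ be a free abelian group of finite rank, $N=\mathrm{Hom}(M,\mathbb Z)$, $N_{\mathbb R}=\mathrm{Hom}(M,\mathbb R)$, $\overline{\mathbb R}=\mathbb R\cup\{\infty\}$ and $\overline{\mathbb R}_{\ge 0}=\mathbb R_{\ge 0}\cup\{\infty\}$. Let $\Delta$ be a nonempty finite fan of strictly convex rational polyhedral cones in $N_{\mathbb R}$, $S_\sigma=\sigma^\vee\cap M$ for $\sigma\in\Delta$, and let $X=X(\Delta)$ be the toric variety over $k$ obtained by gluing the $U_\sigma=\mathrm{Spec}\,k[S_\sigma]$, with big torus $T=\mathrm{Spec}\,k[M]$. **The toric side.** Let $X^{an}$ be the Berkovich analytification of $X$. Let $N_{\mathbb R}(\Delta)$ be the gluing of the spaces $\mathrm{Hom}(S_\sigma,\overline{\mathbb R})$ (monoid homomorphisms, with the topology of pointwise convergence) along restriction to $S_\sigma\subseteq S_\tau$ for faces $\tau\le\sigma$. The map $\mathrm{trop}_\Delta\colon X^{an}\to N_{\mathbb R}(\Delta)$ sends $x\in U_\sigma^{an}$ to $s\mapsto-\log|\chi^s|_x$. For a closed subscheme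 $Y\subseteq X$ (for example a closed subset with its reduced structure) put $\mathrm{Trop}(Y,\Delta)=\mathrm{trop}_\Delta(Y^{an})$. Let $\overline\Delta$ be the closure of the union of the cones of $\Delta$ in $N_{\mathbb R}(\Delta)$. **The logarithmic side.** Let $M_X(U)=\{f\in\mathcal O_X(U): f|_{U\cap T}\text{ is invertible}\}$ be the logarithmic structure given by the toric boundary. Let $\varphi_X\colon(X,M_X/M_X^*)\to F_X$ be its characteristic morphism, i.e. an initial object among the strict morphisms of sharp monoidal spaces from $(X,M_X/M_X^*)$ to fine and saturated Kato fans, and let $\overline\Sigma_X=\mathrm{Hom}(\mathrm{Spec}\,\overline{\mathbb R}_{\ge0},F_X)$ be the extended cone complex. Let $X^\beth$ be Thuillier's analytic space; its points are the points $x\in X^{an}$ together with an extension of $\mathrm{Spec}\,\kappa(x)\to X$ to a morphism $\mathrm{Spec}\,R_x\to X$, where $\kappa(x)$ denotes the residue field of the point of $X$ underlying $x$ and $R_x$ the valuation ring of $|\cdot|_x$ in $\kappa(x)$. Let $r(x)\in X$ be the image of the closed point of $\mathrm{Spec}\,R_x$. The map $\mathrm{trop}_X\colon X^\beth\to\overline\Sigma_X$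 sends $x$ to the morphism which maps the closed point to $\varphi_X(r(x))$ and which is given on stalks at the closed point by $\mathcal O_{F_X,\varphi_X(r(x))}\cong M_{X,r(x)}/M_{X,r(x)}^*\to R_x/R_x^*\to\overline{\mathbb R}_{\ge0}$, the last map being $-\log|\cdot|_x$. For a closed subscheme $Y\subseteq X$ put $\mathrm{Trop}_X(Y)=\mathrm{trop}_X(Y^\beth)$. **Claim.** The characteristic morphism exists and $\mathrm{trop}_X$ is well defined. There is an injective map $\iota\colon\overline\Sigma_X\hookrightarrow N_{\mathbb R}(\Delta)$ with image $\overline\Delta$ such that $\iota(\mathrm{trop}_X(x))=\mathrm{trop}_\Delta(x)$ for all $x\in X^\beth$. If $\overline\Sigma_X$ is identified with $\overline\Delta$ through $\iota$, then for every closed subscheme $Y$ of $X$: 1. $\mathrm{Trop}_X(Y)=\mathrm{Trop}(Y,\Delta)\cap\overline\Delta$ in $N_{\mathbb R}(\Delta)$; 2. $Y$ is proper over $k$ if and only if $\mathrm{Trop}_X(Y)=\mathrm{Trop}(Y,\Delta)$. -/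

import Mathlib

open CategoryTheory AlgebraicGeometry TopologicalSpace

open scoped NNReal ENNReal

namespace TropLog

universe u v w

noncomputable section

/-! ### Rational polyhedral fans

`M` is the character lattice, `N = Hom(M, ℤ)` and `N_ℝ = Hom(M, ℝ)`. -/

section Fans

variable {M : Type u} [AddCommGroup M]

/-- `σ` is generated, as a convex cone, by finitely many vectors of the lattice `N`. -/
def IsRationalPolyhedral (σ : PointedCone ℝ (M →+ ℝ)) : Prop :=
  ∃ s : Finset (M →+ ℤ),
    σ = PointedCone.hull ℝ ((fun n : M →+ ℤ => (Int.castAddHom ℝ).comp n) '' (s : Set (M →+ ℤ)))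

/-- `σ` contains no nonzero linear subspace. -/
def IsStrictlyConvex (σ : PointedCone ℝ (M →+ ℝ)) : Prop :=
  ∀ u : M →+ ℝ, u ∈ σ → -u ∈ σ → u = 0

/-- The monoid `S_σ = σ^∨ ∩ M`. -/
def dualMonoid (σ : PointedCone ℝ (M →+ ℝ)) : AddSubmonoid M where
  carrier := {m | ∀ u ∈ σ, 0 ≤ u m}
  zero_mem' := fun u _ => by simp
  add_mem' := fun {a b} ha hb u hu => by
    rw [map_add]; exact add_nonneg (ha u hu) (hb u hu)

/-- `τ = σ ∩ m^⊥` for some `m ∈ S_σ`. -/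
def IsFace (τ σ : PointedCone ℝ (M →+ ℝ)) : Prop :=
  ∃ m ∈ dualMonoid σ, ∀ u : M →+ ℝ, u ∈ τ ↔ u ∈ σ ∧ u m = 0

variable (M) in
/-- A (finite, nonempty) fan of strictly convex rational polyhedral cones in `N_ℝ`. Since all
cones are strictly convex, being nonempty means that the zero cone belongs to the fan. -/
structure Fan where
  cones : Set (PointedCone ℝ (M →+ ℝ))
  finite : cones.Finite
  bot_mem : ⊥ ∈ cones
  rational : ∀ σ ∈ cones, IsRationalPolyhedral σ
  strictlyConvex : ∀ σ ∈ cones, IsStrictlyConvex σ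
  face_mem : ∀ σ ∈ cones, ∀ τ, IsFace τ σ → τ ∈ cones
  inter_face : ∀ σ ∈ cones, ∀ τ ∈ cones, IsFace (σ ⊓ τ) σ

/-- The cones of the fan, ordered by inclusion (that is, by the face relation). -/
abbrev Fan.Cone (Δ : Fan M) : Type u := {σ : PointedCone ℝ (M →+ ℝ) // σ ∈ Δ.cones}

/-- The zero cone. -/
def Fan.zero (Δ : Fan M) : Δ.Cone := ⟨⊥, Δ.bot_mem⟩

/-- The monoid `S_σ` of a cone of the fan. -/
abbrev Fan.S (Δ : Fan M) (σ : Δ.Cone) : AddSubmonoid M := dualMonoid σ.1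

lemma dualMonoid_anti {σ τ : PointedCone ℝ (M →+ ℝ)} (h : τ ≤ σ) :
    dualMonoid σ ≤ dualMonoid τ := fun _ hm u hu => hm u (h hu)

lemma Fan.isFace_of_le (Δ : Fan M) {τ σ : Δ.Cone} (h : τ ≤ σ) : IsFace τ.1 σ.1 := by
  have := Δ.inter_face σ.1 σ.2 τ.1 τ.2
  rwa [inf_eq_right.mpr (show τ.1 ≤ σ.1 from h)] at this

/-- The inclusion `S_σ ⊆ S_τ` for a face `τ` of `σ`. -/
def Fan.incl (Δ : Fan M) {τ σ : Δ.Cone} (h : τ ≤ σ) : Δ.S σ →+ Δ.S τ :=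
  AddSubmonoid.inclusion (dualMonoid_anti h)

/-- If `τ = σ ∩ m^⊥` then `S_τ = S_σ + ℕ (-m)`. -/
lemma exists_nsmul_add_mem {τ σ : PointedCone ℝ (M →+ ℝ)} (hσ : IsRationalPolyhedral σ)
    {m : M} (hm : m ∈ dualMonoid σ) (hτ : ∀ u : M →+ ℝ, u ∈ τ ↔ u ∈ σ ∧ u m = 0)
    {w : M} (hw : w ∈ dualMonoid τ) : ∃ n : ℕ, ∀ n' ≥ n, w + n' • m ∈ dualMonoid σ := by
  obtain ⟨s, rfl⟩ := hσ
  set g := fun n : M →+ ℤ => (Int.castAddHom ℝ).comp n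
  have key : ∀ x ∈ s, ∃ n : ℕ, ∀ n' ≥ n, 0 ≤ g x (w + n' • m) := by
    intro x hx
    have hxσ : g x ∈ PointedCone.hull ℝ (g '' (s : Set (M →+ ℤ))) :=
      Submodule.subset_span ⟨x, hx, rfl⟩
    rcases (hm _ hxσ).eq_or_lt with h0 | h0
    · refine ⟨0, fun n' _ => ?_⟩
      rw [map_add, map_nsmul, ← h0, smul_zero, add_zero]
      exact hw _ ((hτ _).2 ⟨hxσ, h0.symm⟩)
    · obtain ⟨n, hn⟩ := exists_nat_gt (-(g x w) / g x m)
      refine ⟨n, fun n' hn' => ?_⟩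
      rw [map_add, map_nsmul, nsmul_eq_mul]
      rw [div_lt_iff₀ h0] at hn
      have : (n : ℝ) * g x m ≤ n' * g x m := by
        have : (n : ℝ) ≤ n' := by exact_mod_cast hn'
        gcongr
      linarith
  choose! N hN using key
  refine ⟨s.sup N, fun n' hn' u hu => ?_⟩
  refine Submodule.span_induction (p := fun u _ => 0 ≤ u (w + n' • m)) ?_ ?_ ?_ ?_ hu
  · rintro _ ⟨x, hx, rfl⟩
    exact hN x hx n' (le_trans (Finset.le_sup hx) hn')
  · simp
  · intro a b _ _ ha hb
    exact add_nonneg ha hb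
  · intro a b _ hb
    exact mul_nonneg a.2 hb

end Fans

/-! ### The toric variety of a fan -/

section Toric

variable (k : Type u) [Field k] {M : Type u} [AddCommGroup M] (Δ : Fan M)

/-- The semigroup algebra `k[S_σ]`. -/
abbrev coordRing (σ : Δ.Cone) : Type u := AddMonoidAlgebra k (Δ.S σ)

/-- The inclusion `k[S_σ] ⊆ k[S_τ]` for `τ ≤ σ`. -/
def coordMap {τ σ : Δ.Cone} (h : τ ≤ σ) : coordRing k Δ σ →ₐ[k] coordRing k Δ τ :=
  AddMonoidAlgebra.mapDomainAlgHom k k (Δ.incl h)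

/-- The character `χ^s` as an element of `k[S_σ]`. -/
abbrev character (σ : Δ.Cone) (s : Δ.S σ) : coordRing k Δ σ :=
  AddMonoidAlgebra.of k (Δ.S σ) (Multiplicative.ofAdd s)

@[simp] lemma coordMap_single {τ σ : Δ.Cone} (h : τ ≤ σ) (s : Δ.S σ) (a : k) :
    coordMap k Δ h (AddMonoidAlgebra.single s a) = AddMonoidAlgebra.single (Δ.incl h s) a := by
  simp [coordMap]

lemma coordMap_refl (σ : Δ.Cone) (h : σ ≤ σ) : coordMap k Δ h = AlgHom.id k _ := by
  apply AddMonoidAlgebra.algHom_ext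
  swap
  · exact Subsingleton.elim _ _
  intro s
  rw [coordMap_single]; rfl

lemma coordMap_comp {ρ τ σ : Δ.Cone} (h : ρ ≤ τ) (h' : τ ≤ σ) (h'' : ρ ≤ σ) :
    coordMap k Δ h'' = (coordMap k Δ h).comp (coordMap k Δ h') := by
  apply AddMonoidAlgebra.algHom_ext
  swap
  · exact Subsingleton.elim _ _
  intro s
  rw [AlgHom.comp_apply, coordMap_single, coordMap_single, coordMap_single]; rfl

/-- The diagram of the affine toric varieties `U_σ = Spec k[S_σ]` with the inclusions
`U_τ ⊆ U_σ` for `τ ≤ σ`. -/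
def toricDiagram : Δ.Cone ⥤ Scheme.{u} where
  obj σ := Spec (CommRingCat.of (coordRing k Δ σ))
  map h := Spec.map (CommRingCat.ofHom (coordMap k Δ (leOfHom h)).toRingHom)
  map_id σ := by
    rw [coordMap_refl]; exact Spec.map_id _
  map_comp {a b c} f g := by
    rw [← Spec.map_comp, coordMap_comp k Δ (leOfHom f) (leOfHom g)]; rfl

lemma isLocalization_coordMap {τ σ : Δ.Cone} (h : τ ≤ σ) (m : M) (hm : m ∈ Δ.S σ)
    (hτ : ∀ u : M →+ ℝ, u ∈ τ.1 ↔ u ∈ σ.1 ∧ u m = 0) :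
    @IsLocalization.Away _ _ (character k Δ σ ⟨m, hm⟩) (coordRing k Δ τ) _
      (coordMap k Δ h).toRingHom.toAlgebra := by
  let := (coordMap k Δ h).toRingHom.toAlgebra
  have hinj : Function.Injective (coordMap k Δ h) :=
    AddMonoidAlgebra.mapDomain_injective
      (AddSubmonoid.inclusion_injective (dualMonoid_anti (show τ.1 ≤ σ.1 from h)))
  have hpow : ∀ n : ℕ, algebraMap (coordRing k Δ σ) (coordRing k Δ τ)
      (character k Δ σ ⟨m, hm⟩ ^ n) =
        AddMonoidAlgebra.single (Δ.incl h (n • ⟨m, hm⟩)) (1 : k) := by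
    intro n
    change coordMap k Δ h _ = _
    rw [character, AddMonoidAlgebra.of_apply, AddMonoidAlgebra.single_pow, coordMap_single]
    simp
  have hneg : -m ∈ Δ.S τ := fun u hu => by
    rw [map_neg, ((hτ u).1 hu).2, neg_zero]
  refine (isLocalization_iff_isLocalizationMap _ _).2 ⟨?_, ?_, ?_⟩
  · rintro ⟨_, n, rfl⟩
    change IsUnit (algebraMap (coordRing k Δ σ) (coordRing k Δ τ) (character k Δ σ ⟨m, hm⟩ ^ n))
    rw [hpow]
    refine IsUnit.of_mul_eq_one (AddMonoidAlgebra.single (n • ⟨-m, hneg⟩) 1) ?_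
    rw [AddMonoidAlgebra.single_mul_single, AddMonoidAlgebra.one_def, one_mul]
    congr 1
    ext
    change n • m + n • (-m) = 0
    simp
  · intro z
    suffices H : ∃ N : ℕ, ∀ n ≥ N, ∃ x, z * algebraMap (coordRing k Δ σ) (coordRing k Δ τ)
        (character k Δ σ ⟨m, hm⟩ ^ n) = algebraMap _ _ x by
      obtain ⟨N, hN⟩ := H
      obtain ⟨x, hx⟩ := hN N le_rfl
      exact ⟨(x, ⟨_, N, rfl⟩), hx⟩
    induction z using AddMonoidAlgebra.induction_on with
    | of w =>
      obtain ⟨N, hN⟩ := exists_nsmul_add_mem (Δ.rational σ.1 σ.2) hm hτ w.2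
      refine ⟨N, fun n hn => ⟨AddMonoidAlgebra.single ⟨_, hN n hn⟩ 1, ?_⟩⟩
      rw [hpow]
      change _ = coordMap k Δ h _
      rw [coordMap_single, AddMonoidAlgebra.of_apply, AddMonoidAlgebra.single_mul_single, one_mul]
      rfl
    | add a b ha hb =>
      obtain ⟨N, hN⟩ := ha
      obtain ⟨N', hN'⟩ := hb
      refine ⟨max N N', fun n hn => ?_⟩
      obtain ⟨x, hx⟩ := hN n (le_trans (le_max_left _ _) hn)
      obtain ⟨y, hy⟩ := hN' n (le_trans (le_max_right _ _) hn)
      exact ⟨x + y, by rw [add_mul, hx, hy, map_add]⟩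
    | smul r a ha =>
      obtain ⟨N, hN⟩ := ha
      refine ⟨N, fun n hn => ?_⟩
      obtain ⟨x, hx⟩ := hN n hn
      refine ⟨r • x, ?_⟩
      rw [smul_mul_assoc, hx]
      exact (map_smul (coordMap k Δ h) r x).symm
  · intro x y hxy
    exact ⟨1, by rw [hinj hxy]⟩

lemma exists_toricDiagram_map_range {τ σ : Δ.Cone} (f : τ ⟶ σ) (m : M) (hm : m ∈ Δ.S σ)
    (hτ : ∀ u : M →+ ℝ, u ∈ τ.1 ↔ u ∈ σ.1 ∧ u m = 0) :
    Set.range ((toricDiagram k Δ).map f) =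
      (PrimeSpectrum.basicOpen (character k Δ σ ⟨m, hm⟩) :
        Set (PrimeSpectrum (coordRing k Δ σ))) := by
  let := (coordMap k Δ (leOfHom f)).toRingHom.toAlgebra
  have := isLocalization_coordMap k Δ (leOfHom f) m hm hτ
  exact PrimeSpectrum.localization_away_comap_range (coordRing k Δ τ)
    (character k Δ σ ⟨m, hm⟩)

instance toricDiagram_isOpenImmersion {τ σ : Δ.Cone} (f : τ ⟶ σ) :
    IsOpenImmersion ((toricDiagram k Δ).map f) := by
  obtain ⟨m, hm, hτ⟩ := Δ.isFace_of_le (leOfHom f)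
  let := (coordMap k Δ (leOfHom f)).toRingHom.toAlgebra
  have := isLocalization_coordMap k Δ (leOfHom f) m hm hτ
  exact IsOpenImmersion.of_isLocalization (R := coordRing k Δ σ) (S := coordRing k Δ τ)
    (character k Δ σ ⟨m, hm⟩)

instance toricDiagram_isLocallyDirected :
    (toricDiagram k Δ ⋙ Scheme.forget).IsLocallyDirected where
  cond {i j σ} fi fj xi xj hx := by
    obtain ⟨m, hm, hi⟩ := Δ.isFace_of_le (leOfHom fi)
    obtain ⟨m', hm', hj⟩ := Δ.isFace_of_le (leOfHom fj)
    change (toricDiagram k Δ).map fi xi = (toricDiagram k Δ).map fj xj at hx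
    have hl : ∀ u : M →+ ℝ, u ∈ i.1 ⊓ j.1 ↔ u ∈ σ.1 ∧ u (m + m') = 0 := by
      intro u
      rw [Submodule.mem_inf, hi, hj, map_add]
      constructor
      · rintro ⟨⟨h1, h2⟩, _, h3⟩
        exact ⟨h1, by rw [h2, h3, add_zero]⟩
      · rintro ⟨h1, h2⟩
        have a := hm u h1
        have b := hm' u h1
        exact ⟨⟨h1, by linarith⟩, h1, by linarith⟩
    let l : Δ.Cone := ⟨i.1 ⊓ j.1, Δ.face_mem σ.1 σ.2 _ ⟨m + m', add_mem hm hm', hl⟩⟩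
    let fli : l ⟶ i := homOfLE (show i.1 ⊓ j.1 ≤ i.1 from inf_le_left)
    let flj : l ⟶ j := homOfLE (show i.1 ⊓ j.1 ≤ j.1 from inf_le_right)
    have h1 : (toricDiagram k Δ).map fi xi ∈ (PrimeSpectrum.basicOpen (character k Δ σ ⟨m, hm⟩) :
        Set (PrimeSpectrum (coordRing k Δ σ))) := by
      rw [← exists_toricDiagram_map_range k Δ fi m hm hi]; exact ⟨_, rfl⟩
    have h2 : (toricDiagram k Δ).map fi xi ∈ (PrimeSpectrum.basicOpen (character k Δ σ ⟨m', hm'⟩) :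
        Set (PrimeSpectrum (coordRing k Δ σ))) := by
      rw [hx, ← exists_toricDiagram_map_range k Δ fj m' hm' hj]; exact ⟨_, rfl⟩
    have h3 : (toricDiagram k Δ).map fi xi ∈ Set.range ((toricDiagram k Δ).map (fli ≫ fi)) := by
      rw [exists_toricDiagram_map_range k Δ (fli ≫ fi) (m + m') (add_mem hm hm') hl]
      have : character k Δ σ ⟨m + m', add_mem hm hm'⟩ =
          character k Δ σ ⟨m, hm⟩ * character k Δ σ ⟨m', hm'⟩ := by
        rw [character, character, character, ← map_mul]; rfl
      rw [this, PrimeSpectrum.basicOpen_mul]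
      exact ⟨h1, h2⟩
    obtain ⟨x, hx'⟩ := h3
    refine ⟨l, fli, flj, x, ?_, ?_⟩
    · apply ((toricDiagram k Δ).map fi).isOpenEmbedding.injective
      rw [← hx', Functor.map_comp]; rfl
    · apply ((toricDiagram k Δ).map fj).isOpenEmbedding.injective
      rw [← hx, ← hx', show fli ≫ fi = flj ≫ fj from Subsingleton.elim _ _, Functor.map_comp]; rfl

/-- The toric variety `X(Δ)`: the gluing of the `U_σ` along the `U_τ` for `τ ≤ σ`. -/
def toricVariety : Scheme.{u} := Limits.colimit (toricDiagram k Δ)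

/-- The inclusion `U_σ ⟶ X(Δ)`. -/
def toricChart (σ : Δ.Cone) : Spec (CommRingCat.of (coordRing k Δ σ)) ⟶ toricVariety k Δ :=
  Limits.colimit.ι (toricDiagram k Δ) σ

instance (σ : Δ.Cone) : IsOpenImmersion (toricChart k Δ σ) :=
  inferInstanceAs (IsOpenImmersion (Limits.colimit.ι (toricDiagram k Δ) σ))

/-- The structure morphism `X(Δ) ⟶ Spec k`. -/
def toricStructure : toricVariety k Δ ⟶ Spec (CommRingCat.of k) :=
  Limits.colimit.desc (toricDiagram k Δ)
    { pt := Spec (CommRingCat.of k)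
      ι :=
        { app := fun σ => Spec.map (CommRingCat.ofHom (algebraMap k (coordRing k Δ σ)))
          naturality := fun {τ σ} f => by
            change Spec.map _ ≫ Spec.map _ = _ ≫ 𝟙 _
            rw [Category.comp_id, ← Spec.map_comp, ← CommRingCat.ofHom_comp]
            congr 2
            exact (coordMap k Δ (leOfHom f)).comp_algebraMap } }

/-- The big torus `T = Spec k[M]`, as an open subset of `X(Δ)`. -/
def bigTorus : (toricVariety k Δ).Opens := (toricChart k Δ Δ.zero).opensRange

end Toric

/-! ### Analytifications over a trivially valued field -/

section Analytification

variable {k : Type u} [Field k] {X : Scheme.{u}} (f : X ⟶ Spec (CommRingCat.of k))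

/-- The field homomorphism `k → κ(ξ)` given by the structure morphism of `X`. -/
def residueScalars (ξ : X) : k →+* X.residueField ξ :=
  (Spec.preimage (X.fromSpecResidueField ξ ≫ f)).hom

/-- The points of the Berkovich analytification `X^an` over the trivially valued field `k`: a
point `ξ = ρ(x)` of `X` and a real valued non-Archimedean absolute value on the residue field
`κ(ξ)` which is trivial on `k`. Over an affine open subset `Spec A` of `X` these are the
multiplicative seminorms on `A` which extend the trivial absolute value of `k`, decomposed into
their kernel and the induced absolute value. -/
structure Analytification where
  point : X
  val : Valuation (X.residueField point) ℝ≥0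
  val_scalars : ∀ a : k, a ≠ 0 → val (residueScalars f point a) = 1

variable {f} in
/-- The valuation ring of `κ(ρ(x))`. -/
abbrev Analytification.integers (x : Analytification f) : ValuationSubring (X.residueField x.point) :=
  x.val.valuationSubring

/-- The points of Thuillier's space `X^ℶ`: a point `x` of `X^an` together with an extension
`Spec R ⟶ X` of `Spec κ(ρ(x)) ⟶ X`, where `R` is the valuation ring of `x`. Over an affine open
subset `Spec A`, an extension to a morphism `Spec R ⟶ Spec A` is unique, and exists if and only
if `|a|_x ≤ 1` for all `a ∈ A`. -/
structure Beth where
  toAn : Analytification f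
  integral : Spec (CommRingCat.of toAn.integers) ⟶ X
  fac : Spec.map (CommRingCat.ofHom toAn.integers.subtype) ≫ integral =
    X.fromSpecResidueField toAn.point

variable {f}

/-- The reduction map `r : X^ℶ → X`, the image of the closed point of `Spec R`. -/
def Beth.red (x : Beth f) : X :=
  x.integral (IsLocalRing.closedPoint (CommRingCat.of x.toAn.integers))

/-- The absolute value `|a|_x ≤ 1` of a germ `a ∈ 𝒪_{X, r(x)}`. -/
def Beth.absGerm (x : Beth f) (a : X.presheaf.stalk x.red) : ℝ≥0 :=
  x.toAn.val ((Scheme.stalkClosedPointTo x.integral).hom a : x.toAn.integers)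

variable (f) in
/-- The subspace `Y^an` of `X^an`, for `i : Y ⟶ X`. -/
def subAn {Y : Scheme.{u}} (i : Y ⟶ X) : Set (Analytification f) :=
  {x | ∃ g : Spec (X.residueField x.point) ⟶ Y, g ≫ i = X.fromSpecResidueField x.point}

variable (f) in
/-- The subspace `Y^ℶ` of `X^ℶ`, for `i : Y ⟶ X`. -/
def subBeth {Y : Scheme.{u}} (i : Y ⟶ X) : Set (Beth f) :=
  {x | ∃ g : Spec (CommRingCat.of x.toAn.integers) ⟶ Y, g ≫ i = x.integral}

/-- `-log : ℝ_{≥0} → ℝ ∪ {∞}`, as a homomorphism from multiplication to addition. -/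
def negLog : ℝ≥0 →* Multiplicative (WithTop ℝ) where
  toFun r := Multiplicative.ofAdd (if r = 0 then ⊤ else ((-Real.log r : ℝ) : WithTop ℝ))
  map_one' := by simp
  map_mul' a b := by
    rcases eq_or_ne a 0 with rfl | ha
    · rw [zero_mul, if_pos rfl, ← ofAdd_add, top_add]
    rcases eq_or_ne b 0 with rfl | hb
    · rw [mul_zero, if_pos rfl, ← ofAdd_add, add_top]
    rw [if_neg ha, if_neg hb, if_neg (mul_ne_zero ha hb), ← ofAdd_add, ← WithTop.coe_add,
      NNReal.coe_mul, Real.log_mul (by exact_mod_cast ha) (by exact_mod_cast hb), neg_add]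

/-- `-log : [0, 1] → [0, ∞]`. -/
def negLogUnit (r : ℝ≥0) : ℝ≥0∞ :=
  if r = 0 then ⊤ else ENNReal.ofReal (-Real.log r)

end Analytification

/-! ### The Kajiwara-Payne tropicalization -/

section KajiwaraPayne

variable (k : Type u) [Field k] {M : Type u} [AddCommGroup M] (Δ : Fan M)

/-- `N_ℝ(σ) = Hom(S_σ, ℝ ∪ {∞})`. -/
def LocalTrop (σ : Δ.Cone) : Type u := Δ.S σ →+ WithTop ℝ

/-- The topology of pointwise convergence. -/
instance (σ : Δ.Cone) : TopologicalSpace (LocalTrop Δ σ) :=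
  TopologicalSpace.induced (fun u : Δ.S σ →+ WithTop ℝ => (u : Δ.S σ → WithTop ℝ)) inferInstance

/-- For `τ ≤ σ`, an element of `N_ℝ(τ)` is identified with its restriction to `S_σ`. -/
def tropGlue (p q : Σ σ : Δ.Cone, LocalTrop Δ σ) : Prop :=
  ∃ h : p.1 ≤ q.1, q.2 = AddMonoidHom.comp (p.2 : Δ.S p.1 →+ WithTop ℝ) (Δ.incl h)

/-- The partial compactification `N_ℝ(Δ)` of `N_ℝ`, the gluing of the spaces `N_ℝ(σ)`, with the
quotient topology. -/
def NRDelta : Type u := Quot (tropGlue Δ)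

instance : TopologicalSpace (NRDelta Δ) :=
  inferInstanceAs (TopologicalSpace (Quot (tropGlue Δ)))

/-- The point of `N_ℝ(Δ)` given by an element of `N_ℝ(σ)`. -/
def NRDelta.mk (σ : Δ.Cone) (u : Δ.S σ →+ WithTop ℝ) : NRDelta Δ := Quot.mk _ ⟨σ, u⟩

/-- The union of the cones of `Δ`, as a subset of `N_ℝ(Δ)`. -/
def fanSupport : Set (NRDelta Δ) :=
  {p | ∃ (σ : Δ.Cone) (u : M →+ ℝ), u ∈ σ.1 ∧
    p = NRDelta.mk Δ σ ((WithTop.addHom : ℝ →+ WithTop ℝ).comp (u.comp (Δ.S σ).subtype))}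

/-- The closure of `Δ` in `N_ℝ(Δ)`. -/
def closureFan : Set (NRDelta Δ) := closure (fanSupport Δ)

variable {Δ}

/-- The homomorphism `s ↦ -log |g(χ^s)|` for a homomorphism `g` from `k[S_σ]` to a valued field. -/
def tropHom {σ : Δ.Cone} {K : Type u} [Field K] (v : Valuation K ℝ≥0)
    (g : coordRing k Δ σ →+* K) : Δ.S σ →+ WithTop ℝ :=
  MonoidHom.toAdditiveRight (negLog.comp ((v.toMonoidWithZeroHom : K →* ℝ≥0).comp
    ((g : coordRing k Δ σ →* K).comp (AddMonoidAlgebra.of k (Δ.S σ)))))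

lemma tropHom_apply {σ : Δ.Cone} {K : Type u} [Field K] (v : Valuation K ℝ≥0)
    (g : coordRing k Δ σ →+* K) (s : Δ.S σ) :
    tropHom k v g s = (negLog (v (g (character k Δ σ s)))).toAdd := rfl

lemma exists_chart (x : toricVariety k Δ) : ∃ (σ : Δ.Cone)
    (g : CommRingCat.of (coordRing k Δ σ) ⟶ (toricVariety k Δ).residueField x),
      Spec.map g ≫ toricChart k Δ σ = (toricVariety k Δ).fromSpecResidueField x := by
  obtain ⟨σ, y, hy⟩ := Scheme.IsLocallyDirected.ι_jointly_surjective (toricDiagram k Δ) x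
  have h : Set.range ((toricVariety k Δ).fromSpecResidueField x) ⊆
      Set.range (toricChart k Δ σ) := by
    rw [Scheme.range_fromSpecResidueField, Set.singleton_subset_iff]
    exact ⟨y, hy⟩
  refine ⟨σ, Spec.preimage (IsOpenImmersion.lift (toricChart k Δ σ) _ h), ?_⟩
  rw [Spec.map_preimage]
  exact IsOpenImmersion.lift_fac _ _ _

/-- The tropicalization map `trop_Δ : X(Δ)^an → N_ℝ(Δ)`, which sends `x ∈ U_σ^an` to the
homomorphism `s ↦ -log |χ^s|_x` on `S_σ`; see `tropToric_eq` for the independence of `σ`. -/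
def tropToric (x : Analytification (toricStructure k Δ)) : NRDelta Δ :=
  NRDelta.mk Δ (exists_chart k x.point).choose
    (tropHom k x.val (exists_chart k x.point).choose_spec.choose.hom)

lemma tropToric_eq (x : Analytification (toricStructure k Δ)) (σ : Δ.Cone)
    (g : CommRingCat.of (coordRing k Δ σ) ⟶ (toricVariety k Δ).residueField x.point)
    (hg : Spec.map g ≫ toricChart k Δ σ = (toricVariety k Δ).fromSpecResidueField x.point) :
    tropToric k x = NRDelta.mk Δ σ (tropHom k x.val g.hom) := by
  have main : ∀ (l τ : Δ.Cone) (hl : l ≤ τ)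
      (gl : CommRingCat.of (coordRing k Δ l) ⟶ (toricVariety k Δ).residueField x.point)
      (gt : CommRingCat.of (coordRing k Δ τ) ⟶ (toricVariety k Δ).residueField x.point)
      (_ : Spec.map gl ≫ toricChart k Δ l = (toricVariety k Δ).fromSpecResidueField x.point)
      (_ : Spec.map gt ≫ toricChart k Δ τ = (toricVariety k Δ).fromSpecResidueField x.point),
      NRDelta.mk Δ l (tropHom k x.val gl.hom) = NRDelta.mk Δ τ (tropHom k x.val gt.hom) := by
    intro l τ hl gl gt h1 h2
    have hw : (toricDiagram k Δ).map (homOfLE hl) ≫ toricChart k Δ τ = toricChart k Δ l :=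
      Limits.colimit.w (toricDiagram k Δ) (homOfLE hl)
    have h3 : Spec.map (CommRingCat.ofHom (coordMap k Δ hl).toRingHom ≫ gl) = Spec.map gt := by
      rw [← cancel_mono (toricChart k Δ τ), h2, ← h1, ← hw, Spec.map_comp, Category.assoc]
      rfl
    have h4 := Spec.map_injective h3
    refine Quot.sound ⟨hl, ?_⟩
    change tropHom k x.val gt.hom = (tropHom k x.val gl.hom).comp (Δ.incl hl)
    ext s
    rw [← h4, AddMonoidHom.comp_apply, tropHom_apply, tropHom_apply]
    have : coordMap k Δ hl (character k Δ τ s) = character k Δ l (Δ.incl hl s) :=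
      coordMap_single k Δ hl s 1
    rw [← this]
    rfl
  set τ := (exists_chart k x.point).choose with hτ
  have hgt := (exists_chart k x.point).choose_spec.choose_spec
  set gt := (exists_chart k x.point).choose_spec.choose
  have mem : ∀ (τ : Δ.Cone)
      (gt : CommRingCat.of (coordRing k Δ τ) ⟶ (toricVariety k Δ).residueField x.point)
      (_ : Spec.map gt ≫ toricChart k Δ τ = (toricVariety k Δ).fromSpecResidueField x.point),
      ∃ y, toricChart k Δ τ y = x.point := by
    intro τ gt h
    let p : Spec ((toricVariety k Δ).residueField x.point) := IsLocalRing.closedPoint _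
    exact ⟨Spec.map gt p, (congrArg (fun f : _ ⟶ toricVariety k Δ => f p) h).trans
      (Scheme.fromSpecResidueField_apply _ _)⟩
  obtain ⟨y, hy⟩ := mem σ g hg
  obtain ⟨z, hz⟩ := mem τ gt hgt
  obtain ⟨l, fi, fj, w, hw1, -⟩ := (Scheme.IsLocallyDirected.ι_eq_ι_iff (toricDiagram k Δ)).1
    (hy.trans hz.symm)
  have hwl : toricChart k Δ l w = x.point := by
    rw [← hy, ← hw1]
    exact congrArg (fun f : _ ⟶ toricVariety k Δ => f w)
      (Limits.colimit.w (toricDiagram k Δ) fi).symm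
  have h : Set.range ((toricVariety k Δ).fromSpecResidueField x.point) ⊆
      Set.range (toricChart k Δ l) := by
    rw [Scheme.range_fromSpecResidueField, Set.singleton_subset_iff]
    exact ⟨w, hwl⟩
  have hgl : Spec.map (Spec.preimage (IsOpenImmersion.lift (toricChart k Δ l) _ h)) ≫
      toricChart k Δ l = (toricVariety k Δ).fromSpecResidueField x.point := by
    rw [Spec.map_preimage]
    exact IsOpenImmersion.lift_fac _ _ _
  exact (main l τ (leOfHom fj) _ gt hgl hgt).symm.trans (main l σ (leOfHom fi) _ g hgl hg)

/-- The extended tropical variety `Trop(Y, Δ) = trop_Δ(Y^an)`. -/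
def TropToric {Y : Scheme.{u}} (i : Y ⟶ toricVariety k Δ) : Set (NRDelta Δ) :=
  tropToric k '' subAn (toricStructure k Δ) i

end KajiwaraPayne

/-! ### Monoidal spaces and Kato fans -/

/-- A locally monoidal space. The sheaf of monoids is given through its étalé space, that is by
its stalks together with the functions `x ↦ s(x)` into the stalks which are the germs of a
section `s`. -/
structure MonoidalSpace where
  carrier : Type u
  [topology : TopologicalSpace carrier]
  stalk : carrier → Type u
  [monoid : ∀ x, CommMonoid (stalk x)]
  IsSection : ∀ U : Opens carrier, (∀ x : U, stalk x) → Prop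
  isSection_one : ∀ U, IsSection U fun _ => 1
  isSection_mul : ∀ U s t, IsSection U s → IsSection U t → IsSection U fun x => s x * t x
  isSection_res : ∀ (U V : Opens carrier) (h : V ≤ U) (s : ∀ x : U, stalk x),
    IsSection U s → IsSection V fun x => s ⟨x, h x.2⟩
  isSection_local : ∀ (U : Opens carrier) (s : ∀ x : U, stalk x),
    (∀ x : U, ∃ (V : Opens carrier) (h : V ≤ U), x.1 ∈ V ∧ IsSection V fun y => s ⟨y, h y.2⟩) →
      IsSection U s
  exists_section : ∀ (x : carrier) (a : stalk x), ∃ (U : Opens carrier) (hx : x ∈ U)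
    (s : ∀ y : U, stalk y), IsSection U s ∧ s ⟨x, hx⟩ = a
  eq_nearby : ∀ (U : Opens carrier) (s t : ∀ y : U, stalk y), IsSection U s → IsSection U t →
    ∀ x : U, s x = t x → ∃ (V : Opens carrier) (h : V ≤ U), x.1 ∈ V ∧
      ∀ y : V, s ⟨y, h y.2⟩ = t ⟨y, h y.2⟩

namespace MonoidalSpace

attribute [instance] MonoidalSpace.topology MonoidalSpace.monoid

/-- A sharp monoidal space: the stalks have no units except the identity. -/
def IsSharp (X : MonoidalSpace.{u}) : Prop :=
  ∀ (x : X.carrier) (a : X.stalk x), IsUnit a → a = 1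

/-- A morphism of locally monoidal spaces: a continuous map together with a homomorphism of
sheaves of monoids (given on the stalks) which is local on the stalks. -/
@[ext]
structure Hom (X : MonoidalSpace.{v}) (Y : MonoidalSpace.{u}) where
  base : X.carrier → Y.carrier
  continuous_base : Continuous base
  stalkMap : ∀ x, Y.stalk (base x) →* X.stalk x
  isLocal : ∀ x (a : Y.stalk (base x)), IsUnit (stalkMap x a) → IsUnit a
  isSection_comp : ∀ (V : Opens Y.carrier) (s : ∀ y : V, Y.stalk y), Y.IsSection V s →
    X.IsSection ⟨base ⁻¹' V, V.2.preimage continuous_base⟩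
      fun x => stalkMap x.1 (s ⟨base x.1, x.2⟩)

/-- The composition `X ⟶ Y ⟶ Z`. -/
def Hom.comp {X : MonoidalSpace.{u}} {Y : MonoidalSpace.{v}} {Z : MonoidalSpace.{w}}
    (f : Hom X Y) (g : Hom Y Z) : Hom X Z where
  base := g.base ∘ f.base
  continuous_base := g.continuous_base.comp f.continuous_base
  stalkMap x := (f.stalkMap x).comp (g.stalkMap (f.base x))
  isLocal _ _ h := g.isLocal _ _ (f.isLocal _ _ h)
  isSection_comp V s hs := f.isSection_comp _ _ (g.isSection_comp V s hs)

/-- A strict morphism `f : X ⟶ Y`: the map `f^{-1} 𝒪_Y → 𝒪_X` is an isomorphism. -/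
def Hom.IsStrict {X : MonoidalSpace.{v}} {Y : MonoidalSpace.{u}} (f : Hom X Y) : Prop :=
  ∀ x, Function.Bijective (f.stalkMap x)

/-- `f` is an isomorphism onto an open subspace of `Y`. -/
def Hom.IsOpenImmersion {X : MonoidalSpace.{v}} {Y : MonoidalSpace.{u}} (f : Hom X Y) : Prop :=
  Topology.IsOpenEmbedding f.base ∧ f.IsStrict

end MonoidalSpace

/-- A prime ideal of a (multiplicatively written) commutative monoid; the empty ideal is
allowed. -/
@[ext]
structure MonoidPrime (P : Type u) [CommMonoid P] where
  ideal : Set P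
  mul_mem : ∀ a b, b ∈ ideal → a * b ∈ ideal
  one_notMem : (1 : P) ∉ ideal
  mul_notMem : ∀ a b, a ∉ ideal → b ∉ ideal → a * b ∉ ideal

namespace MonoidPrime

variable (P : Type u) [CommMonoid P]

/-- The maximal ideal `P - P^*`. -/
def maximal : MonoidPrime P where
  ideal := {a | ¬ IsUnit a}
  mul_mem _ _ hb h := hb (isUnit_of_mul_isUnit_right h)
  one_notMem h := h isUnit_one
  mul_notMem _ _ ha hb h := h ((not_not.1 ha).mul (not_not.1 hb))

variable {P}

/-- The complement of a prime ideal. -/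
def compl (p : MonoidPrime P) : Submonoid P where
  carrier := p.idealᶜ
  one_mem' := p.one_notMem
  mul_mem' := fun ha hb => p.mul_notMem _ _ ha hb

/-- The topology generated by the sets `D(f) = {p | f ∉ p}`. -/
instance : TopologicalSpace (MonoidPrime P) :=
  TopologicalSpace.generateFrom (Set.range fun f : P => {p : MonoidPrime P | f ∉ p.ideal})

/-- The open set `D(f)`. -/
def basicOpen (f : P) : Opens (MonoidPrime P) :=
  ⟨{p | f ∉ p.ideal}, TopologicalSpace.isOpen_generateFrom_of_mem ⟨f, rfl⟩⟩

/-- The stalk `P_p / P_p^*`. -/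
abbrev Stalk (p : MonoidPrime P) : Type u := Associates (Localization p.compl)

/-- The canonical map `P → P_p / P_p^*`. It is surjective, since denominators are units. -/
def toStalk (p : MonoidPrime P) : P →* p.Stalk :=
  Associates.mkMonoidHom.comp (Localization.monoidOf p.compl).toMonoidHom

lemma toStalk_surjective (p : MonoidPrime P) : Function.Surjective p.toStalk := by
  intro a
  obtain ⟨b, rfl⟩ := Associates.mk_surjective a
  obtain ⟨⟨x, y⟩, h⟩ := (Localization.monoidOf p.compl).surj b
  refine ⟨x, ?_⟩
  change Associates.mk _ = _
  rw [Associates.mk_eq_mk_iff_associated]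
  obtain ⟨u, hu⟩ := (Localization.monoidOf p.compl).map_units y
  refine Associated.symm ⟨u, ?_⟩
  rw [hu]; exact h

lemma toStalk_eq_iff (p : MonoidPrime P) (a b : P) :
    p.toStalk a = p.toStalk b ↔ ∃ s t, s ∉ p.ideal ∧ t ∉ p.ideal ∧ s * a = t * b := by
  change Associates.mk _ = Associates.mk _ ↔ _
  rw [Associates.mk_eq_mk_iff_associated]
  set L := Localization.monoidOf p.compl
  have hu : ∀ s, s ∉ p.ideal → IsUnit (L s) := fun s hs => L.map_units ⟨s, hs⟩
  constructor
  · rintro ⟨u, hu'⟩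
    obtain ⟨⟨c, d⟩, h⟩ := L.surj (u : Localization p.compl)
    have hc : IsUnit (L c) := by
      rw [← h]; exact u.isUnit.mul (L.map_units d)
    have hcp : c ∉ p.ideal := by
      intro hcp
      obtain ⟨v, hv⟩ := hc.exists_right_inv
      obtain ⟨⟨e, g⟩, h2⟩ := L.surj v
      have h3 : L (c * e) = L g := by
        rw [map_mul, ← h2, ← mul_assoc, hv, one_mul]
      obtain ⟨t, ht⟩ := L.exists_of_eq h3
      have h4 : (t : P) * (g : P) ∉ p.ideal := p.mul_notMem _ _ t.2 g.2
      apply h4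
      rw [← ht, mul_comm c e]
      exact p.mul_mem _ _ (p.mul_mem _ _ hcp)
    have h5 : L (c * a) = L (d * b) := by
      have hu2 : L a * u = L b := hu'
      rw [map_mul, map_mul, ← hu2, ← h]
      simp only [mul_comm, mul_left_comm]
    obtain ⟨t, ht⟩ := L.exists_of_eq h5
    exact ⟨t * c, t * d, p.mul_notMem _ _ t.2 hcp, p.mul_notMem _ _ t.2 d.2, by
      rw [mul_assoc, ht, mul_assoc]⟩
  · rintro ⟨s, t, hs, ht, h⟩
    have h1 : Associated (L a) (L (s * a)) := by
      rw [map_mul, mul_comm]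
      exact ⟨(hu s hs).unit, rfl⟩
    have h2 : Associated (L (t * b)) (L b) := by
      rw [map_mul, mul_comm]
      exact Associated.symm ⟨(hu t ht).unit, rfl⟩
    rw [h] at h1
    exact h1.trans h2

end MonoidPrime

/-- The spectrum of a monoid, as a sharp monoidal space. The sections of the structure sheaf are
locally given by elements of `P` (denominators are units and hence trivial). -/
def monoidSpec (P : Type u) [CommMonoid P] : MonoidalSpace.{u} where
  carrier := MonoidPrime P
  stalk p := p.Stalk
  IsSection U s := ∀ x : U, ∃ (V : Opens (MonoidPrime P)) (h : V ≤ U) (a : P), x.1 ∈ V ∧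
    ∀ y : V, s ⟨y, h y.2⟩ = y.1.toStalk a
  isSection_one U x := ⟨U, le_rfl, 1, x.2, fun y => (map_one _).symm⟩
  isSection_mul U s t hs ht x := by
    obtain ⟨V, h, a, hx, ha⟩ := hs x
    obtain ⟨V', h', a', hx', ha'⟩ := ht x
    refine ⟨V ⊓ V', inf_le_left.trans h, a * a', ⟨hx, hx'⟩, fun y => ?_⟩
    rw [map_mul]
    exact congrArg₂ _ (ha ⟨y, y.2.1⟩) (ha' ⟨y, y.2.2⟩)
  isSection_res U V h s hs x := by
    obtain ⟨W, hW, a, hx, ha⟩ := hs ⟨x, h x.2⟩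
    exact ⟨W ⊓ V, inf_le_right, a, ⟨hx, x.2⟩, fun y => ha ⟨y, y.2.1⟩⟩
  isSection_local U s hs x := by
    obtain ⟨V, h, hx, hV⟩ := hs x
    obtain ⟨W, hW, a, hx', ha⟩ := hV ⟨x, hx⟩
    exact ⟨W, hW.trans h, a, hx', ha⟩
  exists_section x a := by
    obtain ⟨b, rfl⟩ := x.toStalk_surjective a
    exact ⟨⊤, trivial, fun y => y.1.toStalk b, fun z => ⟨⊤, le_rfl, b, trivial, fun _ => rfl⟩, rfl⟩
  eq_nearby U s t hs ht x hx := by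
    obtain ⟨V, h, a, hxV, ha⟩ := hs x
    obtain ⟨V', h', a', hxV', ha'⟩ := ht x
    have e : x.1.toStalk a = x.1.toStalk a' :=
      (ha ⟨x, hxV⟩).symm.trans (hx.trans (ha' ⟨x, hxV'⟩))
    obtain ⟨c, d, hc, hd, hcd⟩ := (MonoidPrime.toStalk_eq_iff _ _ _).1 e
    refine ⟨V ⊓ V' ⊓ (MonoidPrime.basicOpen c ⊓ MonoidPrime.basicOpen d),
      inf_le_left.trans (inf_le_left.trans h), ⟨⟨hxV, hxV'⟩, hc, hd⟩, fun y => ?_⟩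
    refine (ha ⟨y, y.2.1.1⟩).trans (Eq.trans ?_ (ha' ⟨y, y.2.1.2⟩).symm)
    exact (MonoidPrime.toStalk_eq_iff _ _ _).2 ⟨c, d, y.2.2.1, y.2.2.2, hcd⟩

/-- A fine and saturated monoid: finitely generated, cancellative (that is, `P → P^gp` is
injective), and every `a / b ∈ P^gp` with `(a / b)^n ∈ P` for some `n > 0` belongs to `P`. -/
def IsFineSaturated (P : Type u) [CommMonoid P] : Prop :=
  Monoid.FG P ∧ (∀ a b c : P, a * b = a * c → b = c) ∧
    ∀ (a b : P) (n : ℕ), 0 < n → (∃ c, a ^ n = b ^ n * c) → ∃ c, a = b * c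

/-- A Kato fan: a sharp monoidal space which is locally isomorphic to spectra of monoids. -/
def IsKatoFan (F : MonoidalSpace.{u}) : Prop :=
  F.IsSharp ∧ ∀ x : F.carrier, ∃ (P : Type u) (_ : CommMonoid P)
    (j : MonoidalSpace.Hom (monoidSpec P) F), j.IsOpenImmersion ∧ x ∈ Set.range j.base

/-- A fine and saturated Kato fan: it is quasi-compact, and every open affine subset is isomorphic
to the spectrum of a fine and saturated monoid. -/
def IsFineSaturatedKatoFan (F : MonoidalSpace.{u}) : Prop :=
  IsKatoFan F ∧ CompactSpace F.carrier ∧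
    ∀ (P : Type u) (_ : CommMonoid P) (j : MonoidalSpace.Hom (monoidSpec P) F),
      j.IsOpenImmersion → ∃ (Q : Type u) (_ : CommMonoid Q)
        (j' : MonoidalSpace.Hom (monoidSpec Q) F), IsFineSaturated Q ∧ j'.IsOpenImmersion ∧
          Set.range j'.base = Set.range j.base

/-- The extended cone complex `F(ℝ_{≥0} ∪ {∞})` of a Kato fan, the set of morphisms
`Spec (ℝ_{≥0} ∪ {∞}) ⟶ F`. -/
def ExtendedConeComplex (F : MonoidalSpace.{u}) : Type u :=
  MonoidalSpace.Hom (monoidSpec (Multiplicative ℝ≥0∞)) F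

/-- The closed point of `Spec (ℝ_{≥0} ∪ {∞})`. -/
def closedPt : MonoidPrime (Multiplicative ℝ≥0∞) := MonoidPrime.maximal _

/-! ### Divisorial logarithmic structures and their tropicalization -/

section Log

variable (X : Scheme.{u}) (X₀ : X.Opens)

/-- The divisorial logarithmic structure on `X` with respect to the boundary `X - X₀`:
`M(U) = {f ∈ 𝒪_X(U) | f is invertible on U ∩ X₀}`. -/
def logSections (U : X.Opens) : Submonoid Γ(X, U) :=
  (IsUnit.submonoid Γ(X, U ⊓ X₀)).comap
    ((X.presheaf.map (homOfLE (inf_le_left : U ⊓ X₀ ≤ U)).op).hom : Γ(X, U) →* Γ(X, U ⊓ X₀))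

lemma logSections_res {U V : X.Opens} (h : V ≤ U) {f : Γ(X, U)} (hf : f ∈ logSections X X₀ U) :
    X.presheaf.map (homOfLE h).op f ∈ logSections X X₀ V := by
  have h1 : IsUnit (X.presheaf.map (homOfLE (inf_le_left : U ⊓ X₀ ≤ U)).op f) := hf
  have h2 := h1.map (X.presheaf.map (homOfLE (inf_le_inf_right X₀ h : V ⊓ X₀ ≤ U ⊓ X₀)).op).hom
  change IsUnit (X.presheaf.map (homOfLE (inf_le_left : V ⊓ X₀ ≤ V)).op
    (X.presheaf.map (homOfLE h).op f))
  rw [← ConcreteCategory.comp_apply, ← Functor.map_comp]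
  change IsUnit (X.presheaf.map _ (X.presheaf.map _ f)) at h2
  rw [← ConcreteCategory.comp_apply, ← Functor.map_comp] at h2
  exact h2

/-- The stalk `M_x ⊆ 𝒪_{X,x}` of the logarithmic structure. -/
def logStalk (x : X) : Submonoid (X.presheaf.stalk x) where
  carrier := {a | ∃ (U : X.Opens) (hx : x ∈ U) (f : Γ(X, U)), f ∈ logSections X X₀ U ∧
    X.presheaf.germ U x hx f = a}
  one_mem' := ⟨⊤, trivial, 1, one_mem _, map_one _⟩
  mul_mem' := by
    rintro _ _ ⟨U, hU, f, hf, rfl⟩ ⟨V, hV, g, hg, rfl⟩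
    have hUV : x ∈ U ⊓ V := ⟨hU, hV⟩
    refine ⟨U ⊓ V, hUV, _, mul_mem (logSections_res X X₀ inf_le_left hf)
      (logSections_res X X₀ inf_le_right hg), (map_mul _ _ _).trans ?_⟩
    exact congrArg₂ _ (X.presheaf.germ_res_apply _ _ hUV _) (X.presheaf.germ_res_apply _ _ hUV _)

variable {X X₀} in
/-- The germ at `x` of a section of the logarithmic structure. -/
def logGerm {U : X.Opens} (f : logSections X X₀ U) (x : X) (hx : x ∈ U) : logStalk X X₀ x :=
  ⟨X.presheaf.germ U x hx f.1, U, hx, f.1, f.2, rfl⟩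

variable {X X₀} in
lemma logGerm_res {U V : X.Opens} (h : V ≤ U) (f : logSections X X₀ U) (x : X) (hx : x ∈ V) :
    logGerm ⟨_, logSections_res X X₀ h f.2⟩ x hx = logGerm f x (h hx) :=
  Subtype.ext (X.presheaf.germ_res_apply _ _ _ _)

variable {X X₀} in
lemma exists_logGerm {x : X} (a : logStalk X X₀ x) :
    ∃ (U : X.Opens) (hx : x ∈ U) (f : logSections X X₀ U), logGerm f x hx = a := by
  obtain ⟨a, U, hx, f, hf, rfl⟩ := a
  exact ⟨U, hx, ⟨f, hf⟩, rfl⟩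

variable {X X₀} in
lemma logGerm_mul_nearby {A B C : X.Opens} (a : logSections X X₀ A) (b : logSections X X₀ B)
    (c : logSections X X₀ C) (x : X) (hA : x ∈ A) (hB : x ∈ B) (hC : x ∈ C)
    (h : logGerm a x hA * logGerm b x hB = logGerm c x hC) :
    ∃ (W : X.Opens) (wA : W ≤ A) (wB : W ≤ B) (wC : W ≤ C), x ∈ W ∧
      ∀ (y : X) (hy : y ∈ W), logGerm a y (wA hy) * logGerm b y (wB hy) = logGerm c y (wC hy) := by
  let p : logSections X X₀ (A ⊓ B) := ⟨_, logSections_res X X₀ inf_le_left a.2⟩ *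
    ⟨_, logSections_res X X₀ inf_le_right b.2⟩
  have hp : ∀ y (hy : y ∈ A ⊓ B), logGerm p y hy = logGerm a y hy.1 * logGerm b y hy.2 := by
    intro y hy
    rw [← logGerm_res inf_le_left a y hy, ← logGerm_res inf_le_right b y hy]
    exact Subtype.ext (map_mul _ _ _)
  have hAB : x ∈ A ⊓ B := ⟨hA, hB⟩
  have h1 : X.presheaf.germ (A ⊓ B) x hAB p.1 = X.presheaf.germ C x hC c.1 :=
    congrArg Subtype.val ((hp x hAB).trans h)
  obtain ⟨W, hxW, i, j, hW⟩ := X.presheaf.germ_eq x hAB hC _ _ h1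
  refine ⟨W, (leOfHom i).trans inf_le_left, (leOfHom i).trans inf_le_right, leOfHom j, hxW,
    fun y hy => (hp y (leOfHom i hy)).symm.trans (Subtype.ext ?_)⟩
  change X.presheaf.germ _ y _ p.1 = X.presheaf.germ _ y _ c.1
  rw [← X.presheaf.germ_res_apply i y hy, ← X.presheaf.germ_res_apply j y hy, hW]

variable {X X₀} in
lemma associated_nearby {A C : X.Opens} (a : logSections X X₀ A) (c : logSections X X₀ C) (x : X)
    (hA : x ∈ A) (hC : x ∈ C) (h : Associated (logGerm a x hA) (logGerm c x hC)) :
    ∃ (W : X.Opens) (wA : W ≤ A) (wC : W ≤ C), x ∈ W ∧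
      ∀ (y : X) (hy : y ∈ W), Associated (logGerm a y (wA hy)) (logGerm c y (wC hy)) := by
  obtain ⟨u, hu⟩ := h
  obtain ⟨B, hB, b, hb⟩ := exists_logGerm (u : logStalk X X₀ x)
  obtain ⟨D, hD, d, hd⟩ := exists_logGerm ((u⁻¹ : (logStalk X X₀ x)ˣ) : logStalk X X₀ x)
  obtain ⟨W, w1, w2, w3, hxW, hW⟩ := logGerm_mul_nearby a b c x hA hB hC (by rw [hb, hu])
  obtain ⟨W', w1', w2', _, hxW', hW'⟩ := logGerm_mul_nearby b d (1 : logSections X X₀ ⊤) x hB hD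
    trivial (by
      rw [hb, hd, Units.mul_inv]
      exact (Subtype.ext (map_one _)).symm)
  refine ⟨W ⊓ W', inf_le_left.trans w1, inf_le_left.trans w3, ⟨hxW, hxW'⟩, fun y hy => ?_⟩
  have hunit : IsUnit (logGerm b y (w2 hy.1)) :=
    IsUnit.of_mul_eq_one (logGerm d y (w2' hy.2))
      ((hW' y hy.2).trans (Subtype.ext (map_one _)))
  exact ⟨hunit.unit, hW y hy.1⟩

/-- The monoidal space `(X, M / M^*)` given by the characteristic sheaf of the logarithmic
structure. Its stalk at `x` is `M_x / M_x^*`, and its sections are locally the classes of sections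
of `M`. -/
def charSpace : MonoidalSpace.{u} where
  carrier := X
  stalk x := Associates (logStalk X X₀ x)
  IsSection U s := ∀ x : U, ∃ (V : X.Opens) (h : V ≤ U) (f : logSections X X₀ V), x.1 ∈ V ∧
    ∀ y : V, s ⟨y, h y.2⟩ = Associates.mk (logGerm f y.1 y.2)
  isSection_one U x := ⟨U, le_rfl, 1, x.2, fun y => by
    rw [show logGerm (1 : logSections X X₀ U) y.1 y.2 = 1 from Subtype.ext (map_one _)]
    exact Associates.mk_one.symm⟩
  isSection_mul U s t hs ht x := by
    obtain ⟨V, h, a, hx, ha⟩ := hs x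
    obtain ⟨V', h', a', hx', ha'⟩ := ht x
    refine ⟨V ⊓ V', inf_le_left.trans h,
      ⟨_, logSections_res X X₀ inf_le_left a.2⟩ * ⟨_, logSections_res X X₀ inf_le_right a'.2⟩,
      ⟨hx, hx'⟩, fun y => ?_⟩
    refine (congrArg₂ _ (ha ⟨y, y.2.1⟩) (ha' ⟨y, y.2.2⟩)).trans ?_
    rw [← logGerm_res inf_le_left a y.1 y.2, ← logGerm_res inf_le_right a' y.1 y.2]
    refine (Associates.mk_mul_mk).trans (congrArg _ (Subtype.ext ?_))
    exact (map_mul _ _ _).symm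
  isSection_res U V h s hs x := by
    obtain ⟨W, hW, a, hx, ha⟩ := hs ⟨x, h x.2⟩
    refine ⟨W ⊓ V, inf_le_right, ⟨_, logSections_res X X₀ inf_le_left a.2⟩, ⟨hx, x.2⟩,
      fun y => ?_⟩
    rw [logGerm_res inf_le_left a y.1 y.2]
    exact ha ⟨y, y.2.1⟩
  isSection_local U s hs x := by
    obtain ⟨V, h, hx, hV⟩ := hs x
    obtain ⟨W, hW, a, hx', ha⟩ := hV ⟨x, hx⟩
    exact ⟨W, hW.trans h, a, hx', ha⟩
  exists_section x a := by
    obtain ⟨⟨b, U, hx, f, hf, rfl⟩, rfl⟩ := Associates.mk_surjective a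
    exact ⟨U, hx, fun y => Associates.mk (logGerm ⟨f, hf⟩ y.1 y.2),
      fun z => ⟨U, le_rfl, ⟨f, hf⟩, z.2, fun _ => rfl⟩, rfl⟩
  eq_nearby U s t hs ht x hx := by
    obtain ⟨V, h, a, hxV, ha⟩ := hs x
    obtain ⟨V', h', a', hxV', ha'⟩ := ht x
    have e : Associates.mk (logGerm a x.1 hxV) = Associates.mk (logGerm a' x.1 hxV') :=
      (ha ⟨x, hxV⟩).symm.trans (hx.trans (ha' ⟨x, hxV'⟩))
    obtain ⟨W, hW, hW', hxW, hass⟩ := associated_nearby a a' x.1 hxV hxV'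
      (Associates.mk_eq_mk_iff_associated.1 e)
    refine ⟨W, hW.trans h, hxW, fun y => ?_⟩
    refine (ha ⟨y, hW y.2⟩).trans (Eq.trans ?_ (ha' ⟨y, hW' y.2⟩).symm)
    exact Associates.mk_eq_mk_iff_associated.2 (hass y.1 y.2)

variable {X X₀}

/-- The characteristic morphism `φ_X : (X, M / M^*) ⟶ F_X` into the Kato fan `F_X` associated to
the logarithmic structure, defined by its universal property: it is initial among the strict
morphisms from `(X, M / M^*)` into fine and saturated Kato fans. -/
def IsCharacteristicMorphism {F : MonoidalSpace.{u}} (φ : MonoidalSpace.Hom (charSpace X X₀) F) :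
    Prop :=
  IsFineSaturatedKatoFan F ∧ φ.IsStrict ∧
    ∀ (G : MonoidalSpace.{u}) (ψ : MonoidalSpace.Hom (charSpace X X₀) G),
      IsFineSaturatedKatoFan G → ψ.IsStrict →
        ∃! h : MonoidalSpace.Hom F G, h.IsStrict ∧ φ.comp h = ψ

variable {k : Type u} [Field k] {f : X ⟶ Spec (CommRingCat.of k)}

/-- `u = trop_X(x)`: the morphism `u : Spec (ℝ_{≥0} ∪ {∞}) ⟶ F_X` is induced by
`φ_X : (X, M / M^*) ⟶ F_X`, `Spec R ⟶ X` and the valuation `-log |·|_x : R → ℝ_{≥0} ∪ {∞}`.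
That is, `u` sends the closed point to `φ_X(r(x))`, and the homomorphism which `u` induces on the
stalks at the closed point is given by
`𝒪_{F, φ(r(x))} ≃ M_{r(x)} / M_{r(x)}^* → R / R^* → ℝ_{≥0} ∪ {∞}`. -/
def IsTropicalization {F : MonoidalSpace.{u}} (φ : MonoidalSpace.Hom (charSpace X X₀) F)
    (x : Beth f) (u : ExtendedConeComplex F) : Prop :=
  u.base closedPt = φ.base x.red ∧
    ∀ (V : Opens F.carrier) (t : ∀ y : V, F.stalk y) (_ : F.IsSection V t)
      (h : φ.base x.red ∈ V) (h' : u.base closedPt ∈ V) (m : logStalk X X₀ x.red),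
        φ.stalkMap x.red (t ⟨_, h⟩) = Associates.mk m →
          u.stalkMap closedPt (t ⟨_, h'⟩) =
            closedPt.toStalk (Multiplicative.ofAdd (negLogUnit (x.absGerm m.1)))

/-- The tropical variety `Trop_X(Y) = trop_X(Y^ℶ)`. -/
def TropLogVariety (f : X ⟶ Spec (CommRingCat.of k)) {F : MonoidalSpace.{u}}
    (φ : MonoidalSpace.Hom (charSpace X X₀) F) {Y : Scheme.{u}} (i : Y ⟶ X) :
    Set (ExtendedConeComplex F) :=
  {u | ∃ x ∈ subBeth f i, IsTropicalization φ x u}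

end Log

end

end TropLog

open TropLog

universe u

/-!
The argument rests on an explicit description of the characteristic morphism of a toric variety and
of the extended cone complex.

*The Kato fan.* The characteristic morphism of `X(Δ)` goes to the fan itself: `fanSpace Δ` is the
set of cones of `Δ`, with the faces of a cone as its smallest neighbourhood and with stalk
`S_σ / S_σ^*` at `σ`. The morphism `toricCharMorphism` sends the orbit of `σ` to `σ`. It is strict
(`charClass_bijective`) because, in the local ring of a point of the closed orbit of `U_σ`, every
divisor of a character is a character times a unit; this is shown by looking at the minima of the
elements of `σ` on supports of Laurent polynomials (`exists_eq_character_mul_of_mul_eq`). It is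
initial because the generic points of the orbits form a strict section of it, and every point of
`X(Δ)` is a specialization of the generic point of its orbit, from which no strict morphism to a
Kato fan can separate it (`existsUnique_strict_of_section`).

*The cone complex.* A point of the extended cone complex is thus a cone `σ` together with a local
homomorphism `S_σ → [0, ∞]`. In `N_ℝ(Δ)` these are exactly the points which are given by
non-negative homomorphisms on some `S_σ` (`exists_isLocalTrop`), in a unique way because two cones
of a fan are separated by a character (`IsLocalTrop.cone_eq`). The points given by non-negative
homomorphisms form the closure of the fan (`mem_closureFan_iff`): they form a closed set, and each
of them is a limit of vectors `u + t v` of a cone as `t` tends to infinity. This yields the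
embedding `toNRDelta` and its range, and the compatibility with the tropicalization maps is read
off on characters (`toNRDelta_eq_tropToric`).

*Intersection with the closure.* A point `x` of `X^an` has tropicalization in the closure of the
fan if and only if, for some `σ`, it lies in `U_σ` and all characters of `S_σ` have absolute value
at most `1` at `x` (`tropToric_mem_closureFan_iff`). Then `k[S_σ]` maps to the valuation ring of
`x`, so `x` extends to a point of `X^ℶ` (`exists_beth`), and this point belongs to `Y^ℶ` if `x`
belongs to `Y^an` since `Y` is closed (`mem_subBeth_iff`).

*Properness.* By the previous step, it has to be shown that `Y` is proper if and only if
`Trop(Y, Δ)` is contained in the closure of the fan (`isProper_iff_tropToric_subset`). If `Y` is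
proper, the valuative criterion extends the points of `Y^an` to `Y^ℶ`. For the converse, `X(Δ)` is
of finite type by Gordan's lemma and separated because cones are separated by characters. Suppose
that the existence part of the valuative criterion fails for a valuation ring `V` of a residue
field of `Y`. Then for every `σ` with `U_σ` containing the point some character of `S_σ` lies
outside `V`, and the inverses of these characters are finitely many nonunits of `V`. The ring `V`
may have arbitrary rank, but there is a real valuation, trivial on `k`, which is less than `1` at
all these inverses (`exists_real_valuation_lt_one`): it comes from a minimal prime over a principal
ideal in a finitely generated subalgebra of `V`, which has height one by Krull's principal ideal
theorem. This valuation defines a point of `Y^an` with tropicalization outside the closure of the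
fan.
-/

/-! ### Duality for rational polyhedral cones -/

namespace TropLog

section Cones

variable {M : Type u} [AddCommGroup M]

/-- Fourier–Motzkin elimination of one variable `t ≥ 0` from finitely many inequalities
`t * b i ≤ a i`. -/
lemma exists_nonneg_forall_mul_le {ι : Type*} (G : Finset ι) (a b : ι → ℝ)
    (h1 : ∀ i ∈ G, 0 ≤ b i → 0 ≤ a i)
    (h2 : ∀ i ∈ G, ∀ j ∈ G, 0 < b i → b j < 0 → a i * b j ≤ a j * b i) :
    ∃ t : ℝ, 0 ≤ t ∧ ∀ i ∈ G, t * b i ≤ a i := by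
  classical
  -- the largest of the lower bounds for `t`
  let L : Finset ℝ := insert 0 ((G.filter fun j => b j < 0).image fun j => a j / b j)
  have hL : L.Nonempty := ⟨0, Finset.mem_insert_self _ _⟩
  refine ⟨L.max' hL, L.le_max' 0 (Finset.mem_insert_self _ _), fun i hi => ?_⟩
  rcases lt_trichotomy (b i) 0 with hb | hb | hb
  · have : a i / b i ≤ L.max' hL := L.le_max' _ (Finset.mem_insert_of_mem
      (Finset.mem_image_of_mem _ (Finset.mem_filter.2 ⟨hi, hb⟩)))
    rwa [div_le_iff_of_neg hb] at this
  · rw [hb, mul_zero]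
    exact h1 i hi hb.ge
  · rw [← le_div_iff₀ hb]
    refine L.max'_le hL _ fun y hy => ?_
    rcases Finset.mem_insert.1 hy with rfl | hy
    · exact div_nonneg (h1 i hi hb.le) hb.le
    · obtain ⟨j, hj, rfl⟩ := Finset.mem_image.1 hy
      obtain ⟨hj, hbj⟩ := Finset.mem_filter.1 hj
      rw [div_le_iff_of_neg hbj, div_mul_eq_mul_div, div_le_iff₀ hb]
      exact h2 i hi j hj hb hbj

/-- The vector of `N_ℝ` given by a vector of the lattice `N`. -/
abbrev latticeVec (n : M →+ ℤ) : M →+ ℝ := (Int.castAddHom ℝ).comp n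

/-- A rational polyhedral cone is cut out by finitely many integral inequalities. -/
theorem IsRationalPolyhedral.exists_finset_mem_iff [Module.Finite ℤ M]
    {σ : PointedCone ℝ (M →+ ℝ)} (hσ : IsRationalPolyhedral σ) :
    ∃ G : Finset M, ∀ u : M →+ ℝ, u ∈ σ ↔ ∀ g ∈ G, 0 ≤ u g := by
  classical
  obtain ⟨s, rfl⟩ := hσ
  induction s using Finset.induction_on with
  | empty =>
    obtain ⟨S, hS⟩ := (Module.Finite.fg_top : (⊤ : Submodule ℤ M).FG)
    refine ⟨S ∪ S.image Neg.neg, fun u => ⟨fun hu => ?_, fun hu => ?_⟩⟩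
    · have : u = 0 := by simpa [PointedCone.hull] using hu
      simp [this]
    · have : u = 0 := by
        ext m
        have hm : m ∈ Submodule.span ℤ (S : Set M) := hS ▸ trivial
        induction hm using Submodule.span_induction with
        | mem x hx =>
          have h1 := hu x (Finset.mem_union_left _ hx)
          have h2 := hu (-x) (Finset.mem_union_right _ (Finset.mem_image_of_mem _ hx))
          rw [map_neg] at h2
          exact le_antisymm (neg_nonneg.1 h2) h1
        | zero => simp
        | add x y _ _ hx hy => simp [hx, hy]
        | smul a x _ hx => simp [hx]
      rw [this]
      exact Submodule.zero_mem _
  | insert n s _ ih =>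
    obtain ⟨G, hG⟩ := ih
    -- the pairs `(g, h)` with `n g > 0 > n h` contribute the positive combinations killed by `n`
    refine ⟨G.filter (fun g => 0 ≤ n g) ∪ ((G ×ˢ G).filter
      fun p => 0 < n p.1 ∧ n p.2 < 0).image (fun p => n p.1 • p.2 - n p.2 • p.1), fun u => ?_⟩
    have key : u ∈ PointedCone.hull ℝ ((fun n : M →+ ℤ => (Int.castAddHom ℝ).comp n) ''
        ((insert n s : Finset (M →+ ℤ)) : Set (M →+ ℤ))) ↔
        ∃ t : ℝ, 0 ≤ t ∧ ∀ g ∈ G, t * n g ≤ u g := by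
      rw [Finset.coe_insert, Set.image_insert_eq, PointedCone.hull, Submodule.mem_span_insert]
      constructor
      · rintro ⟨c, z, hz, rfl⟩
        refine ⟨c, c.2, fun g hg => ?_⟩
        have := (hG z).1 hz g hg
        change _ ≤ (c : ℝ) * (n g : ℝ) + z g
        linarith
      · rintro ⟨t, ht, h⟩
        refine ⟨⟨t, ht⟩, u - t • latticeVec n, (hG _).2 fun g hg => ?_, ?_⟩
        · have := h g hg
          change 0 ≤ u g - t * (n g : ℝ)
          linarith
        · change u = t • latticeVec n + (u - t • latticeVec n)
          abel
    rw [key]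
    constructor
    · rintro ⟨t, ht, h⟩ g hg
      rcases Finset.mem_union.1 hg with hg | hg
      · obtain ⟨hg, hn⟩ := Finset.mem_filter.1 hg
        exact (mul_nonneg ht (by exact_mod_cast hn)).trans (h g hg)
      · obtain ⟨⟨p, q⟩, hpq, rfl⟩ := Finset.mem_image.1 hg
        obtain ⟨hpq, h1, h2⟩ := Finset.mem_filter.1 hpq
        obtain ⟨hp, hq⟩ := Finset.mem_product.1 hpq
        have a1 : (0 : ℝ) < n p := by exact_mod_cast h1
        have a2 : (n q : ℝ) < 0 := by exact_mod_cast h2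
        have e1 := mul_le_mul_of_nonneg_left (h q hq) a1.le
        have e2 := mul_le_mul_of_nonpos_left (h p hp) a2.le
        simp only [map_sub, map_zsmul, zsmul_eq_mul]
        nlinarith
    · intro h
      refine exists_nonneg_forall_mul_le G _ _ (fun g hg hn => ?_) fun g hg g' hg' hn hn' => ?_
      · exact h g (Finset.mem_union_left _ (Finset.mem_filter.2 ⟨hg, by exact_mod_cast hn⟩))
      · have := h (n g • g' - n g' • g) (Finset.mem_union_right _ (Finset.mem_image.2
          ⟨(g, g'), Finset.mem_filter.2 ⟨Finset.mem_product.2 ⟨hg, hg'⟩,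
            by exact_mod_cast hn, by exact_mod_cast hn'⟩, rfl⟩))
        simp only [map_sub, map_zsmul, zsmul_eq_mul] at this
        linarith

/-- **Gordan's lemma**: the monoid `S_σ` is finitely generated. -/
lemma IsRationalPolyhedral.fg_dualMonoid [Module.Finite ℤ M]
    {σ : PointedCone ℝ (M →+ ℝ)} (hσ : IsRationalPolyhedral σ) : (dualMonoid σ).FG := by
  obtain ⟨s, rfl⟩ := hσ
  obtain ⟨d, b, hb⟩ := Submodule.fg_iff_exists_fin_generating_family.1
    (Module.Finite.fg_top : (⊤ : Submodule ℤ M).FG)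
  have hmem : ∀ m, m ∈ dualMonoid (PointedCone.hull ℝ
      ((fun n : M →+ ℤ => (Int.castAddHom ℝ).comp n) '' (s : Set (M →+ ℤ)))) ↔
      ∀ n ∈ s, 0 ≤ n m := by
    intro m
    constructor
    · intro h n hn
      have h1 : (0 : ℝ) ≤ (n m : ℝ) := h _ (Submodule.subset_span ⟨n, hn, rfl⟩)
      exact_mod_cast h1
    · intro h u hu
      refine Submodule.span_induction (p := fun u _ => 0 ≤ u m) ?_ ?_ ?_ ?_ hu
      · rintro _ ⟨x, hx, rfl⟩
        exact_mod_cast Int.cast_nonneg (h x hx)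
      · simp
      · intro a b _ _ ha hb
        exact add_nonneg ha hb
      · intro a b _ hb
        exact mul_nonneg a.2 hb
  -- `S_σ` is the image of the non-negative integral solutions `(p, q, t)` of `n (p - q) = t n`
  let π : ((Fin d → ℕ) × (Fin d → ℕ)) × (s → ℕ) →+ M :=
    { toFun := fun x => ∑ i, (x.1.1 i • b i - x.1.2 i • b i)
      map_zero' := by simp
      map_add' := fun x y => by
        rw [← Finset.sum_add_distrib]
        refine Finset.sum_congr rfl fun i _ => ?_
        simp only [Prod.fst_add, Prod.snd_add, Pi.add_apply, add_smul]
        abel }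
  let f : ((Fin d → ℕ) × (Fin d → ℕ)) × (s → ℕ) →+ (s → ℤ) :=
    { toFun := fun x n => n.1 (π x)
      map_zero' := by ext; simp
      map_add' := fun x y => by ext; simp }
  let g : ((Fin d → ℕ) × (Fin d → ℕ)) × (s → ℕ) →+ (s → ℤ) :=
    { toFun := fun x n => (x.2 n : ℤ)
      map_zero' := by ext; simp
      map_add' := fun x y => by ext; simp }
  have h := (AddSubmonoid.fg_eqLocusM f g).map π
  convert h using 1
  ext m
  rw [hmem, AddSubmonoid.mem_map]
  constructor
  · intro hm
    have : m ∈ Submodule.span ℤ (Set.range b) := hb ▸ trivial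
    obtain ⟨c, hc⟩ := (Submodule.mem_span_range_iff_exists_fun ℤ).1 this
    have hπ : π ((fun i => (c i).toNat, fun i => (-c i).toNat), fun n => (n.1 m).toNat) = m := by
      change ∑ i, ((c i).toNat • b i - (-c i).toNat • b i) = m
      refine Eq.trans (Finset.sum_congr rfl fun i _ => ?_) hc
      rw [← natCast_zsmul, ← natCast_zsmul, ← sub_smul]
      congr 1
      omega
    refine ⟨_, ?_, hπ⟩
    funext n
    change n.1 (π _) = ((n.1 m).toNat : ℤ)
    rw [hπ, Int.toNat_of_nonneg (hm n.1 n.2)]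
  · rintro ⟨x, hx, rfl⟩ n hn
    have : n (π x) = (x.2 ⟨n, hn⟩ : ℤ) := congrFun hx ⟨n, hn⟩
    rw [this]
    positivity

/-- Separation of cones: two rational cones which meet in a common face lie on opposite sides of
a rational hyperplane which cuts out the common face. -/
theorem exists_separating [Module.Finite ℤ M] {σ τ : PointedCone ℝ (M →+ ℝ)}
    (hσ : IsRationalPolyhedral σ) (hτ : IsRationalPolyhedral τ)
    (h1 : IsFace (σ ⊓ τ) σ) (h2 : IsFace (σ ⊓ τ) τ) :
    ∃ m : M, m ∈ dualMonoid σ ∧ -m ∈ dualMonoid τ ∧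
      (∀ u, u ∈ σ ⊓ τ ↔ u ∈ σ ∧ u m = 0) ∧ ∀ u, u ∈ σ ⊓ τ ↔ u ∈ τ ∧ u (-m) = 0 := by
  classical
  obtain ⟨s, hs⟩ := hσ
  obtain ⟨t, ht⟩ := hτ
  -- the cone `γ = σ - τ`
  let γ : PointedCone ℝ (M →+ ℝ) := PointedCone.hull ℝ
    ((fun n : M →+ ℤ => (Int.castAddHom ℝ).comp n) '' ((s ∪ t.image Neg.neg : Finset _) : Set _))
  obtain ⟨G, hG⟩ := IsRationalPolyhedral.exists_finset_mem_iff (σ := γ) ⟨_, rfl⟩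
  have hσγ : ∀ u ∈ σ, u ∈ γ := by
    intro u hu
    rw [hs] at hu
    exact Submodule.span_mono (Set.image_mono (by simp)) hu
  have hτγ : ∀ u ∈ τ, -u ∈ γ := by
    intro u hu
    rw [ht] at hu
    refine Submodule.span_induction (p := fun u _ => -u ∈ γ) ?_ ?_ ?_ ?_ hu
    · rintro _ ⟨n, hn, rfl⟩
      refine Submodule.subset_span ⟨-n, ?_, ?_⟩
      · simpa using Or.inr hn
      · ext; simp
    · simp
    · intro a b _ _ ha hb
      rw [neg_add]
      exact add_mem ha hb
    · intro a b _ hb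
      rw [← smul_neg]
      exact Submodule.smul_mem _ _ hb
  have hγ : ∀ u ∈ γ, ∃ a ∈ σ, ∃ b ∈ τ, u = a - b := by
    intro u hu
    refine Submodule.span_induction (p := fun u _ => ∃ a ∈ σ, ∃ b ∈ τ, u = a - b) ?_ ?_ ?_ ?_ hu
    · rintro _ ⟨n, hn, rfl⟩
      rcases Finset.mem_union.1 (Finset.mem_coe.1 hn) with hn | hn
      · refine ⟨latticeVec n, ?_, 0, zero_mem _, (sub_zero _).symm⟩
        rw [hs]
        exact Submodule.subset_span ⟨n, hn, rfl⟩
      · obtain ⟨n', hn', rfl⟩ := Finset.mem_image.1 hn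
        refine ⟨0, zero_mem _, latticeVec n', ?_, by ext; simp⟩
        rw [ht]
        exact Submodule.subset_span ⟨n', hn', rfl⟩
    · exact ⟨0, zero_mem _, 0, zero_mem _, by simp⟩
    · rintro _ _ _ _ ⟨a, ha, b, hb, rfl⟩ ⟨a', ha', b', hb', rfl⟩
      exact ⟨_, add_mem ha ha', _, add_mem hb hb', by abel⟩
    · rintro c _ _ ⟨a, ha, b, hb, rfl⟩
      exact ⟨_, Submodule.smul_mem _ c ha, _, Submodule.smul_mem _ c hb, smul_sub _ _ _⟩
  -- the sum of the inequalities which cut out `γ` vanishes exactly on `γ ∩ -γ`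
  have hsum : ∀ u : M →+ ℝ, u (∑ g ∈ G, g) = ∑ g ∈ G, u g := fun u => map_sum u _ _
  have hnn : ∀ u ∈ γ, 0 ≤ u (∑ g ∈ G, g) := fun u hu => by
    rw [hsum]
    exact Finset.sum_nonneg ((hG u).1 hu)
  have hzero : ∀ u ∈ γ, u (∑ g ∈ G, g) = 0 → -u ∈ γ := fun u hu h => by
    rw [hsum, Finset.sum_eq_zero_iff_of_nonneg ((hG u).1 hu)] at h
    exact (hG _).2 fun g hg => by simp [h g hg]
  have hmσ : ∑ g ∈ G, g ∈ dualMonoid σ := fun u hu => hnn u (hσγ u hu)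
  have hmτ : -∑ g ∈ G, g ∈ dualMonoid τ := fun u hu => by
    have := hnn _ (hτγ u hu)
    rwa [map_neg]
  obtain ⟨m1, hm1, e1⟩ := h1
  obtain ⟨m2, hm2, e2⟩ := h2
  refine ⟨∑ g ∈ G, g, hmσ, hmτ, fun u => ⟨fun hu => ⟨hu.1, ?_⟩, fun hu => ?_⟩,
    fun u => ⟨fun hu => ⟨hu.2, ?_⟩, fun hu => ?_⟩⟩
  · have := hmτ u hu.2
    rw [map_neg] at this
    exact le_antisymm (by linarith) (hmσ u hu.1)
  · obtain ⟨a, ha, b, hb, hab⟩ := hγ _ (hzero u (hσγ u hu.1) hu.2)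
    have hb' : b = u + a := by rw [eq_sub_iff_add_eq] at hab; rw [← hab]; abel
    have h3 : b ∈ σ ⊓ τ := ⟨hb' ▸ add_mem hu.1 ha, hb⟩
    have h4 := ((e1 b).1 h3).2
    rw [hb', AddMonoidHom.add_apply] at h4
    exact (e1 u).2 ⟨hu.1, le_antisymm (by linarith [hm1 a ha]) (hm1 u hu.1)⟩
  · have := hmτ u hu.2
    rw [map_neg] at this ⊢
    linarith [hmσ u hu.1]
  · have hu2 : (-u) (∑ g ∈ G, g) = 0 := by simpa using hu.2
    obtain ⟨a, ha, b, hb, hab⟩ := hγ _ (hzero _ (hτγ u hu.1) hu2)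
    have hb' : a = u + b := by rw [neg_neg] at hab; rw [hab]; abel
    have h3 : a ∈ σ ⊓ τ := ⟨ha, hb' ▸ add_mem hu.1 hb⟩
    have h4 := ((e2 a).1 h3).2
    rw [hb', AddMonoidHom.add_apply] at h4
    exact (e2 u).2 ⟨hu.1, le_antisymm (by linarith [hm2 b hb]) (hm2 u hu.1)⟩

end Cones

end TropLog

/-! ### Faces and points of the partial compactification -/

namespace TropLog

section Faces

variable {M : Type u} [AddCommGroup M] (Δ : Fan M)

/-- The intersection of two cones of the fan. -/
def Fan.inf (σ τ : Δ.Cone) : Δ.Cone :=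
  ⟨σ.1 ⊓ τ.1, Δ.face_mem σ.1 σ.2 _ (Δ.inter_face σ.1 σ.2 τ.1 τ.2)⟩

lemma Fan.inf_le_left (σ τ : Δ.Cone) : Δ.inf σ τ ≤ σ := fun _ h => h.1

lemma Fan.inf_le_right (σ τ : Δ.Cone) : Δ.inf σ τ ≤ τ := fun _ h => h.2

variable {Δ}

/-- `τ = σ ∩ m^⊥`. -/
def CutsOut {τ σ : Δ.Cone} (m : Δ.S σ) : Prop :=
  ∀ u : M →+ ℝ, u ∈ τ.1 ↔ u ∈ σ.1 ∧ u m = 0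

lemma exists_cutsOut {τ σ : Δ.Cone} (h : τ ≤ σ) : ∃ m : Δ.S σ, CutsOut (τ := τ) m := by
  obtain ⟨m, hm, h⟩ := Δ.isFace_of_le h
  exact ⟨⟨m, hm⟩, h⟩

/-- The face `σ ∩ m^⊥`. -/
lemma exists_cone_cutsOut (σ : Δ.Cone) (m : Δ.S σ) :
    ∃ τ : Δ.Cone, τ ≤ σ ∧ CutsOut (τ := τ) m := by
  let τ : PointedCone ℝ (M →+ ℝ) :=
    { carrier := {u | u ∈ σ.1 ∧ u m = 0}
      zero_mem' := ⟨zero_mem _, rfl⟩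
      add_mem' := fun {a b} ha hb => ⟨add_mem ha.1 hb.1, by
        rw [AddMonoidHom.add_apply, ha.2, hb.2, add_zero]⟩
      smul_mem' := fun c a ha => ⟨Submodule.smul_mem _ _ ha.1, by
        change (c : ℝ) * a m = 0
        rw [ha.2, mul_zero]⟩ }
  exact ⟨⟨τ, Δ.face_mem σ.1 σ.2 τ ⟨m, m.2, fun _ => Iff.rfl⟩⟩, fun _ h => h.1, fun _ => Iff.rfl⟩

lemma CutsOut.neg_mem {τ σ : Δ.Cone} {m : Δ.S σ} (hm : CutsOut (τ := τ) m) :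
    -(m : M) ∈ Δ.S τ := fun u hu => by
  rw [map_neg, ((hm u).1 hu).2, neg_zero]

lemma CutsOut.le {τ σ : Δ.Cone} {m : Δ.S σ} (hm : CutsOut (τ := τ) m) : τ ≤ σ :=
  fun u hu => ((hm u).1 hu).1

lemma CutsOut.exists_add_mem {τ σ : Δ.Cone} {m : Δ.S σ} (hm : CutsOut (τ := τ) m)
    {w : M} (hw : w ∈ Δ.S τ) : ∃ n : ℕ, ∀ n' ≥ n, w + n' • (m : M) ∈ Δ.S σ :=
  exists_nsmul_add_mem (Δ.rational σ.1 σ.2) m.2 hm hw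

lemma neg_mem_iff_forall {τ : Δ.Cone} {s : M} (hs : s ∈ Δ.S τ) :
    -s ∈ Δ.S τ ↔ ∀ u ∈ τ.1, u s = 0 := by
  constructor
  · intro h u hu
    have h1 := h u hu
    rw [map_neg] at h1
    exact le_antisymm (neg_nonneg.1 h1) (hs u hu)
  · intro h u hu
    rw [map_neg, h u hu, neg_zero]

/-- If `τ = σ ∩ m^⊥`, then every face `τ'` of `σ` on which `m` is invertible, that is to say
`-m ∈ S_τ'`, is contained in `τ`. -/
lemma le_of_cutsOut {τ τ' σ : Δ.Cone} {m : Δ.S σ} (hm : CutsOut (τ := τ) m) (h : τ' ≤ σ)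
    (h' : -(m : M) ∈ Δ.S τ') : τ' ≤ τ := fun u hu =>
  (hm u).2 ⟨h hu, (neg_mem_iff_forall (dualMonoid_anti h m.2)).1 h' u hu⟩

/-- A face of the monoid `S_σ` consists of the elements of `S_σ` which vanish on a face of `σ`. -/
theorem exists_face_of_submonoid (σ : Δ.Cone) (F : AddSubmonoid (Δ.S σ))
    (hF : ∀ a b, a + b ∈ F → a ∈ F) :
    ∃ (τ : Δ.Cone) (m : Δ.S σ), m ∈ F ∧ CutsOut (τ := τ) m ∧
      ∀ s : Δ.S σ, s ∈ F ↔ -(s : M) ∈ Δ.S τ := by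
  have hfin : Finite Δ.Cone := Δ.finite
  let T : Set Δ.Cone := {τ | ∃ m ∈ F, CutsOut (τ := τ) (σ := σ) m}
  have hT : T.Nonempty := ⟨σ, 0, zero_mem F, fun u => by simp⟩
  -- a minimal face among those cut out by elements of `F`
  obtain ⟨τ, hτ⟩ := (Set.toFinite T).exists_minimal hT
  obtain ⟨m, hmF, hm⟩ := hτ.1
  refine ⟨τ, m, hmF, hm, fun s => ⟨fun hs => ?_, fun hs => ?_⟩⟩
  · obtain ⟨ρ, hρ, hms⟩ := exists_cone_cutsOut σ (m + s)
    have hle : ρ ≤ τ := le_of_cutsOut hm hρ fun u hu => by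
      have h1 := ((hms u).1 hu).2
      have h2 := m.2 u (hρ hu)
      have h3 := s.2 u (hρ hu)
      rw [AddSubmonoid.coe_add, map_add] at h1
      rw [map_neg]
      linarith
    have hle' : τ ≤ ρ := hτ.2 ⟨m + s, add_mem hmF hs, hms⟩ hle
    intro u hu
    have h1 := ((hms u).1 (hle' hu)).2
    rw [AddSubmonoid.coe_add, map_add, ((hm u).1 hu).2, zero_add] at h1
    rw [map_neg, h1, neg_zero]
  · obtain ⟨n, hn⟩ := hm.exists_add_mem hs
    refine hF s ⟨_, hn n le_rfl⟩ ?_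
    convert nsmul_mem hmF n using 1
    ext
    change (s : M) + (-(s : M) + n • (m : M)) = n • (m : M)
    abel

/-- The zero cone is cut out by an element of `S_σ`. -/
lemma exists_cutsOut_zero (σ : Δ.Cone) : ∃ m : Δ.S σ, CutsOut (τ := Δ.zero) m :=
  exists_cutsOut (show Δ.zero ≤ σ from bot_le (a := σ.1))

end Faces

section LocalTrop

variable {M : Type u} [AddCommGroup M] {Δ : Fan M}

lemma ne_top_of_neg_mem {σ : Δ.Cone} (w : Δ.S σ →+ WithTop ℝ) {s : Δ.S σ}
    (hs : -(s : M) ∈ Δ.S σ) : w s ≠ ⊤ := by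
  intro h
  have h1 : w s + w ⟨-(s : M), hs⟩ = 0 := by
    rw [← map_add, ← map_zero w]
    congr 1
    ext
    exact add_neg_cancel _
  rw [h, top_add] at h1
  exact WithTop.top_ne_zero h1

/-- A homomorphism on `S_τ` is determined by its restriction to `S_σ`, since `S_τ` arises from `S_σ`
by inverting an element. -/
lemma incl_comp_injective {τ σ : Δ.Cone} (h : τ ≤ σ) {v v' : Δ.S τ →+ WithTop ℝ}
    (hv : v.comp (Δ.incl h) = v'.comp (Δ.incl h)) : v = v' := by
  obtain ⟨m, hm⟩ := exists_cutsOut h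
  ext1 s
  obtain ⟨n, hn⟩ := hm.exists_add_mem s.2
  have h1 := DFunLike.congr_fun hv ⟨_, hn n le_rfl⟩
  have h2 := DFunLike.congr_fun hv (n • m)
  have e : Δ.incl h ⟨_, hn n le_rfl⟩ = s + Δ.incl h (n • m) := rfl
  simp only [AddMonoidHom.comp_apply] at h1 h2
  rw [e, map_add, map_add, ← h2] at h1
  refine (WithTop.add_right_inj (ne_top_of_neg_mem v (s := Δ.incl h (n • m)) ?_)).1
    h1
  change -(n • (m : M)) ∈ Δ.S τ
  rw [← smul_neg]
  exact nsmul_mem hm.neg_mem n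

/-- A homomorphism on `S_σ` which is finite at `m` extends to `S_{σ ∩ m^⊥}`. -/
lemma CutsOut.exists_extend {τ σ : Δ.Cone} {m : Δ.S σ} (hm : CutsOut (τ := τ) m)
    (w : Δ.S σ →+ WithTop ℝ) (hw : w m ≠ ⊤) :
    ∃ v : Δ.S τ →+ WithTop ℝ, v.comp (Δ.incl hm.le) = w := by
  obtain ⟨r, hr⟩ := WithTop.ne_top_iff_exists.1 hw
  have hwn : ∀ n : ℕ, w (n • m) = ((n * r : ℝ) : WithTop ℝ) := fun n => by
    rw [map_nsmul, ← hr, ← WithTop.coe_nsmul, nsmul_eq_mul]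
  have key : ∀ s : Δ.S τ, ∃ n : ℕ, (s : M) + n • (m : M) ∈ Δ.S σ := fun s => by
    obtain ⟨n, hn⟩ := hm.exists_add_mem s.2
    exact ⟨n, hn n le_rfl⟩
  choose N hN using key
  have cancel : ∀ (n : ℕ) (x : WithTop ℝ), x + w (n • m) + ((-(n * r) : ℝ) : WithTop ℝ) = x := by
    intro n x
    rw [hwn, add_assoc, ← WithTop.coe_add, add_neg_cancel, WithTop.coe_zero, add_zero]
  have indep : ∀ (s : Δ.S τ) (n : ℕ) (hn : (s : M) + n • (m : M) ∈ Δ.S σ),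
      w ⟨_, hN s⟩ + ((-(N s * r) : ℝ) : WithTop ℝ) = w ⟨_, hn⟩ + ((-(n * r) : ℝ) : WithTop ℝ) := by
    intro s n hn
    have h1 : w ⟨_, hN s⟩ + w (n • m) = w ⟨_, hn⟩ + w (N s • m) := by
      rw [← map_add, ← map_add]
      congr 1
      ext
      change (s : M) + N s • (m : M) + n • (m : M) = (s : M) + n • (m : M) + N s • (m : M)
      abel
    rw [← cancel n (w ⟨_, hN s⟩), h1, add_assoc, add_comm ((-(n * r) : ℝ) : WithTop ℝ), ← add_assoc,
      cancel]
  refine ⟨{ toFun := fun s => w ⟨_, hN s⟩ + ((-(N s * r) : ℝ) : WithTop ℝ)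
            map_zero' := ?_
            map_add' := fun s t => ?_ }, ?_⟩
  · rw [indep 0 0 (by simp)]
    simp
    exact map_zero w
  · have e : ((s + t : Δ.S τ) : M) + (N s + N t) • (m : M) =
        ((s : M) + N s • (m : M)) + ((t : M) + N t • (m : M)) := by
      rw [add_smul, AddSubmonoid.coe_add]; abel
    have hst : ((s + t : Δ.S τ) : M) + (N s + N t) • (m : M) ∈ Δ.S σ :=
      e ▸ add_mem (hN s) (hN t)
    have : w ⟨_, hst⟩ = w ⟨_, hN s⟩ + w ⟨_, hN t⟩ := by
      rw [← map_add]
      exact congrArg w (Subtype.ext e)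
    rw [indep (s + t) (N s + N t) hst, this]
    rw [Nat.cast_add, add_mul, neg_add, WithTop.coe_add]
    abel
  · ext1 s
    change w ⟨_, hN (Δ.incl hm.le s)⟩ + ((-(N (Δ.incl hm.le s) * r) : ℝ) : WithTop ℝ) = w s
    rw [indep (Δ.incl hm.le s) 0 (by simp [Fan.incl])]
    simp [Fan.incl]

/-- Two pairs represent the same point of `N_ℝ(Δ)` if and only if they are restrictions of one
homomorphism on `S_λ` for a common face `λ`. -/
theorem NRDelta.mk_eq_mk_iff {σ τ : Δ.Cone} {w : Δ.S σ →+ WithTop ℝ} {w' : Δ.S τ →+ WithTop ℝ} :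
    NRDelta.mk Δ σ w = NRDelta.mk Δ τ w' ↔ ∃ (l : Δ.Cone) (h : l ≤ σ) (h' : l ≤ τ)
      (v : Δ.S l →+ WithTop ℝ), v.comp (Δ.incl h) = w ∧ v.comp (Δ.incl h') = w' := by
  constructor
  · intro h
    have h1 := Quot.eqvGen_exact h
    let R : (p q : Σ σ : Δ.Cone, LocalTrop Δ σ) → Prop := fun p q =>
      ∃ (l : Δ.Cone) (h : l ≤ p.1) (h' : l ≤ q.1) (v : Δ.S l →+ WithTop ℝ),
        v.comp (Δ.incl h) = p.2 ∧ v.comp (Δ.incl h') = q.2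
    suffices H : ∀ p q, Relation.EqvGen (tropGlue Δ) p q → R p q from H _ _ h1
    intro p q hpq
    induction hpq with
    | rel p q h => exact ⟨p.1, le_rfl, h.1, p.2, by ext; rfl, h.2.symm⟩
    | refl p => exact ⟨p.1, le_rfl, le_rfl, p.2, by ext; rfl, by ext; rfl⟩
    | symm p q _ ih =>
      obtain ⟨l, h, h', v, e, e'⟩ := ih
      exact ⟨l, h', h, v, e', e⟩
    | trans p q r _ _ ih ih' =>
      obtain ⟨l, hp, hq, v, e1, e2⟩ := ih
      obtain ⟨l', hq', hr, v', e3, e4⟩ := ih'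
      obtain ⟨m, hm⟩ := exists_cutsOut hq
      obtain ⟨m', hm'⟩ := exists_cutsOut hq'
      have hinf : CutsOut (τ := Δ.inf l l') (m + m') := by
        intro u
        change u ∈ l.1 ∧ u ∈ l'.1 ↔ u ∈ q.1.1 ∧ u ((m : M) + m') = 0
        rw [hm, hm', map_add]
        constructor
        · rintro ⟨⟨h1, h2⟩, _, h3⟩
          exact ⟨h1, by rw [h2, h3, add_zero]⟩
        · rintro ⟨h1, h2⟩
          have a := m.2 u h1
          have b := m'.2 u h1
          exact ⟨⟨h1, by linarith⟩, h1, by linarith⟩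
      -- the homomorphism on `S_q` is finite at `m + m'`, so it extends to `S_{l ∩ l'}`
      obtain ⟨x, hx⟩ := hinf.exists_extend (q.2 : Δ.S q.1 →+ WithTop ℝ) (by
        refine fun h => (not_or.2 ?_) (WithTop.add_eq_top.1
          ((AddMonoidHom.map_add (q.2 : Δ.S q.1 →+ WithTop ℝ) m m').symm.trans h))
        constructor
        · have := DFunLike.congr_fun e2 m
          rw [← this]
          exact ne_top_of_neg_mem v hm.neg_mem
        · have := DFunLike.congr_fun e3 m'
          rw [← this]
          exact ne_top_of_neg_mem v' hm'.neg_mem)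
      have f1 : x.comp (Δ.incl (Δ.inf_le_left l l')) = v :=
        incl_comp_injective hq (hx.trans e2.symm)
      have f2 : x.comp (Δ.incl (Δ.inf_le_right l l')) = v' :=
        incl_comp_injective hq' (hx.trans e3.symm)
      refine ⟨Δ.inf l l', (Δ.inf_le_left l l').trans hp, (Δ.inf_le_right l l').trans hr, x, ?_, ?_⟩
      · rw [← e1, ← f1]; rfl
      · rw [← e4, ← f2]; rfl
  · rintro ⟨l, h, h', v, rfl, rfl⟩
    have e : ∀ (σ : Δ.Cone) (h : l ≤ σ), NRDelta.mk Δ l v = NRDelta.mk Δ σ (v.comp (Δ.incl h)) :=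
      fun σ h => Quot.sound ⟨h, rfl⟩
    rw [← e, ← e]

end LocalTrop

section Closure

variable {M : Type u} [AddCommGroup M] {Δ : Fan M}

/-- The inclusion `[0, ∞] ⊆ ℝ ∪ {∞}`. -/
noncomputable def ennrealToWithTop : ℝ≥0∞ →+ WithTop ℝ :=
  AddMonoidHom.withTopMap (NNReal.toRealHom : ℝ≥0 →+* ℝ).toAddMonoidHom

lemma ennrealToWithTop_coe (r : ℝ≥0) : ennrealToWithTop (r : ℝ≥0∞) = ((r : ℝ) : WithTop ℝ) := rfl

lemma ennrealToWithTop_top : ennrealToWithTop ⊤ = ⊤ := rfl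

lemma ennrealToWithTop_injective : Function.Injective ennrealToWithTop := by
  intro a b h
  induction a with
  | top =>
    induction b with
    | top => rfl
    | coe b => exact absurd h (by simp [ennrealToWithTop_coe, ennrealToWithTop_top])
  | coe a =>
    induction b with
    | top => exact absurd h (by simp [ennrealToWithTop_coe, ennrealToWithTop_top])
    | coe b =>
      rw [ennrealToWithTop_coe, ennrealToWithTop_coe, WithTop.coe_inj] at h
      exact congrArg _ (NNReal.coe_injective h)

lemma ennrealToWithTop_nonneg (a : ℝ≥0∞) : 0 ≤ ennrealToWithTop a := by
  induction a with
  | top => exact le_top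
  | coe a =>
    rw [ennrealToWithTop_coe]
    exact_mod_cast a.2

lemma exists_ennrealToWithTop_comp {A : Type*} [AddMonoid A] (w : A →+ WithTop ℝ)
    (hw : ∀ a, 0 ≤ w a) : ∃ v : A →+ ℝ≥0∞, ennrealToWithTop.comp v = w := by
  have key : ∀ x : WithTop ℝ, 0 ≤ x → ∃ y : ℝ≥0∞, ennrealToWithTop y = x := by
    intro x hx
    induction x with
    | top => exact ⟨⊤, rfl⟩
    | coe x => exact ⟨ENNReal.ofNNReal ⟨x, by exact_mod_cast hx⟩, rfl⟩
  choose f hf using fun a => key (w a) (hw a)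
  refine ⟨{ toFun := f, map_zero' := ?_, map_add' := fun a b => ?_ }, AddMonoidHom.ext hf⟩
  · exact ennrealToWithTop_injective (by rw [hf, map_zero, map_zero])
  · exact ennrealToWithTop_injective (by rw [hf, map_add, map_add, hf, hf])

/-- A homomorphism `S_σ → [0, ∞]` is local if only the units of `S_σ` are sent to `0`. -/
def IsLocalTrop {σ : Δ.Cone} (w : Δ.S σ →+ ℝ≥0∞) : Prop :=
  ∀ s, w s = 0 → -(s : M) ∈ Δ.S σ

/-- Every point of `N_ℝ(Δ)` which is given by a non-negative homomorphism is given by a local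
homomorphism on the face where the homomorphism vanishes. -/
lemma exists_isLocalTrop {σ : Δ.Cone} (w : Δ.S σ →+ WithTop ℝ) (hw : ∀ s, 0 ≤ w s) :
    ∃ (τ : Δ.Cone) (v : Δ.S τ →+ ℝ≥0∞), IsLocalTrop v ∧
      NRDelta.mk Δ σ w = NRDelta.mk Δ τ (ennrealToWithTop.comp v) := by
  let F : AddSubmonoid (Δ.S σ) := AddMonoidHom.mker w
  obtain ⟨τ, m, hmF, hm, hF⟩ := exists_face_of_submonoid σ F fun a b h => by
    have h1 : w a + w b = 0 := by rw [← map_add]; exact h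
    exact ((add_eq_zero_iff_of_nonneg (hw a) (hw b)).1 h1).1
  have hwm : w m = 0 := hmF
  obtain ⟨x, hx⟩ := hm.exists_extend w (by rw [hwm]; exact WithTop.zero_ne_top)
  have hxs : ∀ s : Δ.S τ, ∃ t : Δ.S σ, x s = w t ∧ (-(t : M) ∈ Δ.S τ → -(s : M) ∈ Δ.S τ) := by
    intro s
    obtain ⟨n, hn⟩ := hm.exists_add_mem s.2
    refine ⟨⟨_, hn n le_rfl⟩, ?_, fun h => ?_⟩
    · rw [← hx]
      change x s = x (s + Δ.incl hm.le (n • m))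
      rw [map_add]
      change x s = x s + (x.comp (Δ.incl hm.le)) (n • m)
      rw [hx, map_nsmul, hwm, smul_zero, add_zero]
    · have := add_mem h (dualMonoid_anti hm.le (n • m).2)
      convert this using 1
      change -(s : M) = -((s : M) + n • (m : M)) + n • (m : M)
      abel
  obtain ⟨v, rfl⟩ := exists_ennrealToWithTop_comp x fun s => by
    obtain ⟨t, ht, -⟩ := hxs s
    rw [ht]; exact hw t
  refine ⟨τ, v, fun s hs => ?_, ?_⟩
  · obtain ⟨t, ht, h⟩ := hxs s
    refine h ((hF t).1 ?_)
    change w t = 0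
    rw [← ht, AddMonoidHom.comp_apply, hs, map_zero]
  · rw [← hx]
    exact (Quot.sound ⟨hm.le, rfl⟩ : NRDelta.mk Δ τ _ = NRDelta.mk Δ σ _).symm

/-- Two cones of a fan are separated by an `m` which cuts out their intersection from each of
them. -/
lemma exists_separating_cutsOut [Module.Finite ℤ M] (σ τ : Δ.Cone) :
    ∃ (m : Δ.S σ) (m' : Δ.S τ), (m' : M) = -(m : M) ∧
      CutsOut (τ := Δ.inf σ τ) m ∧ CutsOut (τ := Δ.inf σ τ) m' := by
  have h2 := Δ.inter_face τ.1 τ.2 σ.1 σ.2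
  rw [inf_comm] at h2
  obtain ⟨m, h1, h2, h3, h4⟩ := exists_separating (Δ.rational σ.1 σ.2) (Δ.rational τ.1 τ.2)
    (Δ.inter_face σ.1 σ.2 τ.1 τ.2) h2
  exact ⟨⟨m, h1⟩, ⟨-m, h2⟩, rfl, h3, h4⟩

/-- The representation of a point of `N_ℝ(Δ)` by a local homomorphism is unique. -/
theorem IsLocalTrop.cone_eq [Module.Finite ℤ M] {σ τ : Δ.Cone}
    {v : Δ.S σ →+ ℝ≥0∞} {v' : Δ.S τ →+ ℝ≥0∞} (hv : IsLocalTrop v) (hv' : IsLocalTrop v')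
    (h : NRDelta.mk Δ σ (ennrealToWithTop.comp v) = NRDelta.mk Δ τ (ennrealToWithTop.comp v')) :
    σ = τ := by
  obtain ⟨l, h1, h2, w, e1, e2⟩ := NRDelta.mk_eq_mk_iff.1 h
  obtain ⟨m, m', hmm, hm, hm'⟩ := exists_separating_cutsOut σ τ
  have a1 := DFunLike.congr_fun e1 m
  have a2 := DFunLike.congr_fun e2 m'
  have a3 : w (Δ.incl h1 m) + w (Δ.incl h2 m') = 0 := by
    rw [← map_add, ← map_zero w]
    congr 1
    ext
    change (m : M) + (m' : M) = 0
    rw [hmm, add_neg_cancel]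
  simp only [AddMonoidHom.comp_apply] at a1 a2
  rw [a1, a2, ← map_add, ← map_zero ennrealToWithTop] at a3
  have a4 := ennrealToWithTop_injective a3
  rw [add_eq_zero] at a4
  have b1 := (neg_mem_iff_forall m.2).1 (hv m a4.1)
  have b2 := (neg_mem_iff_forall m'.2).1 (hv' m' a4.2)
  refine le_antisymm ?_ ?_
  · exact fun u hu => ((hm u).2 ⟨hu, b1 u hu⟩).2
  · exact fun u hu => ((hm' u).2 ⟨hu, b2 u hu⟩).1

/-- The chart `Hom(S_σ, ℝ ∪ {∞}) → N_ℝ(Δ)` is injective. -/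
lemma IsLocalTrop.eq_of_mk_eq {σ : Δ.Cone} {v v' : Δ.S σ →+ ℝ≥0∞}
    (h : NRDelta.mk Δ σ (ennrealToWithTop.comp v) = NRDelta.mk Δ σ (ennrealToWithTop.comp v')) :
    v = v' := by
  obtain ⟨l, h1, h2, w, e1, e2⟩ := NRDelta.mk_eq_mk_iff.1 h
  ext1 s
  exact ennrealToWithTop_injective (DFunLike.congr_fun (e1.symm.trans e2) s)

/-- The points of `N_ℝ(Δ)` in the chart `N_ℝ(τ)` which come from a non-negative homomorphism on
`S_σ` are cut out by closed conditions, formulated with an `m` which separates `τ` and `σ`. -/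
lemma exists_nonneg_rep_iff (σ τ : Δ.Cone) {m : Δ.S τ} {m' : Δ.S σ} (hmm : (m' : M) = -(m : M))
    (hm : CutsOut (τ := Δ.inf τ σ) m) (w : Δ.S τ →+ WithTop ℝ) :
    (∃ v : Δ.S σ →+ WithTop ℝ, (∀ s, 0 ≤ v s) ∧ NRDelta.mk Δ τ w = NRDelta.mk Δ σ v) ↔
      w m ≤ 0 ∧ ∀ (s : Δ.S σ) (n : ℕ) (h : (s : M) + n • (m : M) ∈ Δ.S τ) (r : ℝ),
        w m ≤ r ∨ ((n * r : ℝ) : WithTop ℝ) ≤ w ⟨_, h⟩ := by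
  constructor
  · rintro ⟨v, hv, h⟩
    obtain ⟨l, h1, h2, x, e1, e2⟩ := NRDelta.mk_eq_mk_iff.1 h
    have a1 : x (Δ.incl h1 m) = w m := DFunLike.congr_fun e1 m
    have a2 : x (Δ.incl h2 m') = v m' := DFunLike.congr_fun e2 m'
    have a3 : w m + v m' = 0 := by
      rw [← a1, ← a2, ← map_add, ← map_zero x]
      congr 1
      ext
      change (m : M) + (m' : M) = 0
      rw [hmm, add_neg_cancel]
    have hle : w m ≤ 0 := by
      rw [← a3]
      exact le_add_of_nonneg_right (hv m')
    refine ⟨hle, fun s n hn r => or_iff_not_imp_left.2 fun hr => ?_⟩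
    have a4 : w ⟨_, hn⟩ = x (Δ.incl h2 s) + n • w m := by
      rw [← a1, ← map_nsmul, ← map_add, ← e1]
      rfl
    have a5 : x (Δ.incl h2 s) = v s := DFunLike.congr_fun e2 s
    rw [a4, a5]
    have : ((n * r : ℝ) : WithTop ℝ) = n • (r : WithTop ℝ) := by
      rw [← WithTop.coe_nsmul, nsmul_eq_mul]
    rw [this]
    exact (nsmul_le_nsmul_right (not_le.1 hr).le n).trans (le_add_of_nonneg_left (hv s))
  · rintro ⟨hle, H⟩
    have hne : w m ≠ ⊤ := ne_top_of_le_ne_top WithTop.zero_ne_top hle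
    obtain ⟨x, hx⟩ := hm.exists_extend w hne
    obtain ⟨a, ha⟩ := WithTop.ne_top_iff_exists.1 hne
    refine ⟨x.comp (Δ.incl (Δ.inf_le_right τ σ)), fun s => ?_, ?_⟩
    · obtain ⟨n, hn'⟩ := hm.exists_add_mem (Δ.incl (Δ.inf_le_right τ σ) s).2
      have hn : (s : M) + n • (m : M) ∈ Δ.S τ := hn' n le_rfl
      have h1 : w ⟨_, hn⟩ = x (Δ.incl (Δ.inf_le_right τ σ) s) + n • w m := by
        rw [← hx]
        change x (Δ.incl (Δ.inf_le_right τ σ) s + Δ.incl hm.le (n • m)) = _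
        rw [map_add, map_nsmul, map_nsmul]
        rfl
      rw [AddMonoidHom.comp_apply]
      cases hb : x (Δ.incl (Δ.inf_le_right τ σ) s) with
      | top => exact le_top
      | coe b =>
        rw [hb, ← ha, ← WithTop.coe_nsmul, ← WithTop.coe_add, nsmul_eq_mul] at h1
        have h2 : ∀ r : ℝ, r < a → n * r ≤ b + n * a := fun r hr => by
          have := (H s n hn r).resolve_left (by
            rw [← ha, not_le]; exact_mod_cast hr)
          rw [h1] at this
          exact_mod_cast this
        have h3 : (n : ℝ) * a ≤ b + n * a := by
          refine le_of_forall_pos_sub_le fun ε hε => ?_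
          have h4 := h2 (a - ε / (n + 1)) (by
            have : 0 < ε / ((n : ℝ) + 1) := by positivity
            linarith)
          have h5 : (n : ℝ) * (ε / (n + 1)) ≤ ε := by
            rw [← mul_div_assoc, div_le_iff₀ (by positivity)]
            nlinarith
          rw [mul_sub] at h4
          linarith
        have : 0 ≤ b := by linarith
        exact_mod_cast this
    · exact NRDelta.mk_eq_mk_iff.2 ⟨Δ.inf τ σ, hm.le, Δ.inf_le_right τ σ, x, hx, rfl⟩

lemma continuous_eval (σ : Δ.Cone) (s : Δ.S σ) :
    Continuous fun w : LocalTrop Δ σ => DFunLike.coe (F := Δ.S σ →+ WithTop ℝ) w s :=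
  (continuous_apply s).comp continuous_induced_dom

/-- The points of `N_ℝ(Δ)` which are given by non-negative homomorphisms form a closed set: in each
of the finitely many charts this is a finite union of sets cut out by closed conditions. -/
lemma isClosed_nonneg [Module.Finite ℤ M] :
    IsClosed {p : NRDelta Δ | ∃ (σ : Δ.Cone) (v : Δ.S σ →+ WithTop ℝ),
    (∀ s, 0 ≤ v s) ∧ p = NRDelta.mk Δ σ v} := by
  have hfin : Finite Δ.Cone := Δ.finite
  refine (isQuotientMap_quot_mk (r := tropGlue Δ)).isClosed_preimage.1
    (isClosed_sigma_iff.2 fun τ => ?_)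
  suffices this : IsClosed
    (⋃ σ : Δ.Cone, {w : LocalTrop Δ τ | ∃ v : Δ.S σ →+ WithTop ℝ, (∀ s, 0 ≤ v s) ∧
        NRDelta.mk Δ τ w = NRDelta.mk Δ σ v}) by
    convert this using 1
    ext w
    simp only [Set.mem_iUnion]
    rfl
  refine isClosed_iUnion_of_finite fun σ => ?_
  obtain ⟨m, m', hmm, hm, -⟩ := exists_separating_cutsOut τ σ
  let ev (s : Δ.S τ) (w : LocalTrop Δ τ) : WithTop ℝ := DFunLike.coe (F := Δ.S τ →+ WithTop ℝ) w s
  have key : IsClosed ({w | ev m w ≤ 0} ∩ ⋂ (s : Δ.S σ) (n : ℕ)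
      (h : (s : M) + n • (m : M) ∈ Δ.S τ) (r : ℝ),
        ({w | ev m w ≤ r} ∪ {w | ((n * r : ℝ) : WithTop ℝ) ≤ ev ⟨_, h⟩ w})) := by
    refine IsClosed.inter (isClosed_le (continuous_eval τ m) continuous_const) ?_
    refine isClosed_iInter fun s => isClosed_iInter fun n => isClosed_iInter fun h =>
      isClosed_iInter fun r => IsClosed.union ?_ ?_
    · exact isClosed_le (continuous_eval τ m) continuous_const
    · exact isClosed_le continuous_const (continuous_eval τ _)
  convert key using 1
  ext w
  refine (exists_nonneg_rep_iff σ τ hmm hm w).trans ?_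
  simp only [Set.mem_inter_iff, Set.mem_iInter, Set.mem_union]
  rfl

/-- A non-negative homomorphism on `S_σ` is the limit of `ũ + t v`, where `ũ ∈ N_ℝ` extends its
finite part and `v` lies in the relative interior of the face where it is finite. -/
lemma mem_closureFan_of_nonneg [Module.Finite ℤ M] {σ : Δ.Cone} (w : Δ.S σ →+ WithTop ℝ)
    (hw : ∀ s, 0 ≤ w s) : NRDelta.mk Δ σ w ∈ closureFan Δ := by
  classical
  let F : AddSubmonoid (Δ.S σ) :=
    { carrier := {s | w s ≠ ⊤}
      zero_mem' := by
        change w 0 ≠ ⊤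
        rw [map_zero]; exact WithTop.zero_ne_top
      add_mem' := fun {a b} ha hb => by
        change w (a + b) ≠ ⊤
        rw [map_add]; exact WithTop.add_ne_top.2 ⟨ha, hb⟩ }
  obtain ⟨τ, m, hmF, hm, hF⟩ := exists_face_of_submonoid σ F fun a b h => by
    change w (a + b) ≠ ⊤ at h
    rw [map_add] at h
    exact (WithTop.add_ne_top.1 h).1
  obtain ⟨x, hx⟩ := hm.exists_extend w hmF
  -- the group of units of `S_τ`, on which `x` is finite
  let L : AddSubgroup M :=
    { carrier := {s | s ∈ Δ.S τ ∧ -s ∈ Δ.S τ}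
      zero_mem' := ⟨zero_mem _, by rw [neg_zero]; exact zero_mem _⟩
      add_mem' := fun {a b} ha hb => ⟨add_mem ha.1 hb.1, by
        rw [neg_add]; exact add_mem ha.2 hb.2⟩
      neg_mem' := fun {a} ha => ⟨ha.2, by rw [neg_neg]; exact ha.1⟩ }
  have hL : ∀ l : L, x ⟨l, l.2.1⟩ ≠ ⊤ := fun l => ne_top_of_neg_mem x l.2.2
  let y : L →+ ℝ :=
    { toFun := fun l => (x ⟨l, l.2.1⟩).untop (hL l)
      map_zero' := by
        rw [WithTop.untop_eq_iff]
        exact map_zero x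
      map_add' := fun a b => by
        rw [WithTop.untop_eq_iff, WithTop.coe_add, WithTop.coe_untop, WithTop.coe_untop,
          ← map_add]
        rfl }
  -- the divisible group `ℝ` is injective, so `y` extends to `M`
  obtain ⟨u, hu⟩ := (Module.Baer.of_divisible ℝ).extension_property_addMonoidHom L.subtype
    L.subtype_injective y
  have huF : ∀ s : Δ.S σ, w s ≠ ⊤ → ((u s : ℝ) : WithTop ℝ) = w s := by
    intro s hs
    have hsL : (s : M) ∈ L := ⟨dualMonoid_anti hm.le s.2, (hF s).1 hs⟩
    have h1 : u s = y ⟨s, hsL⟩ := DFunLike.congr_fun hu ⟨s, hsL⟩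
    rw [h1, ← hx]
    exact WithTop.coe_untop _ _
  obtain ⟨S, hS⟩ := Δ.rational τ.1 τ.2
  -- the sum of the generators lies in the relative interior of `τ`
  let v : M →+ ℝ := ∑ n ∈ S, latticeVec n
  have hSτ : ∀ n ∈ S, latticeVec n ∈ τ.1 := fun n hn => by
    rw [hS]
    exact Submodule.subset_span ⟨n, hn, rfl⟩
  have hvτ : v ∈ τ.1 := Submodule.sum_mem _ hSτ
  have hv0 : ∀ s : Δ.S σ, w s ≠ ⊤ → v s = 0 := fun s hs =>
    (neg_mem_iff_forall (dualMonoid_anti hm.le s.2)).1 ((hF s).1 hs) v hvτ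
  have hv1 : ∀ s : Δ.S σ, w s = ⊤ → 0 < v s := by
    intro s hs
    have hsτ : (s : M) ∈ Δ.S τ := dualMonoid_anti hm.le s.2
    refine lt_of_le_of_ne (hsτ v hvτ) fun h0 => ?_
    have h1 : ∑ n ∈ S, latticeVec n s = 0 := by
      rw [← AddMonoidHom.finsetSum_apply]; exact h0.symm
    rw [Finset.sum_eq_zero_iff_of_nonneg fun n hn => hsτ _ (hSτ n hn)] at h1
    refine absurd hs ((hF s).2 ((neg_mem_iff_forall hsτ).2 fun a ha => ?_))
    rw [hS] at ha
    refine Submodule.span_induction (p := fun a _ => a s = 0) ?_ ?_ ?_ ?_ ha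
    · rintro _ ⟨n, hn, rfl⟩
      exact h1 n hn
    · rfl
    · intro a b _ _ ha hb
      rw [AddMonoidHom.add_apply, ha, hb, add_zero]
    · intro c a _ ha
      change (c : ℝ) * a s = 0
      rw [ha, mul_zero]
  obtain ⟨G, hG⟩ := (Δ.rational σ.1 σ.2).exists_finset_mem_iff
  have hlim : ∀ s : Δ.S σ, w s = ⊤ →
      Filter.Tendsto (fun t : ℕ => u s + t * v s) Filter.atTop Filter.atTop := fun s hs =>
    Filter.tendsto_atTop_add_const_left _ _
      (tendsto_natCast_atTop_atTop.atTop_mul_const (hv1 s hs))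
  have hev : ∀ᶠ t : ℕ in Filter.atTop, u + t • v ∈ σ.1 := by
    have : ∀ᶠ t : ℕ in Filter.atTop, ∀ g ∈ G, 0 ≤ (u + t • v) g := by
      refine (Filter.eventually_all_finset G).2 fun g hg => ?_
      have hgσ : g ∈ Δ.S σ := fun a ha => (hG a).1 ha g hg
      have e : ∀ t : ℕ, (u + t • v) g = u g + t * v g := fun t => by simp
      simp only [e]
      by_cases hgw : w ⟨g, hgσ⟩ = ⊤
      · exact (hlim ⟨g, hgσ⟩ hgw).eventually_ge_atTop 0
      · refine Filter.Eventually.of_forall fun t => ?_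
        have h1 := huF ⟨g, hgσ⟩ hgw
        have h2 := hw ⟨g, hgσ⟩
        rw [← h1] at h2
        rw [hv0 ⟨g, hgσ⟩ hgw, mul_zero, add_zero]
        exact_mod_cast h2
    exact this.mono fun t ht => (hG _).2 ht
  -- the points `u + t v` of `N_ℝ`, as homomorphisms on `S_σ`
  let W : ℕ → LocalTrop Δ σ := fun t =>
    (WithTop.addHom : ℝ →+ WithTop ℝ).comp ((u + t • v).comp (Δ.S σ).subtype)
  let w₀ : LocalTrop Δ σ := w
  have hind : Topology.IsInducing (fun (a : LocalTrop Δ σ) (s : Δ.S σ) =>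
      (DFunLike.coe (F := Δ.S σ →+ WithTop ℝ) a s)) := ⟨rfl⟩
  have hW : Filter.Tendsto W Filter.atTop (nhds w₀) := by
    refine hind.tendsto_nhds_iff.2 ?_
    refine tendsto_pi_nhds.2 fun s => ?_
    change Filter.Tendsto (fun t : ℕ => (((u + t • v) (s : M) : ℝ) : WithTop ℝ)) _ (nhds (w s))
    have e : ∀ t : ℕ, (u + t • v) s = u s + t * v s := fun t => by simp
    simp only [e]
    by_cases hs : w s = ⊤
    · rw [hs]
      refine tendsto_order.2 ⟨fun a ha => ?_, fun a ha => absurd ha not_top_lt⟩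
      lift a to ℝ using ha.ne
      exact ((hlim s hs).eventually_gt_atTop a).mono fun t ht => WithTop.coe_lt_coe.2 ht
    · rw [hv0 s hs]
      simp only [mul_zero, add_zero, huF s hs]
      exact tendsto_const_nhds
  have hcont : Continuous fun a : LocalTrop Δ σ => NRDelta.mk Δ σ a :=
    continuous_quot_mk.comp continuous_sigmaMk
  exact mem_closure_of_tendsto ((hcont.tendsto w₀).comp hW)
    (hev.mono fun t ht => ⟨σ, u + t • v, ht, rfl⟩)

/-- The closure of the fan consists of the points given by homomorphisms `S_σ → [0, ∞]`. -/
theorem mem_closureFan_iff [Module.Finite ℤ M] {p : NRDelta Δ} : p ∈ closureFan Δ ↔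
    ∃ (σ : Δ.Cone) (v : Δ.S σ →+ WithTop ℝ), (∀ s, 0 ≤ v s) ∧ p = NRDelta.mk Δ σ v := by
  constructor
  · intro hp
    refine closure_minimal ?_ isClosed_nonneg hp
    rintro _ ⟨σ, u, hu, rfl⟩
    exact ⟨σ, _, fun s => WithTop.coe_le_coe.2 (s.2 u hu), rfl⟩
  · rintro ⟨σ, v, hv, rfl⟩
    exact mem_closureFan_of_nonneg v hv

end Closure

end TropLog

/-! ### Monoidal spaces -/

namespace TropLog

universe v w

namespace MonoidalSpace

/-- Morphisms of monoidal spaces may be compared on germs of sections. This avoids transporting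
stalks along equalities of points. -/
lemma Hom.ext_of_sections {X : MonoidalSpace.{v}} {Y : MonoidalSpace.{u}} {f g : Hom X Y}
    (hb : ∀ x, f.base x = g.base x)
    (hs : ∀ x (V : Opens Y.carrier) (t : ∀ y : V, Y.stalk y), Y.IsSection V t →
      ∀ (h1 : f.base x ∈ V) (h2 : g.base x ∈ V),
        f.stalkMap x (t ⟨_, h1⟩) = g.stalkMap x (t ⟨_, h2⟩)) : f = g := by
  obtain ⟨fb, fc, fs, fl, fi⟩ := f
  obtain ⟨gb, gc, gs, gl, gi⟩ := g
  obtain rfl : fb = gb := funext hb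
  obtain rfl : fs = gs := by
    funext x
    ext1 a
    obtain ⟨U, hx, s, hs', rfl⟩ := Y.exists_section _ a
    exact hs x U s hs' hx hx
  rfl

lemma isUnit_section_congr {X : MonoidalSpace.{u}} {V : Opens X.carrier} (t : ∀ y : V, X.stalk y)
    {x y : X.carrier} (e : x = y) (hx : x ∈ V) (hy : y ∈ V) :
    IsUnit (t ⟨x, hx⟩) ↔ IsUnit (t ⟨y, hy⟩) := by
  subst e; rfl

lemma Hom.IsStrict.comp {X : MonoidalSpace.{u}} {Y : MonoidalSpace.{v}} {Z : MonoidalSpace.{w}}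
    {f : Hom X Y} {g : Hom Y Z} (hf : f.IsStrict) (hg : g.IsStrict) : (f.comp g).IsStrict :=
  fun x => (hf x).comp (hg (f.base x))

/-- Locally every section of the source of a strict morphism is pulled back from the target. -/
lemma Hom.IsStrict.exists_section {X : MonoidalSpace.{v}} {Y : MonoidalSpace.{u}} {f : Hom X Y}
    (hf : f.IsStrict) {U : Opens X.carrier} {s : ∀ x : U, X.stalk x} (hs : X.IsSection U s)
    (x : U) : ∃ (V : Opens Y.carrier) (t : ∀ y : V, Y.stalk y) (W : Opens X.carrier) (hU : W ≤ U)
      (hV : ∀ y ∈ W, f.base y ∈ V), Y.IsSection V t ∧ x.1 ∈ W ∧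
        ∀ y : W, f.stalkMap y.1 (t ⟨_, hV y.1 y.2⟩) = s ⟨y.1, hU y.2⟩ := by
  obtain ⟨a, ha⟩ := (hf x.1).2 (s x)
  obtain ⟨V, hx, t, ht, rfl⟩ := Y.exists_section _ a
  let U' : Opens X.carrier := U ⊓ ⟨f.base ⁻¹' V, V.2.preimage f.continuous_base⟩
  have h1 := X.isSection_res U U' inf_le_left s hs
  have h2 := X.isSection_res _ U' inf_le_right _ (f.isSection_comp V t ht)
  obtain ⟨W, hW, hxW, h⟩ := X.eq_nearby U' _ _ h2 h1 ⟨x.1, x.2, hx⟩ ha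
  exact ⟨V, t, W, hW.trans inf_le_left, fun y hy => (hW hy).2, ht, hxW, h⟩

end MonoidalSpace

lemma MonoidPrime.specializes_iff {P : Type u} [CommMonoid P] {p q : MonoidPrime P} :
    q ⤳ p ↔ q.ideal ⊆ p.ideal := by
  constructor
  · intro h f hf
    by_contra hfp
    exact h.mem_open (MonoidPrime.basicOpen f).2 hfp hf
  · intro h
    rw [specializes_iff_forall_open]
    intro U hU hp
    induction hU with
    | basic s hs =>
      obtain ⟨f, rfl⟩ := hs
      exact fun hf => hp (h hf)
    | univ => trivial
    | inter s t _ _ hs ht => exact ⟨hs hp.1, ht hp.2⟩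
    | sUnion S _ ih =>
      obtain ⟨s, hs, hps⟩ := hp
      exact ⟨s, hs, ih s hs hps⟩

lemma MonoidPrime.mem_of_maximal_mem {P : Type u} [CommMonoid P] {U : Opens (MonoidPrime P)}
    (h : MonoidPrime.maximal P ∈ U) (p : MonoidPrime P) : p ∈ U := by
  refine (MonoidPrime.specializes_iff.2 ?_ : p ⤳ MonoidPrime.maximal P).mem_open U.2 h
  intro f hf hu
  obtain ⟨g, hg⟩ := hu.exists_left_inv
  exact p.one_notMem (hg ▸ p.mul_mem g f hf)

lemma MonoidPrime.isUnit_toStalk_iff {P : Type u} [CommMonoid P] (p : MonoidPrime P) (a : P) :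
    IsUnit (p.toStalk a) ↔ a ∉ p.ideal := by
  have : p.toStalk a = 1 ↔ a ∉ p.ideal := by
    rw [← map_one p.toStalk, MonoidPrime.toStalk_eq_iff]
    constructor
    · rintro ⟨s, t, -, ht, h⟩ ha
      rw [mul_one] at h
      exact ht (h ▸ p.mul_mem s a ha)
    · intro ha
      exact ⟨1, a, p.one_notMem, ha, by rw [one_mul, mul_one]⟩
  rw [← this]
  exact Associates.isUnit_iff_eq_one _

/-- A homomorphism which factors through a quotient. -/
noncomputable def descHom {A B C : Type*} [Monoid A] [Monoid B] [Monoid C] (π : A →* B)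
    (hπ : Function.Surjective π) (g : A →* C) (h : ∀ a b, π a = π b → g a = g b) : B →* C where
  toFun b := g (Function.surjInv hπ b)
  map_one' := by
    rw [h _ 1 ((Function.surjInv_eq hπ 1).trans (map_one π).symm), map_one]
  map_mul' x y := by
    rw [← map_mul]
    apply h
    rw [map_mul, Function.surjInv_eq hπ, Function.surjInv_eq hπ, Function.surjInv_eq hπ]

lemma descHom_apply {A B C : Type*} [Monoid A] [Monoid B] [Monoid C] (π : A →* B)
    (hπ : Function.Surjective π) (g : A →* C) (h : ∀ a b, π a = π b → g a = g b) (a : A) :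
    descHom π hπ g h (π a) = g a :=
  h _ _ (Function.surjInv_eq hπ _)

lemma descHom_bijective {A B C : Type*} [Monoid A] [Monoid B] [Monoid C] (π : A →* B)
    (hπ : Function.Surjective π) (g : A →* C) (h : ∀ a b, π a = π b → g a = g b)
    (hg : Function.Surjective g) (h' : ∀ a b, g a = g b → π a = π b) :
    Function.Bijective (descHom π hπ g h) := by
  constructor
  · intro x y hxy
    obtain ⟨a, rfl⟩ := hπ x
    obtain ⟨b, rfl⟩ := hπ y
    rw [descHom_apply, descHom_apply] at hxy
    exact h' _ _ hxy
  · intro c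
    obtain ⟨a, rfl⟩ := hg c
    exact ⟨π a, descHom_apply _ _ _ _ _⟩

lemma isUnit_of_map_bijective {A B : Type*} [Monoid A] [Monoid B] (f : A →* B)
    (hf : Function.Bijective f) (a : A) (h : IsUnit (f a)) : IsUnit a := by
  have := h.map (MulEquiv.ofBijective f hf).symm
  rwa [show f a = MulEquiv.ofBijective f hf a from rfl, MulEquiv.symm_apply_apply] at this

namespace MonoidPrime

variable {P : Type v} {Q : Type u} [CommMonoid P] [CommMonoid Q] (f : Q →* P)

/-- The preimage of a prime ideal. -/
def comap (p : MonoidPrime P) : MonoidPrime Q where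
  ideal := f ⁻¹' p.ideal
  mul_mem a b hb := by
    rw [Set.mem_preimage, map_mul]; exact p.mul_mem _ _ hb
  one_notMem := by
    rw [Set.mem_preimage, map_one]; exact p.one_notMem
  mul_notMem a b ha hb := by
    rw [Set.mem_preimage, map_mul]; exact p.mul_notMem _ _ ha hb

lemma continuous_comap : Continuous (comap f) := continuous_generateFrom_iff.2 (by
  rintro _ ⟨a, rfl⟩
  exact (basicOpen (f a)).2)

lemma toStalk_comp_eq (p : MonoidPrime P) (a b : Q)
    (h : (p.comap f).toStalk a = (p.comap f).toStalk b) :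
    p.toStalk.comp f a = p.toStalk.comp f b := by
  obtain ⟨s, t, hs, ht, h⟩ := (toStalk_eq_iff _ _ _).1 h
  exact (toStalk_eq_iff _ _ _).2 ⟨f s, f t, hs, ht, by rw [← map_mul, h, map_mul]⟩

/-- The homomorphism on stalks induced by a homomorphism of monoids. -/
noncomputable def stalkMap (p : MonoidPrime P) : (p.comap f).Stalk →* p.Stalk :=
  descHom (p.comap f).toStalk (p.comap f).toStalk_surjective (p.toStalk.comp f)
    (p.toStalk_comp_eq f)

lemma stalkMap_toStalk (p : MonoidPrime P) (a : Q) :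
    p.stalkMap f ((p.comap f).toStalk a) = p.toStalk (f a) :=
  descHom_apply _ _ _ _ _

lemma isUnit_of_stalkMap (p : MonoidPrime P) (a : (p.comap f).Stalk)
    (h : IsUnit (p.stalkMap f a)) : IsUnit a := by
  obtain ⟨a, rfl⟩ := (p.comap f).toStalk_surjective a
  rw [stalkMap_toStalk, isUnit_toStalk_iff] at h
  exact ((p.comap f).isUnit_toStalk_iff a).2 h

end MonoidPrime

/-- The morphism of spectra induced by a homomorphism of monoids. -/
noncomputable def monoidSpecMap {P : Type v} {Q : Type u} [CommMonoid P] [CommMonoid Q]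
    (f : Q →* P) : MonoidalSpace.Hom (monoidSpec P) (monoidSpec Q) where
  base := MonoidPrime.comap f
  continuous_base := MonoidPrime.continuous_comap f
  stalkMap p := MonoidPrime.stalkMap f p
  isLocal p a h :=
    MonoidPrime.isUnit_of_stalkMap f p a h
  isSection_comp V s hs p := by
    obtain ⟨W, hW, a, hp, ha⟩ := hs ⟨p.1.comap f, p.2⟩
    refine ⟨⟨_, W.2.preimage (MonoidPrime.continuous_comap f)⟩, fun q hq => hW hq, f a, hp,
      fun q => ?_⟩
    exact (congrArg (q.1.stalkMap f) (ha ⟨q.1.comap f, q.2⟩)).trans (q.1.stalkMap_toStalk f a)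

/-- A strict morphism `φ : X ⟶ F` with a strict section `g : F ⟶ X` such that `g (φ x)` specializes
to `x` is initial among the strict morphisms into Kato fans: a strict morphism `ψ` into a Kato fan
takes the same value at `x` and at `g (φ x)`, since a germ near `ψ x` which is a non-unit at `ψ x`
and a unit at `ψ (g (φ x))` would give such a germ on `F` at the point `φ (g (φ x)) = φ x`. -/
theorem existsUnique_strict_of_section {X F G : MonoidalSpace.{u}} (φ : MonoidalSpace.Hom X F)
    (g : MonoidalSpace.Hom F X) (hφ : φ.IsStrict) (hg : g.IsStrict)
    (hb : ∀ y, φ.base (g.base y) = y)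
    (hs : ∀ y (V : Opens F.carrier) (t : ∀ y : V, F.stalk y), F.IsSection V t →
      ∀ (h1 : φ.base (g.base y) ∈ V) (h2 : y ∈ V),
        g.stalkMap y (φ.stalkMap _ (t ⟨_, h1⟩)) = t ⟨y, h2⟩)
    (hspec : ∀ x, g.base (φ.base x) ⤳ x) (hG : IsKatoFan G) (ψ : MonoidalSpace.Hom X G)
    (hψ : ψ.IsStrict) : ∃! h : MonoidalSpace.Hom F G, h.IsStrict ∧ φ.comp h = ψ := by
  refine ⟨g.comp ψ, ⟨hg.comp hψ, ?_⟩, ?_⟩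
  · -- both points lie in a chart `Spec P` of `G`, as a specialization `q ⤳ p`
    have hbase : ∀ x, ψ.base (g.base (φ.base x)) = ψ.base x := by
      intro x
      obtain ⟨P, _, j, hj, p, hp⟩ := hG.2 (ψ.base x)
      have h1 : ψ.base (g.base (φ.base x)) ⤳ j.base p := by
        rw [hp]; exact (hspec x).map ψ.continuous_base
      obtain ⟨q, hq⟩ := h1.mem_open hj.1.isOpen_range ⟨p, rfl⟩
      rw [← hq] at h1
      have h2 : q ⤳ p := hj.1.isInducing.specializes_iff.1 h1
      rw [← hq, ← hp]
      congr 1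
      refine MonoidPrime.ext
        (Set.Subset.antisymm (MonoidPrime.specializes_iff.1 h2) fun s hsp => ?_)
      by_contra hsq
      -- `s` is a unit at `q` and not at `p`; `t` is a section of `G` with the germs of `s`
      have hsec : (monoidSpec P).IsSection ⊤ fun y => MonoidPrime.toStalk y.1 s :=
        fun y => ⟨⊤, le_rfl, s, trivial, fun _ => rfl⟩
      obtain ⟨V, t, W, hU, hV, ht, hpW, hW⟩ := hj.2.exists_section hsec ⟨p, trivial⟩
      have hqW : q ∈ W := h2.mem_open W.2 hpW
      have u1 : ¬ IsUnit (t ⟨_, hV p hpW⟩) := fun hu => by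
        have := hu.map (j.stalkMap p)
        rw [hW ⟨p, hpW⟩] at this
        exact (MonoidPrime.isUnit_toStalk_iff p s).1 this hsp
      have u2 : IsUnit (t ⟨_, hV q hqW⟩) := by
        refine j.isLocal q _ ?_
        rw [hW ⟨q, hqW⟩]
        exact (MonoidPrime.isUnit_toStalk_iff q s).2 hsq
      have hxV : ψ.base x ∈ V := hp ▸ hV p hpW
      have hxV' : ψ.base (g.base (φ.base x)) ∈ V := hq ▸ hV q hqW
      rw [MonoidalSpace.isUnit_section_congr t hp _ hxV] at u1
      rw [MonoidalSpace.isUnit_section_congr t hq _ hxV'] at u2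
      -- near `x` the pull-back of `t` to `X` comes from a section `t'` of `F`
      obtain ⟨V', t', W', hU', hV', ht', hxW', hW'⟩ :=
        hφ.exists_section (ψ.isSection_comp V t ht) ⟨x, hxV⟩
      have hx'W' : g.base (φ.base x) ∈ W' := (hspec x).mem_open W'.2 hxW'
      have u3 := u2.map (ψ.stalkMap _)
      have e1 := hW' ⟨_, hx'W'⟩
      have e2 := hW' ⟨_, hxW'⟩
      rw [← e1] at u3
      have u4 := φ.isLocal _ _ u3
      rw [MonoidalSpace.isUnit_section_congr t' (hb _) _ (hV' x hxW')] at u4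
      have u5 := u4.map (φ.stalkMap x)
      rw [e2] at u5
      exact u1 (ψ.isLocal _ _ u5)
    refine MonoidalSpace.Hom.ext_of_sections hbase fun x V t ht h1 h2 => ?_
    obtain ⟨V', t', W', hU', hV', ht', hxW', hW'⟩ :=
      hφ.exists_section (ψ.isSection_comp V t ht) ⟨x, h2⟩
    have hx'W' : g.base (φ.base x) ∈ W' := (hspec x).mem_open W'.2 hxW'
    have e1 := hW' ⟨_, hx'W'⟩
    have e2 := hW' ⟨_, hxW'⟩
    change φ.stalkMap x (g.stalkMap (φ.base x) (ψ.stalkMap (g.base (φ.base x)) (t ⟨_, h1⟩))) = _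
    have e3 := hs (φ.base x) V' t' ht' (hV' _ hx'W') (hV' x hxW')
    rw [e1] at e3
    rw [← e2, ← e3]
    rfl
  · rintro h ⟨-, rfl⟩
    refine MonoidalSpace.Hom.ext_of_sections (fun y => ?_) fun y V t ht h1 h2 => ?_
    · exact (congrArg h.base (hb y)).symm
    · exact (hs y _ _ (h.isSection_comp V t ht) h2 h1).symm

end TropLog

/-! ### The Kato fan of a fan of cones -/

namespace TropLog

section FanSpace

variable {M : Type u} [AddCommGroup M] {Δ : Fan M}

/-- The class of an element of `S_σ` in `S_σ / S_σ^*`. -/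
def cls (σ : Δ.Cone) (s : Δ.S σ) : Associates (Multiplicative (Δ.S σ)) :=
  Associates.mk (Multiplicative.ofAdd s)

lemma cls_add (σ : Δ.Cone) (s t : Δ.S σ) : cls σ (s + t) = cls σ s * cls σ t :=
  Associates.mk_mul_mk.symm

lemma cls_zero (σ : Δ.Cone) : cls σ 0 = 1 := Associates.mk_one

lemma cls_surjective (σ : Δ.Cone) : Function.Surjective (cls σ) := fun a => by
  obtain ⟨b, rfl⟩ := Associates.mk_surjective a
  exact ⟨b.toAdd, rfl⟩

lemma cls_eq_iff {σ : Δ.Cone} {a b : Δ.S σ} : cls σ a = cls σ b ↔ ∀ u ∈ σ.1, u a = u b := by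
  rw [cls, cls, Associates.mk_eq_mk_iff_associated]
  constructor
  · rintro ⟨c, hc⟩ u hu
    have h1 : a + (c : Multiplicative (Δ.S σ)).toAdd = b := hc
    have h2 : (c : Multiplicative (Δ.S σ)).toAdd + ((c⁻¹ : (Multiplicative (Δ.S σ))ˣ) :
        Multiplicative (Δ.S σ)).toAdd = 0 := c.mul_inv
    have h3 := (c : Multiplicative (Δ.S σ)).toAdd.2 u hu
    have h4 := ((c⁻¹ : (Multiplicative (Δ.S σ))ˣ) : Multiplicative (Δ.S σ)).toAdd.2 u hu
    have h5 := congrArg (fun s : Δ.S σ => u s) h2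
    simp only [AddSubmonoid.coe_add, map_add, AddSubmonoid.coe_zero, map_zero] at h5
    rw [← h1, AddSubmonoid.coe_add, map_add]
    linarith
  · intro h
    have h1 : (b : M) - a ∈ Δ.S σ := fun u hu => by rw [map_sub, h u hu, sub_self]
    have h2 : (a : M) - b ∈ Δ.S σ := fun u hu => by rw [map_sub, h u hu, sub_self]
    refine ⟨⟨Multiplicative.ofAdd ⟨_, h1⟩, Multiplicative.ofAdd ⟨_, h2⟩, ?_, ?_⟩, ?_⟩
    · exact Multiplicative.toAdd.injective (Subtype.ext (by
        change (b : M) - a + (a - b) = 0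
        abel))
    · exact Multiplicative.toAdd.injective (Subtype.ext (by
        change (a : M) - b + (b - a) = 0
        abel))
    · exact Multiplicative.toAdd.injective (Subtype.ext (by
        change (a : M) + (b - a) = b
        abel))

lemma isUnit_cls_iff {σ : Δ.Cone} {s : Δ.S σ} : IsUnit (cls σ s) ↔ -(s : M) ∈ Δ.S σ := by
  rw [Associates.isUnit_iff_eq_one, ← cls_zero, cls_eq_iff, neg_mem_iff_forall s.2]
  simp

/-- The homomorphism `S_σ → S_τ / S_τ^*` is surjective, since `S_τ` arises from `S_σ` by inverting
an element. -/
lemma exists_cls_incl {τ σ : Δ.Cone} (h : τ ≤ σ) (a : Associates (Multiplicative (Δ.S τ))) :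
    ∃ s : Δ.S σ, cls τ (Δ.incl h s) = a := by
  obtain ⟨s, rfl⟩ := cls_surjective τ a
  obtain ⟨m, hm⟩ := exists_cutsOut h
  obtain ⟨n, hn⟩ := hm.exists_add_mem s.2
  refine ⟨⟨_, hn n le_rfl⟩, cls_eq_iff.2 fun u hu => ?_⟩
  change u ((s : M) + n • (m : M)) = u s
  rw [map_add, map_nsmul, ((hm u).1 hu).2, smul_zero, add_zero]

variable (Δ) in
/-- The fan `Δ` as a monoidal space: its points are the cones, with the faces of a cone forming
its smallest open neighbourhood, and the stalk at `σ` is `S_σ / S_σ^*`. -/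
def fanSpace : MonoidalSpace.{u} where
  carrier := Δ.Cone
  topology := Topology.lowerSet Δ.Cone
  stalk σ := Associates (Multiplicative (Δ.S σ))
  IsSection U s := ∀ σ : U, ∃ a : Δ.S σ.1, ∀ (τ : Δ.Cone) (h : τ ≤ σ.1) (hτ : τ ∈ U),
    s ⟨τ, hτ⟩ = cls τ (Δ.incl h a)
  isSection_one U σ := ⟨0, fun τ h _ => by rw [map_zero, cls_zero]⟩
  isSection_mul U s t hs ht σ := by
    obtain ⟨a, ha⟩ := hs σ
    obtain ⟨b, hb⟩ := ht σ
    refine ⟨a + b, fun τ h hτ => (congrArg₂ _ (ha τ h hτ) (hb τ h hτ)).trans ?_⟩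
    rw [map_add, cls_add]
  isSection_res U V h s hs σ := by
    obtain ⟨a, ha⟩ := hs ⟨σ.1, h σ.2⟩
    exact ⟨a, fun τ hτ hV => ha τ hτ (h hV)⟩
  isSection_local U s hs σ := by
    let := Topology.lowerSet Δ.Cone
    obtain ⟨V, h, hσ, hV⟩ := hs σ
    obtain ⟨a, ha⟩ := hV ⟨σ.1, hσ⟩
    exact ⟨a, fun τ hτ hU => ha τ hτ (V.2 hτ hσ)⟩
  exists_section σ a := by
    let := Topology.lowerSet Δ.Cone
    obtain ⟨s, rfl⟩ := cls_surjective σ a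
    refine ⟨⟨Set.Iic σ, fun a b hb ha => hb.trans ha⟩, le_refl σ,
      fun τ => cls τ.1 (Δ.incl τ.2 s), fun τ => ⟨Δ.incl τ.2 s, fun _ _ _ => rfl⟩, rfl⟩
  eq_nearby U s t hs ht σ h := by
    let := Topology.lowerSet Δ.Cone
    obtain ⟨a, ha⟩ := hs σ
    obtain ⟨b, hb⟩ := ht σ
    have hab : cls σ.1 a = cls σ.1 b := (ha σ.1 le_rfl σ.2).symm.trans (h.trans (hb σ.1 le_rfl σ.2))
    refine ⟨⟨Set.Iic σ.1, fun a b hb ha => hb.trans ha⟩, fun τ hτ => U.2 hτ σ.2, le_refl σ.1,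
      fun τ => ?_⟩
    refine (ha τ.1 τ.2 _).trans (Eq.trans ?_ (hb τ.1 τ.2 _).symm)
    exact cls_eq_iff.2 fun u hu => cls_eq_iff.1 hab u (τ.2 hu)

lemma isOpen_fanSpace_iff {s : Set Δ.Cone} :
    IsOpen (X := (fanSpace Δ).carrier) s ↔ IsLowerSet s := Iff.rfl

variable (Δ) in
/-- The set of faces of `σ`. -/
def faces (σ : Δ.Cone) : Opens (fanSpace Δ).carrier :=
  ⟨{τ : Δ.Cone | τ ≤ σ}, isOpen_fanSpace_iff.2 fun _ _ hb ha => hb.trans ha⟩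

/-- The section of the structure sheaf given by an element of `S_σ`. -/
def clsSection (σ : Δ.Cone) (s : Δ.S σ) (τ : faces Δ σ) : (fanSpace Δ).stalk τ.1 :=
  cls τ.1 (Δ.incl (τ := τ.1) (σ := σ) τ.2 s)

lemma isSection_clsSection (σ : Δ.Cone) (s : Δ.S σ) :
    (fanSpace Δ).IsSection (faces Δ σ) (clsSection σ s) :=
  fun τ => ⟨Δ.incl (τ := τ.1) (σ := σ) τ.2 s, fun _ _ _ => rfl⟩

/-- A germ at a face of `σ` is given by an element of `S_σ`. The formulation allows for a change of
the name of the face. -/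
lemma exists_forall_eq_cls {σ τ : Δ.Cone} (h : τ ≤ σ) {V : Opens (fanSpace Δ).carrier}
    {t : ∀ y : V, (fanSpace Δ).stalk y} (ht : (fanSpace Δ).IsSection V t) (hτ : τ ∈ V) :
    ∃ s : Δ.S σ, ∀ (ρ : Δ.Cone) (hρ : ρ ≤ τ) (hV : ρ ∈ V),
      t ⟨ρ, hV⟩ = cls ρ (Δ.incl (hρ.trans h) s) := by
  obtain ⟨a, ha⟩ := ht ⟨τ, hτ⟩
  obtain ⟨s, hs⟩ := exists_cls_incl h (cls τ a)
  refine ⟨s, fun ρ hρ hV => (ha ρ hρ hV).trans ?_⟩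
  exact cls_eq_iff.2 fun u hu => (cls_eq_iff.1 hs u (hρ hu)).symm

/-! ### Charts of the Kato fan -/

section Chart

variable (σ : Δ.Cone)

/-- The complement of a prime ideal of `S_σ` is a face of the monoid, so it consists of the elements
which are invertible on a face of `σ`. -/
lemma exists_chartFace (p : MonoidPrime (Multiplicative (Δ.S σ))) :
    ∃ τ : Δ.Cone, (∃ m : Δ.S σ, Multiplicative.ofAdd m ∉ p.ideal ∧ CutsOut (τ := τ) m) ∧
      ∀ s : Δ.S σ, Multiplicative.ofAdd s ∉ p.ideal ↔ -(s : M) ∈ Δ.S τ := by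
  let F : AddSubmonoid (Δ.S σ) :=
    { carrier := {s | Multiplicative.ofAdd s ∉ p.ideal}
      zero_mem' := p.one_notMem
      add_mem' := fun ha hb => p.mul_notMem _ _ ha hb }
  obtain ⟨τ, m, h1, h2, h3⟩ := exists_face_of_submonoid σ F fun a b h ha => h (by
    rw [add_comm]
    exact p.mul_mem (Multiplicative.ofAdd b) _ ha)
  exact ⟨τ, ⟨m, h1, h2⟩, h3⟩

variable {σ}

/-- The face of `σ` on which the complement of a prime ideal of `S_σ` vanishes. -/
noncomputable def chartFace (p : MonoidPrime (Multiplicative (Δ.S σ))) : Δ.Cone :=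
  (exists_chartFace σ p).choose

variable (p : MonoidPrime (Multiplicative (Δ.S σ)))

lemma exists_chartFace_cutsOut : ∃ m : Δ.S σ, Multiplicative.ofAdd m ∉ p.ideal ∧
    CutsOut (τ := chartFace p) m := (exists_chartFace σ p).choose_spec.1

lemma ofAdd_notMem_iff {s : Δ.S σ} :
    Multiplicative.ofAdd s ∉ p.ideal ↔ -(s : M) ∈ Δ.S (chartFace p) :=
  (exists_chartFace σ p).choose_spec.2 s

lemma chartFace_le : chartFace p ≤ σ := (exists_chartFace_cutsOut p).choose_spec.2.le

/-- A face of `σ` is determined by the elements of `S_σ` which vanish on it. -/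
lemma face_le_of_forall {τ τ' : Δ.Cone} (h : τ ≤ σ) (h' : τ' ≤ σ)
    (H : ∀ s : Δ.S σ, -(s : M) ∈ Δ.S τ → -(s : M) ∈ Δ.S τ') : τ' ≤ τ := by
  obtain ⟨m, hm⟩ := exists_cutsOut h
  exact le_of_cutsOut hm h' (H m hm.neg_mem)

lemma chartFace_eq_of_forall {τ : Δ.Cone} (h : τ ≤ σ)
    (H : ∀ s : Δ.S σ, Multiplicative.ofAdd s ∉ p.ideal ↔ -(s : M) ∈ Δ.S τ) : chartFace p = τ :=
  le_antisymm
    (face_le_of_forall h (chartFace_le p) fun s hs => (ofAdd_notMem_iff p).1 ((H s).2 hs))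
    (face_le_of_forall (chartFace_le p) h fun s hs => (H s).1 ((ofAdd_notMem_iff p).2 hs))

lemma chartFace_le_iff {p q : MonoidPrime (Multiplicative (Δ.S σ))} :
    chartFace q ≤ chartFace p ↔ q.ideal ⊆ p.ideal := by
  constructor
  · intro h a ha
    by_contra hp
    exact (ofAdd_notMem_iff q (s := a.toAdd)).2
      (dualMonoid_anti h ((ofAdd_notMem_iff p (s := a.toAdd)).1 hp)) ha
  · intro h
    exact face_le_of_forall (chartFace_le p) (chartFace_le q) fun s hs =>
      (ofAdd_notMem_iff q).1 fun hq => (ofAdd_notMem_iff p).2 hs (h hq)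

lemma exists_chartFace_eq {τ : Δ.Cone} (h : τ ≤ σ) :
    ∃ p : MonoidPrime (Multiplicative (Δ.S σ)), chartFace p = τ := by
  let p : MonoidPrime (Multiplicative (Δ.S σ)) :=
    { ideal := {a | -((a.toAdd : Δ.S σ) : M) ∉ Δ.S τ}
      mul_mem := fun a b hb hab => hb (by
        have := add_mem hab (dualMonoid_anti h a.toAdd.2)
        convert this using 1
        change _ = -((a.toAdd : M) + b.toAdd) + a.toAdd
        abel)
      one_notMem := fun h => h (by
        rw [toAdd_one, AddSubmonoid.coe_zero, neg_zero]
        exact zero_mem _)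
      mul_notMem := fun a b ha hb h => h (by
        rw [toAdd_mul, AddSubmonoid.coe_add, neg_add]
        exact add_mem (not_not.1 ha) (not_not.1 hb)) }
  exact ⟨p, chartFace_eq_of_forall p h fun s => not_not⟩

/-- The homomorphism `S_σ → S_τ / S_τ^*` for `τ = chartFace p`. -/
noncomputable def chartHom :
    Multiplicative (Δ.S σ) →* Associates (Multiplicative (Δ.S (chartFace p))) :=
  Associates.mkMonoidHom.comp (AddMonoidHom.toMultiplicative (Δ.incl (chartFace_le p)))

lemma chartHom_surjective : Function.Surjective (chartHom p) := fun a => by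
  obtain ⟨s, hs⟩ := exists_cls_incl (chartFace_le p) a
  exact ⟨Multiplicative.ofAdd s, hs⟩

lemma chartHom_eq_iff (a b : Multiplicative (Δ.S σ)) :
    chartHom p a = chartHom p b ↔ p.toStalk a = p.toStalk b := by
  rw [MonoidPrime.toStalk_eq_iff]
  refine (cls_eq_iff (a := Δ.incl (chartFace_le p) a.toAdd)
    (b := Δ.incl (chartFace_le p) b.toAdd)).trans ?_
  change (∀ u ∈ (chartFace p).1, u (a.toAdd : M) = u (b.toAdd : M)) ↔ _
  constructor
  · intro h
    obtain ⟨m, hmp, hm⟩ := exists_chartFace_cutsOut p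
    have h1 : (a.toAdd : M) - b.toAdd ∈ Δ.S (chartFace p) := fun u hu => by
      rw [map_sub, h u hu, sub_self]
    obtain ⟨n, hn⟩ := hm.exists_add_mem h1
    refine ⟨Multiplicative.ofAdd (n • m), Multiplicative.ofAdd ⟨_, hn n le_rfl⟩, ?_, ?_, ?_⟩
    · refine (ofAdd_notMem_iff p).2 fun u hu => ?_
      rw [AddSubmonoidClass.coe_nsmul, map_neg, map_nsmul, ((hm u).1 hu).2, smul_zero, neg_zero]
    · refine (ofAdd_notMem_iff p).2 fun u hu => ?_
      rw [map_neg, map_add, map_sub, h u hu, map_nsmul, ((hm u).1 hu).2, smul_zero, sub_self,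
        add_zero, neg_zero]
    · refine Multiplicative.toAdd.injective (Subtype.ext ?_)
      change n • (m : M) + a.toAdd = (a.toAdd : M) - b.toAdd + n • (m : M) + b.toAdd
      abel
  · rintro ⟨s, t, hs, ht, hst⟩ u hu
    have hz : ∀ c : Multiplicative (Δ.S σ), c ∉ p.ideal → u (c.toAdd : M) = 0 := fun c hc =>
      (neg_mem_iff_forall (dualMonoid_anti (chartFace_le p) c.toAdd.2)).1
        ((ofAdd_notMem_iff p (s := c.toAdd)).1 hc) u hu
    have h1 := congrArg (fun c : Multiplicative (Δ.S σ) => u (c.toAdd : M)) hst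
    simp only [toAdd_mul, AddSubmonoid.coe_add, map_add, hz s hs, hz t ht, zero_add] at h1
    exact h1

/-- The isomorphism `S_τ / S_τ^* ≃ (S_σ)_p / (S_σ)_p^*` for `τ = chartFace p`. -/
noncomputable def chartStalkMap :
    Associates (Multiplicative (Δ.S (chartFace p))) →* p.Stalk :=
  descHom (chartHom p) (chartHom_surjective p) p.toStalk fun a b => (chartHom_eq_iff p a b).1

lemma chartStalkMap_cls (s : Δ.S σ) :
    chartStalkMap p (cls (chartFace p) (Δ.incl (chartFace_le p) s)) =
      p.toStalk (Multiplicative.ofAdd s) :=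
  descHom_apply (chartHom p) (chartHom_surjective p) p.toStalk _ (Multiplicative.ofAdd s)

lemma chartStalkMap_bijective : Function.Bijective (chartStalkMap p) :=
  descHom_bijective _ _ _ _ p.toStalk_surjective fun a b => (chartHom_eq_iff p a b).2

lemma continuous_chartFace : Continuous (Y := (fanSpace Δ).carrier)
    (chartFace : MonoidPrime (Multiplicative (Δ.S σ)) → Δ.Cone) := by
  refine continuous_def.2 fun s hs => isOpen_iff_forall_mem_open.2 fun p hp => ?_
  obtain ⟨m, hmp, hm⟩ := exists_chartFace_cutsOut p
  refine ⟨_, fun q hq => ?_, (MonoidPrime.basicOpen (Multiplicative.ofAdd m)).2, hmp⟩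
  exact isOpen_fanSpace_iff.1 hs (le_of_cutsOut hm (chartFace_le q) ((ofAdd_notMem_iff q).1 hq)) hp

variable (σ) in
/-- The inclusion of the open subspace of faces of `σ`, which is the spectrum of `S_σ`. -/
noncomputable def fanChart :
    MonoidalSpace.Hom (monoidSpec (Multiplicative (Δ.S σ))) (fanSpace Δ) where
  base := chartFace
  continuous_base := continuous_chartFace
  stalkMap p := chartStalkMap p
  isLocal p a h := isUnit_of_map_bijective _ (chartStalkMap_bijective p) a h
  isSection_comp V t ht p := by
    obtain ⟨s, hs⟩ := exists_forall_eq_cls (chartFace_le p.1) ht p.2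
    obtain ⟨m, hmp, hm⟩ := exists_chartFace_cutsOut p.1
    have hle : ∀ q : MonoidPrime (Multiplicative (Δ.S σ)), Multiplicative.ofAdd m ∉ q.ideal →
        chartFace q ≤ chartFace p.1 := fun q hq =>
      le_of_cutsOut hm (chartFace_le q) ((ofAdd_notMem_iff q).1 hq)
    refine ⟨MonoidPrime.basicOpen (Multiplicative.ofAdd m), fun q hq => ?_,
      Multiplicative.ofAdd s, hmp, fun q => ?_⟩
    · exact isOpen_fanSpace_iff.1 V.2 (hle q hq) p.2
    · exact (congrArg (chartStalkMap q.1) (hs _ (hle q.1 q.2) _)).trans (chartStalkMap_cls q.1 s)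

lemma isOpenImmersion_fanChart : (fanChart σ).IsOpenImmersion := by
  refine ⟨Topology.IsOpenEmbedding.of_continuous_injective_isOpenMap continuous_chartFace
    (fun p q h => ?_) fun U hU => ?_, chartStalkMap_bijective⟩
  · exact MonoidPrime.ext (Set.Subset.antisymm (chartFace_le_iff.1 (le_of_eq h))
      (chartFace_le_iff.1 (le_of_eq h.symm)))
  · refine isOpen_fanSpace_iff.2 ?_
    rintro _ τ hτ ⟨p, hp, rfl⟩
    obtain ⟨q, rfl⟩ := exists_chartFace_eq (le_trans hτ (chartFace_le p))
    exact ⟨q, (MonoidPrime.specializes_iff.2 (chartFace_le_iff.1 hτ)).mem_open hU hp, rfl⟩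

lemma range_fanChart : Set.range (fanChart σ).base = {τ : Δ.Cone | τ ≤ σ} := by
  ext τ
  constructor
  · rintro ⟨p, rfl⟩
    exact chartFace_le p
  · exact fun h => exists_chartFace_eq h

end Chart

lemma isFineSaturated_dualMonoid [Module.Finite ℤ M] (σ : Δ.Cone) :
    IsFineSaturated (Multiplicative (Δ.S σ)) := by
  refine ⟨?_, fun a b c h => mul_left_cancel h, ?_⟩
  · have : AddMonoid.FG (Δ.S σ) :=
      (AddMonoid.fg_iff_addSubmonoid_fg _).2 (Δ.rational σ.1 σ.2).fg_dualMonoid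
    infer_instance
  · rintro a b n hn ⟨c, hc⟩
    have key : (a.toAdd : M) - b.toAdd ∈ Δ.S σ := fun u hu => by
      have h1 := congrArg (fun c : Multiplicative (Δ.S σ) => u (c.toAdd : M)) hc
      simp only [toAdd_mul, toAdd_pow, AddSubmonoid.coe_add, AddSubmonoidClass.coe_nsmul, map_add,
        map_nsmul, nsmul_eq_mul] at h1
      have h2 := c.toAdd.2 u hu
      have h3 : (0 : ℝ) < n := by exact_mod_cast hn
      rw [map_sub]
      by_contra! hlt
      nlinarith [mul_neg_of_pos_of_neg h3 hlt]
    refine ⟨Multiplicative.ofAdd ⟨_, key⟩, Multiplicative.toAdd.injective (Subtype.ext ?_)⟩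
    change (a.toAdd : M) = (b.toAdd : M) + ((a.toAdd : M) - b.toAdd)
    abel

lemma isKatoFan_fanSpace : IsKatoFan (fanSpace Δ) :=
  ⟨fun _ a ha => (Associates.isUnit_iff_eq_one a).1 ha, fun σ =>
    ⟨_, _, fanChart σ, isOpenImmersion_fanChart, exists_chartFace_eq (le_refl (α := Δ.Cone) σ)⟩⟩

theorem isFineSaturatedKatoFan_fanSpace [Module.Finite ℤ M] :
    IsFineSaturatedKatoFan (fanSpace Δ) := by
  refine ⟨isKatoFan_fanSpace, ?_, fun P _ j hj => ?_⟩
  · have : Finite (fanSpace Δ).carrier := Δ.finite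
    infer_instance
  · let σ : Δ.Cone := j.base (MonoidPrime.maximal P)
    refine ⟨_, _, fanChart σ, isFineSaturated_dualMonoid σ, isOpenImmersion_fanChart, ?_⟩
    rw [range_fanChart]
    ext τ
    constructor
    · exact fun h => isOpen_fanSpace_iff.1 hj.1.isOpen_range h ⟨_, rfl⟩
    · rintro ⟨p, rfl⟩
      have h1 : σ ∈ faces Δ σ := le_refl σ
      exact MonoidPrime.mem_of_maximal_mem
        (U := ⟨j.base ⁻¹' faces Δ σ, (faces Δ σ).2.preimage j.continuous_base⟩) h1 p

end FanSpace

end TropLog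

/-! ### The extended cone complex -/

namespace TropLog

section ConeComplex

variable {M : Type u} [AddCommGroup M] {Δ : Fan M}

lemma closedPt_toStalk_injective : Function.Injective closedPt.toStalk := by
  have hu : ∀ s : Multiplicative ℝ≥0∞, s ∉ closedPt.ideal → s = 1 := fun s hs => by
    obtain ⟨t, ht⟩ := (not_not.1 hs : IsUnit s).exists_right_inv
    have h : s.toAdd + t.toAdd = 0 := ht
    exact (add_eq_zero.1 h).1
  intro a b h
  obtain ⟨s, t, hs, ht, h⟩ := (MonoidPrime.toStalk_eq_iff _ _ _).1 h
  rwa [hu s hs, hu t ht, one_mul, one_mul] at h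

lemma isUnit_closedPt_toStalk_iff (r : ℝ≥0∞) :
    IsUnit (closedPt.toStalk (Multiplicative.ofAdd r)) ↔ r = 0 := by
  rw [Associates.isUnit_iff_eq_one, ← map_one closedPt.toStalk,
    closedPt_toStalk_injective.eq_iff]
  exact Iff.rfl

/-- The image of a point of `Spec [0, ∞]` under a point of the extended cone complex. -/
def conePt (u : ExtendedConeComplex (fanSpace Δ)) (y : MonoidPrime (Multiplicative ℝ≥0∞)) :
    Δ.Cone :=
  MonoidalSpace.Hom.base u y

/-- The homomorphism on stalks given by a point of the extended cone complex. -/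
def coneMap (u : ExtendedConeComplex (fanSpace Δ)) (y : MonoidPrime (Multiplicative ℝ≥0∞)) :
    Associates (Multiplicative (Δ.S (conePt u y))) →* y.Stalk :=
  MonoidalSpace.Hom.stalkMap u y

lemma isUnit_coneMap_iff {u : ExtendedConeComplex (fanSpace Δ)}
    {y : MonoidPrime (Multiplicative ℝ≥0∞)} {s : Δ.S (conePt u y)} :
    IsUnit (coneMap u y (cls _ s)) ↔ -(s : M) ∈ Δ.S (conePt u y) := by
  rw [← isUnit_cls_iff]
  exact ⟨MonoidalSpace.Hom.isLocal u y _, fun h => h.map _⟩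

/-- The point `u` of the extended cone complex sends the closed point to `σ` and is given on the
stalk `S_σ / S_σ^*` by the homomorphism `w : S_σ → [0, ∞]`. -/
def Represents (u : ExtendedConeComplex (fanSpace Δ)) (σ : Δ.Cone) (w : Δ.S σ →+ ℝ≥0∞) : Prop :=
  ∃ h : conePt u closedPt = σ, ∀ s : Δ.S σ,
    coneMap u closedPt (cls (conePt u closedPt) (Δ.incl (le_of_eq h) s)) =
      closedPt.toStalk (Multiplicative.ofAdd (w s))

lemma Represents.isLocalTrop {u : ExtendedConeComplex (fanSpace Δ)} {σ : Δ.Cone}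
    {w : Δ.S σ →+ ℝ≥0∞} (h : Represents u σ w) : IsLocalTrop w := by
  obtain ⟨rfl, h⟩ := h
  intro s hs
  refine (isUnit_coneMap_iff (s := s)).1 ?_
  rw [show s = Δ.incl le_rfl s from rfl, h s, isUnit_closedPt_toStalk_iff, hs]

/-- The stalk of `Spec [0, ∞]` at the closed point is `[0, ∞]` itself. -/
lemma exists_represents_base (u : ExtendedConeComplex (fanSpace Δ)) :
    ∃ w : Δ.S (conePt u closedPt) →+ ℝ≥0∞, Represents u (conePt u closedPt) w := by
  have key : ∀ s : Δ.S (conePt u closedPt), ∃ r : ℝ≥0∞,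
      coneMap u closedPt (cls (conePt u closedPt) s) =
        closedPt.toStalk (Multiplicative.ofAdd r) := fun s => by
    obtain ⟨r, hr⟩ := closedPt.toStalk_surjective (coneMap u closedPt (cls (conePt u closedPt) s))
    exact ⟨r.toAdd, hr.symm⟩
  choose w hw using key
  have hinj : ∀ r r' : ℝ≥0∞, closedPt.toStalk (Multiplicative.ofAdd r) =
      closedPt.toStalk (Multiplicative.ofAdd r') → r = r' := fun r r' h =>
    closedPt_toStalk_injective h
  refine ⟨{ toFun := w, map_zero' := hinj _ _ ?_, map_add' := fun a b => hinj _ _ ?_ },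
    rfl, fun s => hw s⟩
  · rw [← hw, cls_zero]
    exact (map_one (coneMap u closedPt)).trans (map_one closedPt.toStalk).symm
  · rw [← hw, cls_add, ofAdd_add, map_mul closedPt.toStalk, ← hw, ← hw]
    exact map_mul (coneMap u closedPt) _ _

/-- A local homomorphism `S_σ → [0, ∞]` induces a morphism from `Spec [0, ∞]` to the chart
`Spec S_σ` of the Kato fan. It sends the closed point to `σ` because the homomorphism is local. -/
lemma exists_represents {σ : Δ.Cone} {w : Δ.S σ →+ ℝ≥0∞} (hw : IsLocalTrop w) :
    ∃ u, Represents u σ w := by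
  let f : Multiplicative (Δ.S σ) →* Multiplicative ℝ≥0∞ := AddMonoidHom.toMultiplicative w
  let p : MonoidPrime (Multiplicative (Δ.S σ)) := closedPt.comap f
  have hp : chartFace p = σ := by
    refine chartFace_eq_of_forall p le_rfl fun s => ?_
    change (¬ ¬ IsUnit (Multiplicative.ofAdd (w s))) ↔ _
    rw [not_not]
    constructor
    · rintro ⟨t, ht⟩
      refine hw s ?_
      have h1 : ((t : Multiplicative ℝ≥0∞).toAdd) + ((t⁻¹ : (Multiplicative ℝ≥0∞)ˣ) :
          Multiplicative ℝ≥0∞).toAdd = 0 := t.mul_inv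
      rw [add_eq_zero, ht] at h1
      exact h1.1
    · intro hs
      have h1 : w s + w ⟨_, hs⟩ = 0 := by
        rw [← map_add, ← map_zero w]
        congr 1
        ext
        exact add_neg_cancel _
      rw [(add_eq_zero.1 h1).1]
      exact isUnit_one
  refine ⟨(monoidSpecMap f).comp (fanChart σ), hp, fun s => ?_⟩
  refine (congrArg (closedPt.stalkMap f) (chartStalkMap_cls p s)).trans ?_
  exact MonoidPrime.stalkMap_toStalk f closedPt (Multiplicative.ofAdd s)

/-- A point of the extended cone complex is determined by its values at the closed point: every
open neighbourhood of the closed point of `Spec [0, ∞]` is the whole space, and every germ at a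
face of `σ` comes from a germ at `σ`. -/
lemma Represents.unique {u u' : ExtendedConeComplex (fanSpace Δ)} {σ : Δ.Cone}
    {w : Δ.S σ →+ ℝ≥0∞} (h : Represents u σ w) (h' : Represents u' σ w) : u = u' := by
  obtain ⟨e, h⟩ := h
  obtain ⟨e', h'⟩ := h'
  have hall : ∀ (v : ExtendedConeComplex (fanSpace Δ)), conePt v closedPt = σ → ∀ y,
      conePt v y ≤ σ := fun v hv y =>
    MonoidPrime.mem_of_maximal_mem (U := ⟨MonoidalSpace.Hom.base v ⁻¹' faces Δ σ,
      (faces Δ σ).2.preimage (MonoidalSpace.Hom.continuous_base v)⟩) (le_of_eq hv) y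
  have hu := hall u e
  have hu' := hall u' e'
  let X := monoidSpec (Multiplicative ℝ≥0∞)
  have hsec : ∀ (s : Δ.S σ) (y : MonoidPrime (Multiplicative ℝ≥0∞)),
      coneMap u y (cls _ (Δ.incl (hu y) s)) = coneMap u' y (cls _ (Δ.incl (hu' y) s)) := by
    intro s y
    have a1 := MonoidalSpace.Hom.isSection_comp u _ _ (isSection_clsSection σ s)
    have a2 := MonoidalSpace.Hom.isSection_comp u' _ _ (isSection_clsSection σ s)
    have b1 := X.isSection_res _ ⊤ (fun z _ => hu z) _ a1
    have b2 := X.isSection_res _ ⊤ (fun z _ => hu' z) _ a2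
    obtain ⟨V, hV, hc, H⟩ := X.eq_nearby ⊤ _ _ b1 b2 ⟨closedPt, trivial⟩
      ((h s).trans (h' s).symm)
    exact H ⟨y, MonoidPrime.mem_of_maximal_mem hc y⟩
  have hle : ∀ y, conePt u y = conePt u' y := fun y => by
    refine le_antisymm (face_le_of_forall (hu' y) (hu y) fun s hs => ?_)
      (face_le_of_forall (hu y) (hu' y) fun s hs => ?_)
    · have := isUnit_coneMap_iff.2 (show -((Δ.incl (hu' y) s : Δ.S _) : M) ∈ _ from hs)
      rw [← hsec] at this
      exact isUnit_coneMap_iff.1 this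
    · have := isUnit_coneMap_iff.2 (show -((Δ.incl (hu y) s : Δ.S _) : M) ∈ _ from hs)
      rw [hsec] at this
      exact isUnit_coneMap_iff.1 this
  refine MonoidalSpace.Hom.ext_of_sections hle fun y V t ht h1 h2 => ?_
  obtain ⟨s, hs⟩ := exists_forall_eq_cls (hu y) ht h1
  exact (congrArg (coneMap u y) (hs (conePt u y) le_rfl h1)).trans ((hsec s y).trans
    (congrArg (coneMap u' y) (hs (conePt u' y) (le_of_eq (hle y).symm) h2)).symm)

/-- The point of `N_ℝ(Δ)` given by a point of the extended cone complex. -/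
noncomputable def toNRDelta (u : ExtendedConeComplex (fanSpace Δ)) : NRDelta Δ :=
  NRDelta.mk Δ (conePt u closedPt) (ennrealToWithTop.comp (exists_represents_base u).choose)

lemma Represents.toNRDelta_eq {u : ExtendedConeComplex (fanSpace Δ)} {σ : Δ.Cone}
    {w : Δ.S σ →+ ℝ≥0∞} (h : Represents u σ w) :
    toNRDelta u = NRDelta.mk Δ σ (ennrealToWithTop.comp w) := by
  obtain ⟨rfl, h⟩ := h
  obtain ⟨_, h'⟩ := (exists_represents_base u).choose_spec
  have : (exists_represents_base u).choose = w := by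
    ext1 s
    exact closedPt_toStalk_injective ((h' s).symm.trans (h s))
  rw [toNRDelta, this]

lemma toNRDelta_injective [Module.Finite ℤ M] :
    Function.Injective (toNRDelta (Δ := Δ)) := by
  intro u u' h
  obtain ⟨w, hw⟩ := exists_represents_base u
  obtain ⟨w', hw'⟩ := exists_represents_base u'
  rw [hw.toNRDelta_eq, hw'.toNRDelta_eq] at h
  have key : ∀ (σ τ : Δ.Cone) (w : Δ.S σ →+ ℝ≥0∞) (w' : Δ.S τ →+ ℝ≥0∞), Represents u σ w →
      Represents u' τ w' → NRDelta.mk Δ σ (ennrealToWithTop.comp w) =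
        NRDelta.mk Δ τ (ennrealToWithTop.comp w') → u = u' := by
    intro σ τ w w' hw hw' h
    obtain rfl := hw.isLocalTrop.cone_eq hw'.isLocalTrop h
    obtain rfl := IsLocalTrop.eq_of_mk_eq h
    exact hw.unique hw'
  exact key _ _ w w' hw hw' h

lemma range_toNRDelta [Module.Finite ℤ M] : Set.range (toNRDelta (Δ := Δ)) = closureFan Δ := by
  ext p
  rw [mem_closureFan_iff]
  constructor
  · rintro ⟨u, rfl⟩
    exact ⟨_, _, fun s => ennrealToWithTop_nonneg _, rfl⟩
  · rintro ⟨σ, v, hv, rfl⟩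
    obtain ⟨τ, w, hw, h⟩ := exists_isLocalTrop v hv
    obtain ⟨u, hu⟩ := exists_represents hw
    exact ⟨u, hu.toNRDelta_eq.trans h.symm⟩

end ConeComplex

end TropLog

/-! ### Factorization of elements dividing a character -/

namespace TropLog

section SemigroupAlgebra

variable {k : Type u} [Field k] {M : Type u} [AddCommGroup M] {Δ : Fan M}

/-- The lattice `M` has unique sums, since it is a free abelian group; this is what makes `k[S_σ]` a
domain. -/
lemma uniqueSums_dualMonoid [Module.Free ℤ M] (σ : Δ.Cone) : UniqueSums (Δ.S σ) := by
  let e := (Module.Free.chooseBasis ℤ M).repr.toAddEquiv.toAddMonoidHom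
  have h : UniqueSums M := UniqueSums.of_injective_addHom (AddHomClass.toAddHom e)
    (Module.Free.chooseBasis ℤ M).repr.injective inferInstance
  exact UniqueSums.of_injective_addHom ((Δ.S σ).subtype : Δ.S σ →ₙ+ M) Subtype.val_injective h

/-- If no sum of an element of `A` and an element of `B` arises from other monomials of `f` and
`g`, then some such sum occurs in `f * g`. -/
lemma exists_add_mem_support [Module.Free ℤ M] {σ : Δ.Cone} {f g : coordRing k Δ σ}
    {A B : Finset (Δ.S σ)} (hA : A.Nonempty) (hB : B.Nonempty)
    (hAf : A ⊆ f.coeff.support) (hBg : B ⊆ g.coeff.support)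
    (H : ∀ c ∈ f.coeff.support, ∀ d ∈ g.coeff.support, ∀ a ∈ A, ∀ b ∈ B, c + d = a + b →
      c ∈ A ∧ d ∈ B) :
    ∃ a ∈ A, ∃ b ∈ B, (f * g).coeff (a + b) ≠ 0 := by
  have := uniqueSums_dualMonoid σ
  obtain ⟨a, ha, b, hb, hab⟩ := UniqueSums.uniqueAdd_of_nonempty hA hB
  have h : UniqueAdd f.coeff.support g.coeff.support a b := fun c d hc hd hcd => by
    obtain ⟨h1, h2⟩ := H c hc d hd a ha b hb hcd
    exact hab h1 h2 hcd
  refine ⟨a, ha, b, hb, ?_⟩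
  rw [AddMonoidAlgebra.coeff_mul_add_of_uniqueAdd h]
  exact mul_ne_zero (Finsupp.mem_support_iff.1 (hAf ha)) (Finsupp.mem_support_iff.1 (hBg hb))

lemma character_add {σ : Δ.Cone} (s t : Δ.S σ) :
    character k Δ σ (s + t) = character k Δ σ s * character k Δ σ t :=
  map_mul (AddMonoidAlgebra.of k (Δ.S σ)) (Multiplicative.ofAdd s) (Multiplicative.ofAdd t)

lemma character_zero {σ : Δ.Cone} : character k Δ σ 0 = 1 :=
  map_one (AddMonoidAlgebra.of k (Δ.S σ))

lemma character_nsmul {σ : Δ.Cone} (n : ℕ) (s : Δ.S σ) :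
    character k Δ σ (n • s) = character k Δ σ s ^ n :=
  map_pow (AddMonoidAlgebra.of k (Δ.S σ)) (Multiplicative.ofAdd s) n

lemma coordMap_character {τ σ : Δ.Cone} (h : τ ≤ σ) (s : Δ.S σ) :
    coordMap k Δ h (character k Δ σ s) = character k Δ τ (Δ.incl h s) :=
  coordMap_single k Δ h s 1

lemma coeff_character_mul {σ : Δ.Cone} (s c : Δ.S σ) (f : coordRing k Δ σ) :
    (character k Δ σ s * f).coeff (s + c) = f.coeff c := by
  rw [character, AddMonoidAlgebra.of_apply]
  refine (AddMonoidAlgebra.coeff_single_mul_add f 1 s c).trans (one_mul _)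

lemma exists_of_coeff_character_mul_ne_zero {σ : Δ.Cone} {s e : Δ.S σ} {f : coordRing k Δ σ}
    (h : (character k Δ σ s * f).coeff e ≠ 0) : ∃ c, s + c = e ∧ f.coeff c ≠ 0 := by
  by_contra! H
  by_cases hd : ∃ c, s + c = e
  · obtain ⟨c, rfl⟩ := hd
    rw [coeff_character_mul] at h
    exact h (H c rfl)
  · push Not at hd
    exact h (AddMonoidAlgebra.coeff_single_mul_of_forall_add_ne _ _ hd)

lemma exists_of_coeff_mul_ne_zero {σ : Δ.Cone} {f g : coordRing k Δ σ} {e : Δ.S σ}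
    (h : (f * g).coeff e ≠ 0) : ∃ c d, f.coeff c ≠ 0 ∧ g.coeff d ≠ 0 ∧ c + d = e := by
  classical
  obtain ⟨c, hc, d, hd, hcd⟩ := Finset.mem_add.1
    (AddMonoidAlgebra.support_coeff_mul_subset f g (Finsupp.mem_support_iff.2 h))
  exact ⟨c, d, Finsupp.mem_support_iff.1 hc, Finsupp.mem_support_iff.1 hd, hcd⟩

/-- The minimum of an additive function on the support is additive on products. -/
lemma exists_support_mul_le [Module.Free ℤ M] {σ : Δ.Cone} {f g : coordRing k Δ σ}
    (hf : f ≠ 0) (hg : g ≠ 0) (v : M →+ ℝ) :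
    ∃ e : Δ.S σ, (f * g).coeff e ≠ 0 ∧
      ∀ c d : Δ.S σ, f.coeff c ≠ 0 → g.coeff d ≠ 0 → v e ≤ v c + v d := by
  have hne : ∀ f : coordRing k Δ σ, f ≠ 0 → f.coeff.support.Nonempty := fun f hf =>
    Finsupp.support_nonempty_iff.2 fun h => hf (AddMonoidAlgebra.coeff_eq_zero.1 h)
  obtain ⟨c₀, hc₀, hc⟩ := Finset.exists_min_image _ (fun c : Δ.S σ => v c) (hne f hf)
  obtain ⟨d₀, hd₀, hd⟩ := Finset.exists_min_image _ (fun c : Δ.S σ => v c) (hne g hg)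
  obtain ⟨a, ha, b, hb, hab⟩ := exists_add_mem_support
    (A := f.coeff.support.filter fun c => v c = v c₀)
    (B := g.coeff.support.filter fun d => v d = v d₀)
    ⟨c₀, Finset.mem_filter.2 ⟨hc₀, rfl⟩⟩ ⟨d₀, Finset.mem_filter.2 ⟨hd₀, rfl⟩⟩
    (Finset.filter_subset _ _) (Finset.filter_subset _ _) (by
      intro c hc' d hd' a ha b hb h
      have h1 := congrArg (fun e : Δ.S σ => v e) h
      simp only [AddSubmonoid.coe_add, map_add, (Finset.mem_filter.1 ha).2,
        (Finset.mem_filter.1 hb).2] at h1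
      have h2 := hc c hc'
      have h3 := hd d hd'
      exact ⟨Finset.mem_filter.2 ⟨hc', by linarith⟩, Finset.mem_filter.2 ⟨hd', by linarith⟩⟩)
  refine ⟨a + b, hab, fun c d hc' hd' => ?_⟩
  rw [AddSubmonoid.coe_add, map_add, (Finset.mem_filter.1 ha).2, (Finset.mem_filter.1 hb).2]
  exact add_le_add (hc c (Finsupp.mem_support_iff.2 hc')) (hd d (Finsupp.mem_support_iff.2 hd'))

lemma exists_eq_character_mul {σ : Δ.Cone} {f : coordRing k Δ σ} {s : Δ.S σ}
    (h : ∀ c : Δ.S σ, f.coeff c ≠ 0 → (c : M) - s ∈ Δ.S σ) : ∃ g, f = character k Δ σ s * g := by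
  classical
  suffices H : f ∈ Ideal.span {character k Δ σ s} by
    obtain ⟨g, hg⟩ := Ideal.mem_span_singleton.1 H
    exact ⟨g, hg⟩
  rw [← AddMonoidAlgebra.sum_coeff_single f]
  refine Ideal.sum_mem _ fun c hc => ?_
  refine Ideal.mem_span_singleton.2
    ⟨AddMonoidAlgebra.single ⟨_, h c (Finsupp.mem_support_iff.1 hc)⟩ (f.coeff c), ?_⟩
  rw [character, AddMonoidAlgebra.of_apply, AddMonoidAlgebra.single_mul_single, one_mul]
  congr 1
  ext
  exact (add_sub_cancel (s : M) c).symm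

/-- An element outside an ideal which contains all non-invertible characters has an invertible
character in its support. -/
lemma exists_neg_mem_of_notMem {σ : Δ.Cone} {p : Ideal (coordRing k Δ σ)}
    (hp : ∀ s : Δ.S σ, -(s : M) ∉ Δ.S σ → character k Δ σ s ∈ p) {f : coordRing k Δ σ}
    (hf : f ∉ p) : ∃ c : Δ.S σ, f.coeff c ≠ 0 ∧ -(c : M) ∈ Δ.S σ := by
  by_contra! H
  refine hf ?_
  rw [← AddMonoidAlgebra.sum_coeff_single f]
  refine Ideal.sum_mem _ fun c hc => ?_
  have : AddMonoidAlgebra.single c (f.coeff c) =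
      AddMonoidAlgebra.single 0 (f.coeff c) * character k Δ σ c := by
    rw [character, AddMonoidAlgebra.of_apply, AddMonoidAlgebra.single_mul_single, mul_one]
    exact congrArg₂ _ (zero_add c).symm rfl
  rw [this]
  exact Ideal.mul_mem_left _ _ (hp c (H c (Finsupp.mem_support_iff.1 hc)))

/-- A divisor of a character in the local ring of a point of the closed orbit of `U_σ` is a
character times a unit. -/
lemma exists_eq_character_mul_of_mul_eq [Module.Free ℤ M] {σ : Δ.Cone}
    {p : Ideal (coordRing k Δ σ)} (hp : ∀ s : Δ.S σ, character k Δ σ s ∈ p ↔ -(s : M) ∉ Δ.S σ)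
    {a b h : coordRing k Δ σ} {t : Δ.S σ} (hh : h ∉ p) (hab : a * b = character k Δ σ t * h) :
    ∃ s g, a = character k Δ σ s * g ∧ g ∉ p := by
  obtain ⟨c, hc, hcn⟩ := exists_neg_mem_of_notMem (fun s => (hp s).2) hh
  have h1 : (a * b).coeff (t + c) ≠ 0 := by rwa [hab, coeff_character_mul]
  -- the monomial `t + c` of `a * b` is a sum of monomials `s` of `a` and `s'` of `b`, which turn
  -- out to be minimal on `σ` in the supports of `a` and `b`
  obtain ⟨s, s', hs, hs', hss⟩ := exists_of_coeff_mul_ne_zero h1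
  have ha : a ≠ 0 := fun h => hs (by rw [h]; rfl)
  have hb : b ≠ 0 := fun h => hs' (by rw [h]; rfl)
  have hv : ∀ v ∈ σ.1, v s + v s' = v t := fun v hv => by
    have h2 := congrArg (fun e : Δ.S σ => v e) hss
    simp only [AddSubmonoid.coe_add, map_add] at h2
    rw [h2, (neg_mem_iff_forall c.2).1 hcn v hv, add_zero]
  have key : ∀ v ∈ σ.1, ∀ d d' : Δ.S σ, a.coeff d ≠ 0 → b.coeff d' ≠ 0 →
      v s + v s' ≤ v d + v d' := fun v hvσ d d' hd hd' => by
    obtain ⟨e, he, hle⟩ := exists_support_mul_le ha hb v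
    rw [hab] at he
    obtain ⟨r, rfl, -⟩ := exists_of_coeff_character_mul_ne_zero he
    refine le_trans ?_ (hle d d' hd hd')
    rw [AddSubmonoid.coe_add, map_add, hv v hvσ]
    linarith [r.2 v hvσ]
  obtain ⟨g, rfl⟩ := exists_eq_character_mul (f := a) (s := s) fun d hd v hvσ => by
    rw [map_sub]
    linarith [key v hvσ d s' hd hs']
  obtain ⟨g', rfl⟩ := exists_eq_character_mul (f := b) (s := s') fun d hd v hvσ => by
    rw [map_sub]
    linarith [key v hvσ s d hs hd]
  refine ⟨s, g, rfl, fun hg => hh ?_⟩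
  have e1 : character k Δ σ s * character k Δ σ s' = character k Δ σ t * character k Δ σ c := by
    rw [← character_add, ← character_add, hss]
  have e2 : character k Δ σ t * h = character k Δ σ t * (character k Δ σ c * (g * g')) := by
    rw [← hab, ← mul_assoc _ _ (g * g'), ← e1]
    ring
  have e3 : h = character k Δ σ c * (g * g') := by
    refine AddMonoidAlgebra.ext (Finsupp.ext fun r => ?_)
    rw [← coeff_character_mul t, e2, coeff_character_mul]
  rw [e3]
  exact Ideal.mul_mem_left _ _ (Ideal.mul_mem_right _ _ hg)

/-- If `χ^s f = χ^t g` and `f` does not vanish at a point of the closed orbit, then `t ≤ s` on `σ`: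
some monomial of `f` is an invertible character. -/
lemma le_of_character_mul_eq {σ : Δ.Cone} {p : Ideal (coordRing k Δ σ)}
    (hp : ∀ s : Δ.S σ, character k Δ σ s ∈ p ↔ -(s : M) ∉ Δ.S σ)
    {f g : coordRing k Δ σ} {s t : Δ.S σ} (hf : f ∉ p)
    (h : character k Δ σ s * f = character k Δ σ t * g) {v : M →+ ℝ} (hv : v ∈ σ.1) :
    v t ≤ v s := by
  obtain ⟨c, hc, hcn⟩ := exists_neg_mem_of_notMem (fun s => (hp s).2) hf
  have h1 : (character k Δ σ t * g).coeff (s + c) ≠ 0 := by rwa [← h, coeff_character_mul]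
  obtain ⟨d, hd, -⟩ := exists_of_coeff_character_mul_ne_zero h1
  have h2 := congrArg (fun e : Δ.S σ => v e) hd
  simp only [AddSubmonoid.coe_add, map_add, (neg_mem_iff_forall c.2).1 hcn v hv] at h2
  linarith [d.2 v hv]

variable (k) in
/-- The prime ideal of the generic point of the closed orbit of `U_σ`. -/
def orbitIdeal [Module.Free ℤ M] (σ : Δ.Cone) : PrimeSpectrum (coordRing k Δ σ) where
  asIdeal :=
    { carrier := {f | ∀ c : Δ.S σ, -(c : M) ∈ Δ.S σ → f.coeff c = 0}
      zero_mem' := fun _ _ => rfl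
      add_mem' := fun {f g} hf hg c hc => by
        rw [AddMonoidAlgebra.coeff_add, Finsupp.add_apply, hf c hc, hg c hc, add_zero]
      smul_mem' := fun f g hg e he => by
        by_contra h
        obtain ⟨c, d, -, hd, rfl⟩ := exists_of_coeff_mul_ne_zero h
        refine hd (hg d ?_)
        have := add_mem he c.2
        rwa [AddSubmonoid.coe_add, neg_add, add_comm, add_neg_cancel_left] at this }
  isPrime := by
    refine ⟨fun h => ?_, fun {f g} hfg => ?_⟩
    · have h1 : (1 : coordRing k Δ σ).coeff 0 = 0 := (Ideal.eq_top_iff_one _).1 h 0 (by simp)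
      rw [AddMonoidAlgebra.one_def, AddMonoidAlgebra.coeff_single, Finsupp.single_eq_same] at h1
      exact one_ne_zero h1
    · by_contra! H
      obtain ⟨hf, hg⟩ := H
      have hex : ∀ f : coordRing k Δ σ, ¬ (∀ c : Δ.S σ, -(c : M) ∈ Δ.S σ → f.coeff c = 0) →
          ∃ c, f.coeff c ≠ 0 ∧ -(c : M) ∈ Δ.S σ := fun f hf => by
        push Not at hf
        obtain ⟨c, h1, h2⟩ := hf
        exact ⟨c, h2, h1⟩
      classical
      obtain ⟨c, hc, hcn⟩ := hex f hf
      obtain ⟨d, hd, hdn⟩ := hex g hg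
      obtain ⟨a, ha, b, hb, hab⟩ := exists_add_mem_support
        (A := f.coeff.support.filter fun c => -(c : M) ∈ Δ.S σ)
        (B := g.coeff.support.filter fun c => -(c : M) ∈ Δ.S σ)
        ⟨c, Finset.mem_filter.2 ⟨Finsupp.mem_support_iff.2 hc, hcn⟩⟩
        ⟨d, Finset.mem_filter.2 ⟨Finsupp.mem_support_iff.2 hd, hdn⟩⟩
        (Finset.filter_subset _ _) (Finset.filter_subset _ _) (by
          intro c hc d hd a ha b hb h
          have h1 : -((c : M) + d) ∈ Δ.S σ := by
            rw [← AddSubmonoid.coe_add, h, AddSubmonoid.coe_add, neg_add]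
            exact add_mem (Finset.mem_filter.1 ha).2 (Finset.mem_filter.1 hb).2
          refine ⟨Finset.mem_filter.2 ⟨hc, ?_⟩, Finset.mem_filter.2 ⟨hd, ?_⟩⟩
          · have := add_mem h1 d.2
            rwa [neg_add, neg_add_cancel_right] at this
          · have := add_mem h1 c.2
            rwa [neg_add, add_comm, add_neg_cancel_left] at this)
      refine hab (hfg (a + b) ?_)
      rw [AddSubmonoid.coe_add, neg_add]
      exact add_mem (Finset.mem_filter.1 ha).2 (Finset.mem_filter.1 hb).2

lemma mem_orbitIdeal [Module.Free ℤ M] {σ : Δ.Cone} {f : coordRing k Δ σ} :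
    f ∈ (orbitIdeal k σ).asIdeal ↔ ∀ c : Δ.S σ, -(c : M) ∈ Δ.S σ → f.coeff c = 0 := Iff.rfl

lemma character_mem_orbitIdeal [Module.Free ℤ M] {σ : Δ.Cone} {s : Δ.S σ} :
    character k Δ σ s ∈ (orbitIdeal k σ).asIdeal ↔ -(s : M) ∉ Δ.S σ := by
  classical
  rw [mem_orbitIdeal]
  simp only [character, AddMonoidAlgebra.of_apply, toAdd_ofAdd, AddMonoidAlgebra.coeff_single,
    Finsupp.single_apply]
  constructor
  · intro h hs
    exact one_ne_zero ((if_pos rfl).symm.trans (h s hs))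
  · rintro h c hc
    rw [if_neg]
    rintro rfl
    exact h hc

lemma orbitIdeal_le [Module.Free ℤ M] {σ : Δ.Cone} {p : Ideal (coordRing k Δ σ)}
    (hp : ∀ s : Δ.S σ, -(s : M) ∉ Δ.S σ → character k Δ σ s ∈ p) :
    (orbitIdeal k σ).asIdeal ≤ p := fun f hf => by
  by_contra h
  obtain ⟨c, hc, hcn⟩ := exists_neg_mem_of_notMem hp h
  exact hc (hf c hcn)

/-- The generic point of the orbit of `τ` specializes to that of the orbit of `σ`. -/
lemma comap_orbitIdeal_le [Module.Free ℤ M] {τ σ : Δ.Cone} (h : τ ≤ σ) :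
    (orbitIdeal k τ).asIdeal.comap (coordMap k Δ h) ≤ (orbitIdeal k σ).asIdeal := by
  intro f hf c hc
  have h1 := hf (Δ.incl h c) (dualMonoid_anti h hc)
  have h2 : (coordMap k Δ h f).coeff (Δ.incl h c) = f.coeff c :=
    Finsupp.mapDomain_apply
      (AddSubmonoid.inclusion_injective (dualMonoid_anti (show τ.1 ≤ σ.1 from h))) f.coeff c
  exact h2.symm.trans h1

end SemigroupAlgebra

end TropLog

/-! ### Germs of functions on an affine chart -/

namespace TropLog

section Chart

variable {X : Scheme.{u}} {A : CommRingCat.{u}} (j : Spec A ⟶ X) [IsOpenImmersion j]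

/-- The isomorphism between `A` and the functions on the image of `j : Spec A ⟶ X`. -/
noncomputable def chartSections : A ⟶ Γ(X, j.opensRange) :=
  Spec.preimage (IsOpenImmersion.isoOfRangeEq (isAffineOpen_opensRange j).fromSpec j
    ((isAffineOpen_opensRange j).range_fromSpec)).hom

lemma map_chartSections_comp :
    Spec.map (chartSections j) ≫ j = (isAffineOpen_opensRange j).fromSpec := by
  rw [chartSections, Spec.map_preimage]
  exact IsOpenImmersion.isoOfRangeEq_hom_fac _ _ _

lemma chartSections_bijective : Function.Bijective (chartSections j).hom := by
  refine isIso_SpecMap_iff.1 ?_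
  rw [chartSections, Spec.map_preimage]
  infer_instance

variable {j}

/-- The germ at `x` of an element of `A`. -/
noncomputable def chartGerm {x : X} (hx : x ∈ j.opensRange) : A ⟶ X.presheaf.stalk x :=
  chartSections j ≫ X.presheaf.germ _ x hx

lemma map_chartGerm_comp {x : X} (hx : x ∈ j.opensRange) :
    Spec.map (chartGerm hx) ≫ j = X.fromSpecStalk x := by
  rw [chartGerm, Spec.map_comp, Category.assoc, map_chartSections_comp]
  exact (isAffineOpen_opensRange j).fromSpecStalk_eq_fromSpecStalk hx

lemma eq_chartGerm {x : X} (hx : x ∈ j.opensRange) (g : A ⟶ X.presheaf.stalk x)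
    (hg : Spec.map g ≫ j = X.fromSpecStalk x) : g = chartGerm hx := by
  refine Spec.map_injective ?_
  rw [← cancel_mono j, hg, map_chartGerm_comp]

lemma isUnit_chartGerm_iff {x : X} (hx : x ∈ j.opensRange) {y : Spec A} (hy : j y = x) (a : A) :
    IsUnit ((chartGerm hx).hom a) ↔ a ∉ y.asIdeal := by
  let c : Spec (X.presheaf.stalk x) := IsLocalRing.closedPoint _
  have h2 : (Spec.map (chartGerm hx) ≫ j) c = x := by
    rw [map_chartGerm_comp]
    exact Scheme.fromSpecStalk_closedPoint
  have h1 : Spec.map (chartGerm hx) c = y :=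
    j.isOpenEmbedding.injective (h2.trans hy.symm)
  rw [← h1]
  change _ ↔ ¬ ((chartGerm hx).hom a ∈ IsLocalRing.maximalIdeal _)
  rw [IsLocalRing.mem_maximalIdeal, mem_nonunits_iff, not_not]

/-- Every germ is a fraction of elements of `A`. -/
lemma exists_mul_chartGerm_eq {x : X} (hx : x ∈ j.opensRange) (a : X.presheaf.stalk x) :
    ∃ α β : A, IsUnit ((chartGerm hx).hom β) ∧
      a * (chartGerm hx).hom β = (chartGerm hx).hom α := by
  let _ := X.presheaf.algebra_section_stalk (U := j.opensRange) ⟨x, hx⟩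
  have := (isAffineOpen_opensRange j).isLocalization_stalk ⟨x, hx⟩
  obtain ⟨⟨α, β⟩, h⟩ := IsLocalization.surj
    ((isAffineOpen_opensRange j).primeIdealOf ⟨x, hx⟩).asIdeal.primeCompl a
  have hu := IsLocalization.map_units (X.presheaf.stalk x) β
  have hs := (chartSections_bijective j).2
  obtain ⟨α', hα⟩ := hs α
  obtain ⟨β', hβ⟩ := hs β
  refine ⟨α', β', ?_, ?_⟩
  · rw [← hβ] at hu
    exact hu
  · dsimp only at h
    rw [← hβ, ← hα] at h
    exact h

/-- Elements of `A` with the same germ agree after multiplication by a function which is invertible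
at the point. -/
lemma exists_mul_eq_of_chartGerm_eq {x : X} (hx : x ∈ j.opensRange) {α β : A}
    (h : (chartGerm hx).hom α = (chartGerm hx).hom β) :
    ∃ c, IsUnit ((chartGerm hx).hom c) ∧ c * α = c * β := by
  let _ := X.presheaf.algebra_section_stalk (U := j.opensRange) ⟨x, hx⟩
  have := (isAffineOpen_opensRange j).isLocalization_stalk ⟨x, hx⟩
  obtain ⟨c, hc⟩ := IsLocalization.exists_of_eq
    (M := ((isAffineOpen_opensRange j).primeIdealOf ⟨x, hx⟩).asIdeal.primeCompl)
    (S := X.presheaf.stalk x)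
    (show algebraMap _ _ ((chartSections j).hom α) =
      algebraMap _ _ ((chartSections j).hom β) from h)
  have hu := IsLocalization.map_units (X.presheaf.stalk x) c
  have hb := chartSections_bijective j
  obtain ⟨c', hc'⟩ := hb.2 c
  refine ⟨c', ?_, hb.1 ?_⟩
  · rw [← hc'] at hu
    exact hu
  · rw [map_mul, map_mul, hc', hc]

/-- A unit of the local ring is a germ of the logarithmic structure. -/
lemma mem_logStalk_of_isUnit {X₀ : X.Opens} {x : X} {a : X.presheaf.stalk x} (ha : IsUnit a) :
    a ∈ logStalk X X₀ x := by
  obtain ⟨U, hx, f, rfl⟩ := X.presheaf.exists_germ_eq a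
  have hx' : x ∈ X.basicOpen f := (X.mem_basicOpen f x hx).2 ha
  refine ⟨X.basicOpen f, hx', X.presheaf.map (homOfLE (X.basicOpen_le f)).op f, ?_,
    X.presheaf.germ_res_apply _ _ hx' f⟩
  have h1 : IsUnit (X.presheaf.map (homOfLE (X.basicOpen_le f)).op f) :=
    RingedSpace.isUnit_res_basicOpen _ f
  exact h1.map (X.presheaf.map (homOfLE (inf_le_left : X.basicOpen f ⊓ X₀ ≤ _)).op).hom

lemma mem_logSections_of_forall_isUnit {X₀ U : X.Opens} {f : Γ(X, U)}
    (h : ∀ (x : X) (hx : x ∈ U), x ∈ X₀ → IsUnit (X.presheaf.germ U x hx f)) :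
    f ∈ logSections X X₀ U := by
  refine RingedSpace.isUnit_of_isUnit_germ X.toRingedSpace _ _ fun x hx => ?_
  refine (congrArg IsUnit ?_).mpr (h x hx.1 hx.2)
  exact X.presheaf.germ_res_apply _ _ hx f

lemma isUnit_germ_of_mem_logSections {X₀ U : X.Opens} {f : Γ(X, U)} (hf : f ∈ logSections X X₀ U)
    {x : X} (hx : x ∈ U) (hx₀ : x ∈ X₀) : IsUnit (X.presheaf.germ U x hx f) := by
  have h1 : IsUnit (X.presheaf.map (homOfLE (inf_le_left : U ⊓ X₀ ≤ U)).op f) := hf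
  have hx' : x ∈ U ⊓ X₀ := ⟨hx, hx₀⟩
  have h2 := h1.map (X.presheaf.germ (U ⊓ X₀) x hx').hom
  exact (congrArg IsUnit (X.presheaf.germ_res_apply _ _ hx' f)).mp h2

end Chart

end TropLog

/-! ### Points of a toric variety -/

namespace TropLog

section ToricPoints

variable (k : Type u) [Field k] {M : Type u} [AddCommGroup M] (Δ : Fan M)

/-- The open subset `U_σ` of the toric variety. -/
noncomputable abbrev toricOpen (σ : Δ.Cone) : (toricVariety k Δ).Opens :=
  (toricChart k Δ σ).opensRange

variable {k Δ}

lemma toricDiagram_map_toricChart {τ σ : Δ.Cone} (h : τ ≤ σ) :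
    (toricDiagram k Δ).map (homOfLE h) ≫ toricChart k Δ σ = toricChart k Δ τ :=
  Limits.colimit.w (toricDiagram k Δ) (homOfLE h)

lemma spec_coordMap_toricChart {τ σ : Δ.Cone} (h : τ ≤ σ) :
    Spec.map (CommRingCat.ofHom (coordMap k Δ h).toRingHom) ≫ toricChart k Δ σ =
      toricChart k Δ τ :=
  toricDiagram_map_toricChart h

lemma toricOpen_mono {τ σ : Δ.Cone} (h : τ ≤ σ) : toricOpen k Δ τ ≤ toricOpen k Δ σ := by
  rintro _ ⟨y, rfl⟩
  exact ⟨(toricDiagram k Δ).map (homOfLE h) y,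
    congrArg (fun f : _ ⟶ toricVariety k Δ => f y) (toricDiagram_map_toricChart h)⟩

variable {x : toricVariety k Δ}

lemma chartGerm_coordMap {τ σ : Δ.Cone} (h : τ ≤ σ) (hτ : x ∈ toricOpen k Δ τ)
    (hσ : x ∈ toricOpen k Δ σ) (a : coordRing k Δ σ) :
    (chartGerm hτ).hom (coordMap k Δ h a) = (chartGerm hσ).hom a := by
  have : CommRingCat.ofHom (coordMap k Δ h).toRingHom ≫ chartGerm hτ = chartGerm hσ := by
    refine eq_chartGerm hσ _ ?_
    rw [Spec.map_comp, Category.assoc, spec_coordMap_toricChart, map_chartGerm_comp]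
  rw [← this]
  rfl

lemma chartGerm_character_incl {τ σ : Δ.Cone} (h : τ ≤ σ) (hτ : x ∈ toricOpen k Δ τ)
    (hσ : x ∈ toricOpen k Δ σ) (s : Δ.S σ) :
    (chartGerm hτ).hom (character k Δ τ (Δ.incl h s)) =
      (chartGerm hσ).hom (character k Δ σ s) := by
  rw [← chartGerm_coordMap h hτ hσ, coordMap_character]

/-- For a face `τ = σ ∩ m^⊥` the open subset `U_τ` of `U_σ` is the locus where `χ^m` is
invertible. -/
lemma mem_toricOpen_iff_of_cutsOut {τ σ : Δ.Cone} {m : Δ.S σ} (hm : CutsOut (τ := τ) m)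
    (hσ : x ∈ toricOpen k Δ σ) :
    x ∈ toricOpen k Δ τ ↔ IsUnit ((chartGerm hσ).hom (character k Δ σ m)) := by
  obtain ⟨y, hy⟩ := id hσ
  refine Iff.trans ?_ (isUnit_chartGerm_iff hσ hy _).symm
  have h1 : y ∈ Set.range ((toricDiagram k Δ).map (homOfLE hm.le)) ↔
      character k Δ σ m ∉ y.asIdeal := by
    rw [exists_toricDiagram_map_range k Δ (homOfLE hm.le) m m.2 hm]
    rfl
  rw [← h1]
  constructor
  · rintro ⟨z, hz⟩
    refine ⟨z, (toricChart k Δ σ).isOpenEmbedding.injective (Eq.trans ?_ (hz.trans hy.symm))⟩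
    exact congrArg (fun f : _ ⟶ toricVariety k Δ => f z) (toricDiagram_map_toricChart hm.le)
  · rintro ⟨z, hz⟩
    refine ⟨z, Eq.trans ?_ ((congrArg (toricChart k Δ σ) hz).trans hy)⟩
    exact (congrArg (fun f : _ ⟶ toricVariety k Δ => f z) (toricDiagram_map_toricChart hm.le)).symm

variable (x) in
lemma exists_mem_toricOpen : ∃ σ : Δ.Cone, x ∈ toricOpen k Δ σ := by
  obtain ⟨σ, y, hy⟩ := Scheme.IsLocallyDirected.ι_jointly_surjective (toricDiagram k Δ) x
  exact ⟨σ, y, hy⟩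

lemma exists_mem_toricOpen_le {σ τ : Δ.Cone} (hσ : x ∈ toricOpen k Δ σ)
    (hτ : x ∈ toricOpen k Δ τ) : ∃ l, l ≤ σ ∧ l ≤ τ ∧ x ∈ toricOpen k Δ l := by
  obtain ⟨y, hy⟩ := hσ
  obtain ⟨z, hz⟩ := hτ
  obtain ⟨l, fi, fj, w, hw, -⟩ := (Scheme.IsLocallyDirected.ι_eq_ι_iff (toricDiagram k Δ)).1
    (hy.trans hz.symm)
  refine ⟨l, leOfHom fi, leOfHom fj, w, ?_⟩
  rw [← hy, ← hw]
  exact (congrArg (fun f : _ ⟶ toricVariety k Δ => f w)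
    (Limits.colimit.w (toricDiagram k Δ) fi)).symm

variable (x) in
lemma exists_least_cone : ∃ τ : Δ.Cone, x ∈ toricOpen k Δ τ ∧
    ∀ σ, x ∈ toricOpen k Δ σ → τ ≤ σ := by
  have : Finite Δ.Cone := Δ.finite
  obtain ⟨τ, hτ⟩ := Set.Finite.exists_minimal (s := {σ : Δ.Cone | x ∈ toricOpen k Δ σ})
    (Set.toFinite _) (exists_mem_toricOpen x)
  refine ⟨τ, hτ.1, fun σ hσ => ?_⟩
  obtain ⟨l, h1, h2, h3⟩ := exists_mem_toricOpen_le hσ hτ.1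
  exact (hτ.2 h3 h2).trans h1

variable (x) in
/-- The cone whose torus orbit contains `x`: the least cone `τ` with `x ∈ U_τ`. -/
noncomputable def coneOf : Δ.Cone := (exists_least_cone x).choose

lemma mem_toricOpen_iff {σ : Δ.Cone} : x ∈ toricOpen k Δ σ ↔ coneOf x ≤ σ :=
  ⟨(exists_least_cone x).choose_spec.2 σ,
    fun h => toricOpen_mono h (exists_least_cone x).choose_spec.1⟩

lemma mem_toricOpen_coneOf : x ∈ toricOpen k Δ (coneOf x) := mem_toricOpen_iff.2 le_rfl

/-- The characters which are invertible at `x` are those which are constant on the cone of `x`. -/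
lemma isUnit_chartGerm_character_iff {σ : Δ.Cone} (hσ : x ∈ toricOpen k Δ σ) (s : Δ.S σ) :
    IsUnit ((chartGerm hσ).hom (character k Δ σ s)) ↔ -(s : M) ∈ Δ.S (coneOf x) := by
  constructor
  · intro h
    obtain ⟨τ, -, hτ⟩ := exists_cone_cutsOut σ s
    have h1 := (mem_toricOpen_iff_of_cutsOut hτ hσ).2 h
    exact dualMonoid_anti (mem_toricOpen_iff.1 h1) hτ.neg_mem
  · intro h
    rw [← chartGerm_character_incl (mem_toricOpen_iff.1 hσ) mem_toricOpen_coneOf hσ]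
    refine IsUnit.of_mul_eq_one ((chartGerm mem_toricOpen_coneOf).hom
      (character k Δ (coneOf x) ⟨_, h⟩)) ?_
    rw [← map_mul, ← character_add]
    refine Eq.trans ?_ (map_one (chartGerm (mem_toricOpen_coneOf (x := x))).hom)
    refine congrArg _ (Eq.trans (congrArg _ (Subtype.ext ?_)) character_zero)
    exact add_neg_cancel (s : M)

/-- The character `χ^s`, as a section over `U_σ` of the logarithmic structure. -/
noncomputable def charLogSection (σ : Δ.Cone) (s : Δ.S σ) :
    logSections (toricVariety k Δ) (bigTorus k Δ) (toricOpen k Δ σ) :=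
  ⟨(chartSections (toricChart k Δ σ)).hom (character k Δ σ s),
    mem_logSections_of_forall_isUnit fun y hy hy₀ => by
      refine (isUnit_chartGerm_character_iff hy s).2 fun u hu => ?_
      have h1 : u ∈ (⊥ : PointedCone ℝ (M →+ ℝ)) := (mem_toricOpen_iff (σ := Δ.zero)).1 hy₀ hu
      rw [(Submodule.mem_bot _).1 h1]
      exact le_rfl⟩

/-- The homomorphism from `S_σ` to the stalk of the logarithmic structure at a point of `U_σ`. -/
noncomputable def charLogGerm {σ : Δ.Cone} (hσ : x ∈ toricOpen k Δ σ) :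
    Multiplicative (Δ.S σ) →* logStalk (toricVariety k Δ) (bigTorus k Δ) x where
  toFun s := logGerm (charLogSection σ s.toAdd) x hσ
  map_one' := Subtype.ext ((congrArg (chartGerm hσ).hom character_zero).trans (map_one _))
  map_mul' a b := Subtype.ext
    ((congrArg (chartGerm hσ).hom (character_add a.toAdd b.toAdd)).trans (map_mul _ _ _))

lemma coe_charLogGerm {σ : Δ.Cone} (hσ : x ∈ toricOpen k Δ σ) (s : Δ.S σ) :
    (charLogGerm hσ (Multiplicative.ofAdd s) : (toricVariety k Δ).presheaf.stalk x) =
      (chartGerm hσ).hom (character k Δ σ s) := rfl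

lemma charLogGerm_incl {τ σ : Δ.Cone} (h : τ ≤ σ) (hτ : x ∈ toricOpen k Δ τ)
    (hσ : x ∈ toricOpen k Δ σ) (s : Δ.S σ) :
    charLogGerm hτ (Multiplicative.ofAdd (Δ.incl h s)) = charLogGerm hσ (Multiplicative.ofAdd s) :=
  Subtype.ext (chartGerm_character_incl h hτ hσ s)

lemma isUnit_logStalk_iff {X : Scheme.{u}} {X₀ : X.Opens} {x : X} (a : logStalk X X₀ x) :
    IsUnit a ↔ IsUnit (a : X.presheaf.stalk x) := by
  constructor
  · exact fun h => h.map (logStalk X X₀ x).subtype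
  · rintro ⟨u, hu⟩
    refine IsUnit.of_mul_eq_one ⟨_, mem_logStalk_of_isUnit (u⁻¹).isUnit⟩ (Subtype.ext ?_)
    change (a : X.presheaf.stalk x) * _ = 1
    rw [← hu, Units.mul_inv]

lemma associated_logStalk_iff {X : Scheme.{u}} {X₀ : X.Opens} {x : X} {a b : logStalk X X₀ x} :
    Associated a b ↔ ∃ u : X.presheaf.stalk x, IsUnit u ∧ (a : X.presheaf.stalk x) * u = b := by
  constructor
  · rintro ⟨u, hu⟩
    exact ⟨_, (isUnit_logStalk_iff _).1 u.isUnit, congrArg Subtype.val hu⟩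
  · rintro ⟨u, hu, h⟩
    exact ⟨((isUnit_logStalk_iff ⟨u, mem_logStalk_of_isUnit hu⟩).2 hu).unit, Subtype.ext h⟩

/-- The homomorphism `S_σ / S_σ^* → M_x / M_x^*` for `x ∈ U_σ`. -/
noncomputable def charClass {σ : Δ.Cone} (hσ : x ∈ toricOpen k Δ σ) :
    Associates (Multiplicative (Δ.S σ)) →*
      Associates (logStalk (toricVariety k Δ) (bigTorus k Δ) x) :=
  descHom Associates.mkMonoidHom Associates.mk_surjective
    (Associates.mkMonoidHom.comp (charLogGerm hσ)) fun a b h => by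
      obtain ⟨u, hu⟩ := Associates.mk_eq_mk_iff_associated.1 h
      refine Associates.mk_eq_mk_iff_associated.2 ⟨u.map (charLogGerm hσ), ?_⟩
      rw [← hu, map_mul]
      rfl

lemma charClass_cls {σ : Δ.Cone} (hσ : x ∈ toricOpen k Δ σ) (s : Δ.S σ) :
    charClass hσ (cls σ s) = Associates.mk (charLogGerm hσ (Multiplicative.ofAdd s)) :=
  descHom_apply Associates.mkMonoidHom Associates.mk_surjective _ _ (Multiplicative.ofAdd s)

end ToricPoints

end TropLog

/-! ### The characteristic morphism of a toric variety -/

namespace TropLog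

section CharacteristicMorphism

variable {k : Type u} [Field k] {M : Type u} [AddCommGroup M] {Δ : Fan M}
  {x : toricVariety k Δ} {σ : Δ.Cone}

/-- The prime ideal of a point of `U_σ`. -/
noncomputable def chartIdeal (hσ : x ∈ toricOpen k Δ σ) : Ideal (coordRing k Δ σ) :=
  (IsLocalRing.maximalIdeal ((toricVariety k Δ).presheaf.stalk x)).comap (chartGerm hσ).hom

lemma notMem_chartIdeal {hσ : x ∈ toricOpen k Δ σ} {a : coordRing k Δ σ} :
    a ∉ chartIdeal hσ ↔ IsUnit ((chartGerm hσ).hom a) := by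
  rw [chartIdeal, Ideal.mem_comap, IsLocalRing.mem_maximalIdeal, mem_nonunits_iff, not_not]

instance (hσ : x ∈ toricOpen k Δ σ) : (chartIdeal hσ).IsPrime := Ideal.comap_isPrime _ _

lemma character_mem_chartIdeal {hσ : x ∈ toricOpen k Δ σ} (s : Δ.S σ) :
    character k Δ σ s ∈ chartIdeal hσ ↔ -(s : M) ∉ Δ.S (coneOf x) := by
  rw [← not_iff_not, not_not, notMem_chartIdeal, isUnit_chartGerm_character_iff]

/-- A germ which is invertible on the torus divides a character, up to units: every prime ideal
which does not meet the characters corresponds to a point of the torus. -/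
lemma exists_mul_eq_character_mul (hσ : x ∈ toricOpen k Δ σ)
    {a : (toricVariety k Δ).presheaf.stalk x}
    (ha : a ∈ logStalk (toricVariety k Δ) (bigTorus k Δ) x)
    {α β : coordRing k Δ σ} (hβ : IsUnit ((chartGerm hσ).hom β))
    (h : a * (chartGerm hσ).hom β = (chartGerm hσ).hom α) :
    ∃ (γ h : coordRing k Δ σ) (t : Δ.S σ), h ∉ chartIdeal hσ ∧ α * γ = character k Δ σ t * h := by
  obtain ⟨U, hx, f, hf, rfl⟩ := ha
  obtain ⟨m, hm⟩ := exists_cutsOut_zero σ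
  by_contra! H
  -- a prime `q` which contains `α` but no multiple `χ^{n m} c` with `c` invertible at `x`
  obtain ⟨q, hq, hαq, hd⟩ := Ideal.exists_le_prime_disjoint (Ideal.span {α})
    (Submonoid.powers (character k Δ σ m) ⊔ (chartIdeal hσ).primeCompl) (by
      rw [Set.disjoint_left]
      intro b hb hb'
      obtain ⟨γ, rfl⟩ := Ideal.mem_span_singleton.1 hb
      obtain ⟨_, ⟨n, rfl⟩, c, hc, hcb⟩ := Submonoid.mem_sup.1 hb'
      refine H γ c (n • m) hc ?_
      rw [character_nsmul]
      exact hcb.symm)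
  -- the point of `q` is a point of the torus which specializes to `x`, so `a` is a unit there
  let y : Spec (CommRingCat.of (coordRing k Δ σ)) := ⟨q, hq⟩
  obtain ⟨z, hz⟩ := id hσ
  have hyσ : toricChart k Δ σ y ∈ toricOpen k Δ σ := ⟨y, rfl⟩
  have hnot : ∀ b : coordRing k Δ σ, IsUnit ((chartGerm hσ).hom b) → b ∉ q := fun b hb hbq =>
    Set.disjoint_left.1 hd hbq (SetLike.le_def.1 le_sup_right
      (show b ∈ (chartIdeal hσ).primeCompl from notMem_chartIdeal.2 hb))
  have hyx : toricChart k Δ σ y ⤳ x := by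
    rw [← hz]
    refine Specializes.map ?_ (toricChart k Δ σ).continuous
    refine (PrimeSpectrum.le_iff_specializes y z).1 fun b hb => ?_
    by_contra hbz
    exact hnot b ((isUnit_chartGerm_iff hσ hz b).2 hbz) hb
  have hyu : ∀ b : coordRing k Δ σ, IsUnit ((chartGerm hyσ).hom b) ↔ b ∉ q :=
    isUnit_chartGerm_iff hyσ (y := y) rfl
  have hy₀ : toricChart k Δ σ y ∈ bigTorus k Δ := by
    refine (mem_toricOpen_iff_of_cutsOut hm hyσ).2 ((hyu _).2 fun hmq => ?_)
    exact Set.disjoint_left.1 hd hmq (SetLike.le_def.1 le_sup_left (Submonoid.mem_powers _))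
  have hspec : ∀ b : coordRing k Δ σ, (toricVariety k Δ).presheaf.stalkSpecializes hyx
      ((chartGerm hσ).hom b) = (chartGerm hyσ).hom b := fun b =>
    (toricVariety k Δ).presheaf.germ_stalkSpecializes_apply hσ hyx _
  have h1 := congrArg ((toricVariety k Δ).presheaf.stalkSpecializes hyx).hom h
  rw [map_mul] at h1
  erw [hspec, hspec, (toricVariety k Δ).presheaf.germ_stalkSpecializes_apply hx hyx f] at h1
  refine (hyu α).1 ?_ (hαq (Ideal.mem_span_singleton_self α))
  rw [← h1]
  exact (isUnit_germ_of_mem_logSections hf (hyx.mem_open U.2 hx) hy₀).mul ((hyu β).2 (hnot β hβ))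

/-- The stalk of the characteristic sheaf at a point of the orbit of `σ` is `S_σ / S_σ^*`. -/
lemma charClass_bijective [Module.Free ℤ M] (hσ : x ∈ toricOpen k Δ σ) (h : coneOf x = σ) :
    Function.Bijective (charClass hσ) := by
  have hp : ∀ s : Δ.S σ, character k Δ σ s ∈ chartIdeal hσ ↔ -(s : M) ∉ Δ.S σ := fun s => by
    rw [character_mem_chartIdeal, h]
  constructor
  · intro c d hcd
    obtain ⟨s, rfl⟩ := cls_surjective σ c
    obtain ⟨t, rfl⟩ := cls_surjective σ d
    rw [charClass_cls, charClass_cls, Associates.mk_eq_mk_iff_associated,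
      associated_logStalk_iff] at hcd
    obtain ⟨u, hu, hst⟩ := hcd
    obtain ⟨α, β, hβ, hαβ⟩ := exists_mul_chartGerm_eq hσ u
    have hα : IsUnit ((chartGerm hσ).hom α) := hαβ ▸ hu.mul hβ
    rw [coe_charLogGerm, coe_charLogGerm] at hst
    have h1 : (chartGerm hσ).hom (character k Δ σ s * α) =
        (chartGerm hσ).hom (character k Δ σ t * β) := by
      rw [map_mul, map_mul, ← hαβ, ← hst, mul_assoc]
    obtain ⟨c, hc, h2⟩ := exists_mul_eq_of_chartGerm_eq hσ h1
    have h3 : character k Δ σ s * (c * α) = character k Δ σ t * (c * β) := by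
      rw [mul_left_comm, h2, mul_left_comm]
    have hn : ∀ b : coordRing k Δ σ, IsUnit ((chartGerm hσ).hom b) → c * b ∉ chartIdeal hσ :=
      fun b hb => notMem_chartIdeal.2 (by rw [map_mul]; exact hc.mul hb)
    exact cls_eq_iff.2 fun v hv => le_antisymm (le_of_character_mul_eq hp (hn β hβ) h3.symm hv)
      (le_of_character_mul_eq hp (hn α hα) h3 hv)
  · intro c
    obtain ⟨a, rfl⟩ := Associates.mk_surjective c
    obtain ⟨α, β, hβ, hαβ⟩ := exists_mul_chartGerm_eq hσ a.1
    obtain ⟨γ, h, t, hh, hγ⟩ := exists_mul_eq_character_mul hσ a.2 hβ hαβ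
    obtain ⟨s, g, rfl, hg⟩ := exists_eq_character_mul_of_mul_eq hp hh hγ
    refine ⟨cls σ s, ?_⟩
    rw [charClass_cls, Associates.mk_eq_mk_iff_associated]
    symm
    have hgu := notMem_chartIdeal.1 hg
    refine associated_logStalk_iff.2 ⟨(chartGerm hσ).hom β * (hgu.unit⁻¹ : Units _),
      hβ.mul (Units.isUnit _), ?_⟩
    rw [← mul_assoc, hαβ, coe_charLogGerm, map_mul, mul_assoc, IsUnit.mul_val_inv, mul_one]

lemma charClass_clsIncl {τ σ : Δ.Cone} (h : τ ≤ σ) (hτ : x ∈ toricOpen k Δ τ)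
    (hσ : x ∈ toricOpen k Δ σ) (s : Δ.S σ) :
    charClass hτ (cls τ (Δ.incl h s)) = Associates.mk (logGerm (charLogSection σ s) x hσ) := by
  rw [charClass_cls, charLogGerm_incl h hτ hσ]
  rfl

variable (k Δ) in
/-- The morphism from the toric variety to the Kato fan of `Δ`, which sends the torus orbit of
`σ` to `σ`. -/
noncomputable def toricCharMorphism [Module.Free ℤ M] :
    MonoidalSpace.Hom (charSpace (toricVariety k Δ) (bigTorus k Δ)) (fanSpace Δ) where
  base := coneOf (k := k) (Δ := Δ)
  continuous_base := by
    refine continuous_def.2 fun s hs => isOpen_iff_forall_mem_open.2 fun x hx => ?_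
    refine ⟨(toricOpen k Δ (coneOf (k := k) (Δ := Δ) x)).1, fun y hy => ?_, (toricOpen k Δ _).2,
      mem_toricOpen_coneOf⟩
    exact isOpen_fanSpace_iff.1 hs (mem_toricOpen_iff.1 hy) hx
  stalkMap x := charClass (x := x) mem_toricOpen_coneOf
  isLocal x a h := isUnit_of_map_bijective _ (charClass_bijective mem_toricOpen_coneOf rfl) a h
  isSection_comp V t ht x := by
    let x' : toricVariety k Δ := x.1
    obtain ⟨s, hs⟩ := exists_forall_eq_cls (le_refl (coneOf x')) ht x.2
    refine ⟨toricOpen k Δ (coneOf x'), fun y hy => ?_, charLogSection (coneOf x') s,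
      mem_toricOpen_coneOf, fun y => ?_⟩
    · exact isOpen_fanSpace_iff.1 V.2 (mem_toricOpen_iff.1 hy) x.2
    · have hle := mem_toricOpen_iff.1 y.2
      refine (congrArg (charClass mem_toricOpen_coneOf) (hs _ hle _)).trans ?_
      exact charClass_clsIncl hle mem_toricOpen_coneOf y.2 s

lemma isStrict_toricCharMorphism [Module.Free ℤ M] : (toricCharMorphism k Δ).IsStrict :=
  fun _ => charClass_bijective mem_toricOpen_coneOf rfl

variable (k) in
/-- The generic point of the torus orbit of `σ`. -/
noncomputable def orbitPoint [Module.Free ℤ M] (σ : Δ.Cone) : toricVariety k Δ :=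
  toricChart k Δ σ (orbitIdeal k σ)

lemma orbitPoint_mem [Module.Free ℤ M] : orbitPoint k σ ∈ toricOpen k Δ σ := ⟨_, rfl⟩

lemma coneOf_orbitPoint [Module.Free ℤ M] (σ : Δ.Cone) : coneOf (orbitPoint k σ) = σ := by
  have h := mem_toricOpen_iff.1 (orbitPoint_mem (k := k) (σ := σ))
  refine le_antisymm h (face_le_of_forall h le_rfl fun s hs => ?_)
  rw [← isUnit_chartGerm_character_iff orbitPoint_mem] at hs
  have h1 := (isUnit_chartGerm_iff (j := toricChart k Δ σ) orbitPoint_mem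
    (y := orbitIdeal k σ) rfl _).1 hs
  by_contra h2
  exact h1 (character_mem_orbitIdeal.2 h2)

lemma orbitPoint_specializes [Module.Free ℤ M] (x : toricVariety k Δ) :
    orbitPoint k (coneOf x) ⤳ x := by
  obtain ⟨y, hy⟩ := mem_toricOpen_coneOf (x := x)
  have : toricChart k Δ (coneOf x) (orbitIdeal k (coneOf x)) ⤳ toricChart k Δ (coneOf x) y := by
    refine Specializes.map ?_ (toricChart k Δ _).continuous
    refine (PrimeSpectrum.le_iff_specializes (orbitIdeal k (coneOf x)) y).1 ?_
    refine orbitIdeal_le fun s hs => ?_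
    by_contra h
    exact hs ((isUnit_chartGerm_character_iff mem_toricOpen_coneOf s).1
      ((isUnit_chartGerm_iff mem_toricOpen_coneOf hy _).2 h))
  rwa [hy] at this

lemma orbitPoint_specializes_of_le [Module.Free ℤ M] {τ σ : Δ.Cone} (h : τ ≤ σ) :
    orbitPoint k τ ⤳ orbitPoint k σ := by
  have h1 : orbitPoint k τ = toricChart k Δ σ
      ((toricDiagram k Δ).map (homOfLE h) (orbitIdeal k τ)) :=
    (congrArg (fun f : _ ⟶ toricVariety k Δ => f (orbitIdeal k τ))
      (toricDiagram_map_toricChart h)).symm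
  rw [h1]
  refine Specializes.map ?_ (toricChart k Δ σ).continuous
  exact (PrimeSpectrum.le_iff_specializes
    (PrimeSpectrum.comap (coordMap k Δ h).toRingHom (orbitIdeal k τ)) (orbitIdeal k σ)).1
      (comap_orbitIdeal_le h)

/-- The isomorphism `S_σ / S_σ^* ≃ M_x / M_x^*` at the generic point `x` of the orbit of `σ`. -/
noncomputable def orbitEquiv [Module.Free ℤ M] (σ : Δ.Cone) : Associates (Multiplicative (Δ.S σ)) ≃*
    Associates (logStalk (toricVariety k Δ) (bigTorus k Δ) (orbitPoint k σ)) :=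
  MulEquiv.ofBijective (charClass orbitPoint_mem)
    (charClass_bijective orbitPoint_mem (coneOf_orbitPoint σ))

variable (k Δ) in
/-- The section of the characteristic morphism given by the generic points of the orbits. -/
noncomputable def toricCharSection [Module.Free ℤ M] :
    MonoidalSpace.Hom (fanSpace Δ) (charSpace (toricVariety k Δ) (bigTorus k Δ)) where
  base := orbitPoint k (Δ := Δ)
  continuous_base := continuous_def.2 fun _ hs => isOpen_fanSpace_iff.2 fun _ _ h hσ =>
    (orbitPoint_specializes_of_le h).mem_open hs hσ
  stalkMap σ := (orbitEquiv (k := k) (Δ := Δ) σ).symm.toMonoidHom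
  isLocal σ a h := isUnit_of_map_bijective (orbitEquiv (k := k) (Δ := Δ) σ).symm.toMonoidHom
    (orbitEquiv (k := k) (Δ := Δ) σ).symm.bijective a h
  isSection_comp V t ht σ := by
    let σ' : Δ.Cone := σ.1
    obtain ⟨W, hW, f, hσW, hf⟩ := ht ⟨orbitPoint k σ', σ.2⟩
    obtain ⟨c, hc⟩ := (orbitEquiv (k := k) σ').surjective
      (Associates.mk (logGerm f (orbitPoint k σ') hσW))
    obtain ⟨s, rfl⟩ := cls_surjective σ' c
    have h1 := Associates.mk_eq_mk_iff_associated.1 ((charClass_cls orbitPoint_mem s).symm.trans hc)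
    obtain ⟨W', w1, w2, hσW', hass⟩ := associated_nearby (charLogSection σ' s) f
      (orbitPoint k σ') orbitPoint_mem hσW h1
    refine ⟨s, fun τ hτ hτV => ?_⟩
    have hτW : orbitPoint k τ ∈ W' := (orbitPoint_specializes_of_le hτ).mem_open W'.2 hσW'
    refine (MulEquiv.symm_apply_eq (orbitEquiv (k := k) τ)).2 ?_
    refine (hf ⟨orbitPoint k τ, w2 hτW⟩).trans ?_
    refine Eq.trans ?_ (charClass_clsIncl hτ orbitPoint_mem (w1 hτW) s).symm
    exact Associates.mk_eq_mk_iff_associated.2 (hass _ hτW).symm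

/-- The Kato fan of a toric variety is the fan: the generic points of the orbits form a strict
section of `toricCharMorphism`. -/
theorem isCharacteristicMorphism_toricCharMorphism [Module.Free ℤ M] [Module.Finite ℤ M] :
    IsCharacteristicMorphism (toricCharMorphism k Δ) := by
  refine ⟨isFineSaturatedKatoFan_fanSpace, isStrict_toricCharMorphism, fun G ψ hG hψ => ?_⟩
  refine existsUnique_strict_of_section _ (toricCharSection k Δ) isStrict_toricCharMorphism
    (fun σ => (orbitEquiv (k := k) (Δ := Δ) σ).symm.bijective) coneOf_orbitPoint
    (fun σ V t ht h1 h2 => ?_) orbitPoint_specializes hG.1 ψ hψ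
  obtain ⟨s, hs⟩ := exists_forall_eq_cls (le_refl (α := Δ.Cone) σ) ht h2
  refine (MulEquiv.symm_apply_eq (orbitEquiv (k := k) σ)).2 ?_
  have hle : coneOf (orbitPoint k (σ : Δ.Cone)) ≤ σ := le_of_eq (coneOf_orbitPoint σ)
  refine (congrArg (charClass mem_toricOpen_coneOf) (hs _ hle h1)).trans ?_
  refine (charClass_clsIncl hle mem_toricOpen_coneOf orbitPoint_mem s).trans ?_
  refine (charClass_clsIncl le_rfl orbitPoint_mem orbitPoint_mem s).symm.trans ?_
  exact congrArg (charClass orbitPoint_mem) (hs σ le_rfl h2).symm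

end CharacteristicMorphism

end TropLog

/-! ### Tropicalization of the points of `X^ℶ` -/

namespace TropLog

section NegLog

lemma negLogUnit_one : negLogUnit 1 = 0 := by
  simp [negLogUnit]

lemma negLogUnit_mul {a b : ℝ≥0} (ha : a ≤ 1) (hb : b ≤ 1) :
    negLogUnit (a * b) = negLogUnit a + negLogUnit b := by
  rcases eq_or_ne a 0 with rfl | ha'
  · rw [zero_mul, negLogUnit, if_pos rfl, top_add]
  rcases eq_or_ne b 0 with rfl | hb'
  · rw [mul_zero, negLogUnit, if_pos rfl, add_top]
  have hl : ∀ c : ℝ≥0, c ≤ 1 → 0 ≤ -Real.log c := fun c hc =>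
    neg_nonneg.2 (Real.log_nonpos c.2 (by exact_mod_cast hc))
  rw [negLogUnit, negLogUnit, negLogUnit, if_neg ha', if_neg hb', if_neg (mul_ne_zero ha' hb'),
    NNReal.coe_mul, Real.log_mul (by exact_mod_cast ha') (by exact_mod_cast hb'), neg_add,
    ENNReal.ofReal_add (hl a ha) (hl b hb)]

lemma negLogUnit_eq_zero {a : ℝ≥0} (ha : a ≤ 1) (h : negLogUnit a = 0) : a = 1 := by
  rcases eq_or_ne a 0 with rfl | ha'
  · simp [negLogUnit] at h
  rw [negLogUnit, if_neg ha', ENNReal.ofReal_eq_zero, neg_nonpos] at h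
  refine le_antisymm ha ?_
  by_contra! hlt
  have h0 : (0 : ℝ) < a := by exact_mod_cast pos_iff_ne_zero.2 ha'
  exact absurd (Real.log_neg h0 (by exact_mod_cast hlt)) (not_lt.2 h)

lemma ennrealToWithTop_negLogUnit {a : ℝ≥0} (ha : a ≤ 1) :
    ennrealToWithTop (negLogUnit a) = (negLog a).toAdd := by
  change _ = if a = 0 then ⊤ else ((-Real.log a : ℝ) : WithTop ℝ)
  rcases eq_or_ne a 0 with rfl | ha'
  · rw [negLogUnit, if_pos rfl, if_pos rfl, ennrealToWithTop_top]
  rw [negLogUnit, if_neg ha', if_neg ha', ENNReal.ofReal, ennrealToWithTop_coe,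
    Real.coe_toNNReal (-Real.log a)
      (neg_nonneg.2 (Real.log_nonpos a.2 (by exact_mod_cast ha)))]

lemma negLog_nonneg_iff {a : ℝ≥0} : 0 ≤ (negLog a).toAdd ↔ a ≤ 1 := by
  change 0 ≤ (if a = 0 then ⊤ else ((-Real.log a : ℝ) : WithTop ℝ)) ↔ _
  rcases eq_or_ne a 0 with rfl | ha'
  · simp
  have h0 : (0 : ℝ) < a := by exact_mod_cast pos_iff_ne_zero.2 ha'
  rw [if_neg ha', ← WithTop.coe_zero, WithTop.coe_le_coe, neg_nonneg,
    Real.log_nonpos_iff h0.le]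
  norm_cast

lemma negLog_eq_top_iff {a : ℝ≥0} : (negLog a).toAdd = ⊤ ↔ a = 0 := by
  change (if a = 0 then ⊤ else ((-Real.log a : ℝ) : WithTop ℝ)) = ⊤ ↔ _
  split_ifs with h
  · simp [h]
  · simp [h]

end NegLog

section AbsGerm

variable {k : Type u} [Field k] {X : Scheme.{u}} {f : X ⟶ Spec (CommRingCat.of k)} (x : Beth f)

/-- The homomorphism from the local ring at `r(x)` to the valuation ring of `x`. -/
noncomputable def Beth.germMap : X.presheaf.stalk x.red ⟶ CommRingCat.of x.toAn.integers :=
  Scheme.stalkClosedPointTo x.integral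

lemma Beth.map_germMap_comp : Spec.map x.germMap ≫ X.fromSpecStalk x.red = x.integral :=
  Scheme.Spec_stalkClosedPointTo_fromSpecStalk x.integral

/-- The inclusion of the valuation ring of `x`. -/
noncomputable def Beth.inclMap : CommRingCat.of x.toAn.integers ⟶ X.residueField x.toAn.point :=
  CommRingCat.ofHom x.toAn.integers.subtype

lemma Beth.map_inclMap_comp :
    Spec.map x.inclMap ≫ x.integral = X.fromSpecResidueField x.toAn.point := x.fac

lemma Beth.absGerm_le_one (a : X.presheaf.stalk x.red) : x.absGerm a ≤ 1 :=
  ((Scheme.stalkClosedPointTo x.integral).hom a : x.toAn.integers).2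

lemma Beth.absGerm_mul (a b : X.presheaf.stalk x.red) :
    x.absGerm (a * b) = x.absGerm a * x.absGerm b := by
  have h : (Scheme.stalkClosedPointTo x.integral).hom (a * b) =
      (Scheme.stalkClosedPointTo x.integral).hom a *
        (Scheme.stalkClosedPointTo x.integral).hom b := map_mul _ a b
  exact (congrArg (fun r : x.toAn.integers => x.toAn.val r) h).trans (map_mul x.toAn.val _ _)

lemma Beth.absGerm_one : x.absGerm 1 = 1 := by
  have h : (Scheme.stalkClosedPointTo x.integral).hom 1 = 1 := map_one _
  exact (congrArg (fun r : x.toAn.integers => x.toAn.val r) h).trans (map_one x.toAn.val)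

/-- The homomorphism `𝒪_{X, r(x)} → R` is local. -/
lemma Beth.absGerm_eq_one_iff {a : X.presheaf.stalk x.red} : x.absGerm a = 1 ↔ IsUnit a := by
  constructor
  · intro h
    have h1 : IsUnit ((Scheme.stalkClosedPointTo x.integral).hom a : x.toAn.integers) :=
      (Valuation.valuationSubring.integers x.toAn.val).isUnit_iff_valuation_eq_one.2 h
    exact (Scheme.isLocalHom_stalkClosedPointTo' x.integral).map_nonunit a h1
  · rintro ⟨u, rfl⟩
    have h1 : x.absGerm (u : X.presheaf.stalk x.red) * x.absGerm (u⁻¹ : Units _) = 1 := by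
      rw [← x.absGerm_mul, Units.mul_inv, x.absGerm_one]
    refine le_antisymm (x.absGerm_le_one _) (h1.symm.le.trans ?_)
    exact mul_le_of_le_one_right' (x.absGerm_le_one _)

end AbsGerm

section Tropicalization

variable {k : Type u} [Field k] {M : Type u} [AddCommGroup M] {Δ : Fan M}
  (x : Beth (toricStructure k Δ))

/-- The homomorphism `s ↦ -log |χ^s|_x` on `S_σ`, where `σ` is the cone of `r(x)`. -/
noncomputable def bethTrop : Δ.S (coneOf x.red) →+ ℝ≥0∞ where
  toFun s := negLogUnit (x.absGerm ((chartGerm mem_toricOpen_coneOf).hom (character k Δ _ s)))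
  map_zero' := by
    have h : (chartGerm (mem_toricOpen_coneOf (x := x.red))).hom
        (character k Δ (coneOf x.red) 0) = 1 :=
      (congrArg (chartGerm mem_toricOpen_coneOf).hom character_zero).trans (map_one _)
    exact (congrArg (fun a => negLogUnit (x.absGerm a)) h).trans
      ((congrArg negLogUnit x.absGerm_one).trans negLogUnit_one)
  map_add' s t := by
    have h := (congrArg (chartGerm (mem_toricOpen_coneOf (x := x.red))).hom
      (character_add (k := k) s t)).trans (map_mul _ _ _)
    refine (congrArg (fun a => negLogUnit (x.absGerm a)) h).trans ?_
    exact (congrArg negLogUnit (x.absGerm_mul _ _)).trans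
      (negLogUnit_mul (x.absGerm_le_one _) (x.absGerm_le_one _))

/-- The homomorphism is local, since `𝒪_{X, r(x)} → R` is local and the characters which are
invertible at `r(x)` are the units of `S_σ`. -/
lemma isLocalTrop_bethTrop : IsLocalTrop (bethTrop x) := fun s hs =>
  (isUnit_chartGerm_character_iff mem_toricOpen_coneOf s).1
    (x.absGerm_eq_one_iff.1 (negLogUnit_eq_zero (x.absGerm_le_one _) hs))

/-- A tropicalization of `x` is a point of the extended cone complex represented by `bethTrop x`. -/
lemma isTropicalization_iff [Module.Free ℤ M] (u : ExtendedConeComplex (fanSpace Δ)) :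
    IsTropicalization (toricCharMorphism k Δ) x u ↔ Represents u (coneOf x.red) (bethTrop x) := by
  constructor
  · rintro ⟨h, H⟩
    refine ⟨h, fun s => ?_⟩
    have h1 : coneOf x.red ∈ faces Δ (coneOf x.red) :=
      le_refl (α := Δ.Cone) (coneOf x.red)
    have h2 : conePt u closedPt ∈ faces Δ (coneOf x.red) :=
      le_of_eq (α := Δ.Cone) h
    exact H (faces Δ (coneOf x.red)) (clsSection _ s) (isSection_clsSection _ s) h1 h2
      (charLogGerm mem_toricOpen_coneOf (Multiplicative.ofAdd s))
      (charClass_cls mem_toricOpen_coneOf s)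
  · rintro ⟨h, H⟩
    refine ⟨h, fun V t ht h1 h2 m hm => ?_⟩
    obtain ⟨s, hs⟩ := exists_forall_eq_cls (le_refl (α := Δ.Cone) (coneOf x.red)) ht h1
    have h3 : Associates.mk (charLogGerm mem_toricOpen_coneOf (Multiplicative.ofAdd s)) =
        Associates.mk m := (charClass_cls mem_toricOpen_coneOf s).symm.trans
      ((congrArg (charClass mem_toricOpen_coneOf) (hs (coneOf x.red) le_rfl h1)).symm.trans hm)
    obtain ⟨a, ha, ham⟩ := associated_logStalk_iff.1 (Associates.mk_eq_mk_iff_associated.1 h3)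
    have h4 : x.absGerm m.1 =
        x.absGerm ((chartGerm mem_toricOpen_coneOf).hom (character k Δ _ s)) := by
      rw [← ham, x.absGerm_mul, x.absGerm_eq_one_iff.2 ha, mul_one]
      rfl
    refine (congrArg (coneMap u closedPt) (hs (conePt u closedPt) (le_of_eq h) h2)).trans
      ((H s).trans ?_)
    rw [h4]
    rfl

lemma existsUnique_isTropicalization [Module.Free ℤ M] :
    ∃! u, IsTropicalization (toricCharMorphism k Δ) x u := by
  obtain ⟨u, hu⟩ := exists_represents (isLocalTrop_bethTrop x)
  exact ⟨u, (isTropicalization_iff x u).2 hu, fun v hv =>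
    ((isTropicalization_iff x v).1 hv).unique hu⟩

lemma toNRDelta_eq_tropToric [Module.Free ℤ M] {u : ExtendedConeComplex (fanSpace Δ)}
    (hu : IsTropicalization (toricCharMorphism k Δ) x u) : toNRDelta u = tropToric k x.toAn := by
  rw [((isTropicalization_iff x u).1 hu).toNRDelta_eq]
  let g : CommRingCat.of (coordRing k Δ (coneOf x.red)) ⟶
      (toricVariety k Δ).residueField x.toAn.point :=
    chartGerm (mem_toricOpen_coneOf (x := x.red)) ≫ x.germMap ≫ x.inclMap
  have hg : Spec.map g ≫ toricChart k Δ (coneOf x.red) =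
      (toricVariety k Δ).fromSpecResidueField x.toAn.point := by
    rw [← x.map_inclMap_comp, Spec.map_comp, Spec.map_comp, Category.assoc, Category.assoc,
      map_chartGerm_comp, x.map_germMap_comp]
  rw [tropToric_eq k x.toAn _ g hg]
  congr 1
  ext s
  rw [tropHom_apply]
  exact ennrealToWithTop_negLogUnit (x.absGerm_le_one _)

end Tropicalization

/-! ### Transfer between characteristic morphisms -/

section Transfer

variable {k : Type u} [Field k] {X : Scheme.{u}} {X₀ : X.Opens} {f : X ⟶ Spec (CommRingCat.of k)}

/-- The identity of a monoidal space. -/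
noncomputable def MonoidalSpace.Hom.id (F : MonoidalSpace.{u}) : MonoidalSpace.Hom F F where
  base := _root_.id
  continuous_base := continuous_id
  stalkMap _ := MonoidHom.id _
  isLocal _ _ h := h
  isSection_comp _ _ hs := hs

/-- The map of extended cone complexes induced by a morphism. -/
noncomputable def ExtendedConeComplex.map {F G : MonoidalSpace.{u}} (h : MonoidalSpace.Hom F G)
    (u : ExtendedConeComplex F) : ExtendedConeComplex G := MonoidalSpace.Hom.comp u h

lemma IsTropicalization.map {F G : MonoidalSpace.{u}}
    {φ : MonoidalSpace.Hom (charSpace X X₀) F} (h : MonoidalSpace.Hom F G) {x : Beth f}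
    {u : ExtendedConeComplex F} (hu : IsTropicalization φ x u) :
    IsTropicalization (φ.comp h) x (u.map h) :=
  ⟨congrArg h.base hu.1, fun _ _ ht h1 h2 m hm => hu.2 _ _ (h.isSection_comp _ _ ht) h1 h2 m hm⟩

lemma IsCharacteristicMorphism.exists_inverse {F G : MonoidalSpace.{u}}
    {φ : MonoidalSpace.Hom (charSpace X X₀) F} {ψ : MonoidalSpace.Hom (charSpace X X₀) G}
    (hφ : IsCharacteristicMorphism φ) (hψ : IsCharacteristicMorphism ψ) :
    ∃ (h : MonoidalSpace.Hom F G) (h' : MonoidalSpace.Hom G F), φ.comp h = ψ ∧ ψ.comp h' = φ ∧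
      h.comp h' = MonoidalSpace.Hom.id F ∧ h'.comp h = MonoidalSpace.Hom.id G := by
  obtain ⟨h, ⟨hs, hc⟩, -⟩ := hφ.2.2 G ψ hψ.1 hψ.2.1
  obtain ⟨h', ⟨hs', hc'⟩, -⟩ := hψ.2.2 F φ hφ.1 hφ.2.1
  refine ⟨h, h', hc, hc', ?_, ?_⟩
  · refine (hφ.2.2 F φ hφ.1 hφ.2.1).unique ⟨hs.comp hs', ?_⟩ ⟨fun _ => Function.bijective_id, rfl⟩
    exact (congrArg (fun ψ => MonoidalSpace.Hom.comp ψ h') hc).trans hc'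
  · refine (hψ.2.2 G ψ hψ.1 hψ.2.1).unique ⟨hs'.comp hs, ?_⟩ ⟨fun _ => Function.bijective_id, rfl⟩
    exact (congrArg (fun ψ => MonoidalSpace.Hom.comp ψ h) hc').trans hc

end Transfer

/-! ### Lifting points to the integral model -/

/-- A morphism from `Spec R` factors through a closed subscheme if its restriction to a dominant
`Spec K ⟶ Spec R` does. -/
lemma exists_lift_of_isClosedImmersion {X Y : Scheme.{u}} (i : Y ⟶ X) [IsClosedImmersion i]
    {R K : CommRingCat.{u}} (j : R ⟶ K) (hj : Function.Injective j.hom) (f : Spec R ⟶ X)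
    (h : Spec K ⟶ Y) (w : Spec.map j ≫ f = h ≫ i) : ∃ g : Spec R ⟶ Y, g ≫ i = f := by
  let g := Limits.pullback.fst f i
  let l : Spec K ⟶ Limits.pullback f i := Limits.pullback.lift (Spec.map j) h w
  have hl : l ≫ g = Spec.map j := Limits.pullback.lift_fst _ _ _
  have h1 : Function.Injective (Spec.map j).appTop := by
    have h2 : Function.Injective ((Spec.map j).appTop ≫ (Scheme.ΓSpecIso K).hom) := by
      rw [Scheme.ΓSpecIso_naturality]
      exact hj.comp (ConcreteCategory.bijective_of_isIso (Scheme.ΓSpecIso R).hom).1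
    exact Function.Injective.of_comp (f := (Scheme.ΓSpecIso K).hom) h2
  rw [← hl, Scheme.Hom.comp_appTop] at h1
  have : IsIso g := IsClosedImmersion.isIso_of_injective_of_isAffine
    (Function.Injective.of_comp (f := l.appTop) h1)
  refine ⟨inv g ≫ Limits.pullback.snd f i, ?_⟩
  rw [Category.assoc, ← Limits.pullback.condition, IsIso.inv_hom_id_assoc]

section Integral

lemma Analytification.residueScalars_mem_integers {k : Type u} [Field k] {X : Scheme.{u}}
    {f : X ⟶ Spec (CommRingCat.of k)} (x : Analytification f) (c : k) :
    residueScalars f x.point c ∈ x.integers := by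
  rw [Valuation.mem_valuationSubring_iff]
  rcases eq_or_ne c 0 with rfl | hc
  · rw [map_zero, map_zero]
    exact zero_le_one
  · rw [x.val_scalars c hc]

variable {k : Type u} [Field k] {M : Type u} [AddCommGroup M] {Δ : Fan M}

/-- The homomorphism `k[S_σ] → κ(x)` for `x ∈ U_σ`. -/
noncomputable def chartEval {x : toricVariety k Δ} {σ : Δ.Cone} (hσ : x ∈ toricOpen k Δ σ) :
    CommRingCat.of (coordRing k Δ σ) ⟶ (toricVariety k Δ).residueField x :=
  chartGerm hσ ≫ (toricVariety k Δ).residue x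

lemma map_chartEval_comp {x : toricVariety k Δ} {σ : Δ.Cone} (hσ : x ∈ toricOpen k Δ σ) :
    Spec.map (chartEval hσ) ≫ toricChart k Δ σ = (toricVariety k Δ).fromSpecResidueField x := by
  rw [chartEval, Spec.map_comp, Category.assoc, map_chartGerm_comp]
  rfl

lemma chartEval_ne_zero_iff {x : toricVariety k Δ} {σ : Δ.Cone} (hσ : x ∈ toricOpen k Δ σ)
    (a : coordRing k Δ σ) : (chartEval hσ).hom a ≠ 0 ↔ IsUnit ((chartGerm hσ).hom a) :=
  IsLocalRing.residue_ne_zero_iff_isUnit _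

lemma chartEval_character_incl {x : toricVariety k Δ} {τ σ : Δ.Cone} (h : τ ≤ σ)
    (hτ : x ∈ toricOpen k Δ τ) (hσ : x ∈ toricOpen k Δ σ) (s : Δ.S σ) :
    (chartEval hτ).hom (character k Δ τ (Δ.incl h s)) = (chartEval hσ).hom (character k Δ σ s) :=
  congrArg ((toricVariety k Δ).residue x).hom (chartGerm_character_incl h hτ hσ s)

lemma toricChart_toricStructure (σ : Δ.Cone) : toricChart k Δ σ ≫ toricStructure k Δ =
    Spec.map (CommRingCat.ofHom (algebraMap k (coordRing k Δ σ))) :=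
  Limits.colimit.ι_desc _ _

lemma chartEval_algebraMap {x : toricVariety k Δ} {σ : Δ.Cone} (hσ : x ∈ toricOpen k Δ σ) (c : k) :
    (chartEval hσ).hom (algebraMap k (coordRing k Δ σ) c) =
      residueScalars (toricStructure k Δ) x c := by
  have h : CommRingCat.ofHom (algebraMap k (coordRing k Δ σ)) ≫ chartEval hσ =
      Spec.preimage ((toricVariety k Δ).fromSpecResidueField x ≫ toricStructure k Δ) := by
    refine Spec.map_injective ?_
    rw [Spec.map_preimage, Spec.map_comp, ← toricChart_toricStructure, ← map_chartEval_comp hσ,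
      Category.assoc]
  exact congrArg (fun g : CommRingCat.of k ⟶ _ => g.hom c) h

lemma tropToric_eq_chartEval (x : Analytification (toricStructure k Δ)) {σ : Δ.Cone}
    (hσ : x.point ∈ toricOpen k Δ σ) :
    tropToric k x = NRDelta.mk Δ σ (tropHom k x.val (chartEval hσ).hom) :=
  tropToric_eq k x σ _ (map_chartEval_comp hσ)

/-- The tropicalization of `x` belongs to the closure of the fan if and only if `x` belongs to
`U_σ^ℶ` for some `σ`. -/
lemma tropToric_mem_closureFan_iff [Module.Finite ℤ M] (x : Analytification (toricStructure k Δ)) :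
    tropToric k x ∈ closureFan Δ ↔ ∃ (σ : Δ.Cone) (hσ : x.point ∈ toricOpen k Δ σ),
      ∀ s : Δ.S σ, x.val ((chartEval hσ).hom (character k Δ σ s)) ≤ 1 := by
  rw [mem_closureFan_iff]
  constructor
  · rintro ⟨σ, v, hv, h⟩
    rw [tropToric_eq_chartEval x mem_toricOpen_coneOf] at h
    obtain ⟨l, h1, h2, w, e1, e2⟩ := NRDelta.mk_eq_mk_iff.1 h
    have hl : x.point ∈ toricOpen k Δ l := by
      obtain ⟨m, hm⟩ := exists_cutsOut h1
      refine (mem_toricOpen_iff_of_cutsOut hm mem_toricOpen_coneOf).2 ?_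
      rw [← chartEval_ne_zero_iff]
      intro h0
      have h3 := DFunLike.congr_fun e1 m
      rw [tropHom_apply, h0, map_zero, negLog_eq_top_iff.2 rfl] at h3
      exact ne_top_of_neg_mem w (s := Δ.incl h1 m) hm.neg_mem h3
    have hw : w = tropHom k x.val (chartEval hl).hom := by
      refine incl_comp_injective h1 (e1.trans ?_)
      ext s
      rw [AddMonoidHom.comp_apply, tropHom_apply, tropHom_apply,
        chartEval_character_incl h1 hl mem_toricOpen_coneOf]
    refine ⟨σ, toricOpen_mono h2 hl, fun s => ?_⟩
    rw [← negLog_nonneg_iff, ← chartEval_character_incl h2 hl, ← tropHom_apply, ← hw]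
    exact (hv s).trans (le_of_eq (DFunLike.congr_fun e2 s).symm)
  · rintro ⟨σ, hσ, h⟩
    exact ⟨σ, _, fun s => negLog_nonneg_iff.2 (h s), tropToric_eq_chartEval x hσ⟩

/-- A subring of `κ(x)` which contains the scalars and the values of the characters of `S_σ`
contains the values of all functions on `U_σ`. -/
lemma chartEval_mem {x : toricVariety k Δ} {σ : Δ.Cone} (hσ : x ∈ toricOpen k Δ σ)
    (A : Subring ((toricVariety k Δ).residueField x))
    (hk : ∀ c, residueScalars (toricStructure k Δ) x c ∈ A)
    (h : ∀ s : Δ.S σ, (chartEval hσ).hom (character k Δ σ s) ∈ A) (a : coordRing k Δ σ) :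
    (chartEval hσ).hom a ∈ A := by
  induction a using AddMonoidAlgebra.induction_on with
  | of s => exact h _
  | add a b ha hb =>
    have h1 := map_add (chartEval hσ).hom a b
    exact (congrArg (· ∈ A) h1).mpr (add_mem ha hb)
  | smul c a ha =>
    have h1 : (chartEval hσ).hom (c • a) =
        residueScalars (toricStructure k Δ) x c * (chartEval hσ).hom a := by
      rw [Algebra.smul_def, ← chartEval_algebraMap hσ]
      exact map_mul _ _ _
    exact (congrArg (· ∈ A) h1).mpr (mul_mem (hk c) ha)

/-- A point whose tropicalization belongs to the closure of the fan extends to a point of `X^ℶ`. -/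
lemma exists_beth [Module.Finite ℤ M] (x : Analytification (toricStructure k Δ))
    (h : tropToric k x ∈ closureFan Δ) : ∃ y : Beth (toricStructure k Δ), y.toAn = x := by
  obtain ⟨σ, hσ, h⟩ := (tropToric_mem_closureFan_iff x).1 h
  let g : coordRing k Δ σ →+* x.integers :=
    (chartEval hσ).hom.codRestrict x.integers.toSubring
      (chartEval_mem hσ x.integers.toSubring x.residueScalars_mem_integers h)
  refine ⟨⟨x, Spec.map (CommRingCat.ofHom g) ≫ toricChart k Δ σ, ?_⟩, rfl⟩
  rw [← map_chartEval_comp hσ, ← Category.assoc, ← Spec.map_comp]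
  rfl

end Integral

section SubBeth

variable {k : Type u} [Field k] {X Y : Scheme.{u}} {f : X ⟶ Spec (CommRingCat.of k)} (i : Y ⟶ X)

/-- The closed subscheme `Y` contains the point `Spec R ⟶ X` as soon as it contains its generic
point. -/
lemma mem_subBeth_iff [IsClosedImmersion i] (x : Beth f) :
    x ∈ subBeth f i ↔ x.toAn ∈ subAn f i := by
  constructor
  · rintro ⟨g, hg⟩
    refine ⟨Spec.map x.inclMap ≫ g, ?_⟩
    rw [Category.assoc, hg, x.map_inclMap_comp]
  · rintro ⟨h, hh⟩
    exact exists_lift_of_isClosedImmersion i x.inclMap Subtype.val_injective x.integral h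
      (x.fac.trans hh.symm)

end SubBeth

end TropLog

/-! ### Toric varieties are separated and of finite type -/

namespace TropLog

section LocalLift

/-- A morphism from the spectrum of a local ring factors through an affine chart which contains
the image of the closed point. -/
lemma exists_spec_map_comp_eq {X : Scheme.{u}} {A R : CommRingCat.{u}} [IsLocalRing R]
    (j : Spec A ⟶ X) [IsOpenImmersion j] (l : Spec R ⟶ X)
    (h : l (IsLocalRing.closedPoint R) ∈ j.opensRange) :
    ∃ g : A ⟶ R, Spec.map g ≫ j = l :=
  ⟨chartGerm h ≫ Scheme.stalkClosedPointTo l, by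
    rw [Spec.map_comp, Category.assoc, map_chartGerm_comp,
      Scheme.Spec_stalkClosedPointTo_fromSpecStalk]⟩

lemma eq_of_spec_map_comp_eq {X : Scheme.{u}} {A R : CommRingCat.{u}}
    {j : Spec A ⟶ X} [IsOpenImmersion j] {g g' : A ⟶ R}
    (h : Spec.map g ≫ j = Spec.map g' ≫ j) : g = g' :=
  Spec.map_injective ((cancel_mono j).1 h)

/-- For a point with values in a local ring, invertibility of a function at the closed point can
be tested after pulling it back. -/
lemma isUnit_chartGerm_iff_isUnit_hom {X : Scheme.{u}} {A R : CommRingCat.{u}} [IsLocalRing R]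
    {j : Spec A ⟶ X} [IsOpenImmersion j] {l : Spec R ⟶ X} {g : A ⟶ R} (hg : Spec.map g ≫ j = l)
    (h : l (IsLocalRing.closedPoint R) ∈ j.opensRange) (a : A) :
    IsUnit ((chartGerm h).hom a) ↔ IsUnit (g.hom a) := by
  let c : Spec R := IsLocalRing.closedPoint _
  have hc : j (Spec.map g c) = l c := by rw [← hg]; rfl
  rw [isUnit_chartGerm_iff h hc a]
  change ¬ g.hom a ∈ IsLocalRing.maximalIdeal R ↔ _
  rw [IsLocalRing.mem_maximalIdeal, mem_nonunits_iff, not_not]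

end LocalLift

section Structure

variable {k : Type u} [Field k] {M : Type u} [AddCommGroup M] [Module.Finite ℤ M] {Δ : Fan M}

instance finiteType_coordRing (σ : Δ.Cone) : Algebra.FiniteType k (coordRing k Δ σ) := by
  have : AddMonoid.FG (Δ.S σ) :=
    AddMonoid.fg_iff_addSubmonoid_fg _ |>.2 (Δ.rational σ.1 σ.2).fg_dualMonoid
  infer_instance

variable (k Δ) in
/-- The open cover of the toric variety by the `U_σ`. -/
noncomputable def toricCover : (toricVariety k Δ).OpenCover :=
  Scheme.IsLocallyDirected.openCover (toricDiagram k Δ)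

instance : LocallyOfFiniteType (toricStructure k Δ) := by
  have : IsZariskiLocalAtSource @LocallyOfFiniteType :=
    HasRingHomProperty.instIsZariskiLocalAtSource (P := @LocallyOfFiniteType)
  rw [IsZariskiLocalAtSource.iff_of_openCover (P := @LocallyOfFiniteType) (toricCover k Δ)]
  suffices h : ∀ σ : Δ.Cone, LocallyOfFiniteType (toricChart k Δ σ ≫ toricStructure k Δ) from h
  intro σ
  rw [toricChart_toricStructure, HasRingHomProperty.Spec_iff (P := @LocallyOfFiniteType)]
  exact (RingHom.finiteType_algebraMap (A := k) (B := coordRing k Δ σ)).2 inferInstance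

instance : IsLocallyNoetherian (toricVariety k Δ) := by
  have : IsNoetherianRing (CommRingCat.of k) := inferInstanceAs (IsNoetherianRing k)
  exact LocallyOfFiniteType.isLocallyNoetherian (toricStructure k Δ)

instance : CompactSpace (toricVariety k Δ) := by
  have : Finite (toricCover k Δ).I₀ := Δ.finite
  have : ∀ σ, CompactSpace ((toricCover k Δ).X σ) := fun σ =>
    inferInstanceAs (CompactSpace (Spec (CommRingCat.of (coordRing k Δ σ))))
  exact (toricCover k Δ).compactSpace

instance : QuasiCompact (toricStructure k Δ) := by
  have : IsNoetherian (toricVariety k Δ) := {}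
  infer_instance

instance : QuasiSeparated (toricStructure k Δ) := by
  infer_instance

/-- Let `l₁, l₂` be points with values in a local domain `R` which agree over a field `K` containing
`R`. The cones of their closed points are separated by an `m` such that `χ^m` has a value in `R`
along `l₁` and `χ^{-m}` has a value in `R` along `l₂`. These values are inverse to each other in
`K`, so they are units, and the closed point of `l₁` lies in the open subset which belongs to the
intersection of the cones. -/
lemma coneOf_le_of_generic_eq {R K : Type u} [CommRing R] [IsLocalRing R] [Field K]
    (f : R →+* K) (hf : Function.Injective f)
    (l₁ l₂ : Spec (CommRingCat.of R) ⟶ toricVariety k Δ)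
    (h : Spec.map (CommRingCat.ofHom f) ≫ l₁ = Spec.map (CommRingCat.ofHom f) ≫ l₂) :
    coneOf (l₁ (IsLocalRing.closedPoint R)) ≤ coneOf (l₂ (IsLocalRing.closedPoint R)) := by
  set c : Spec (CommRingCat.of R) := IsLocalRing.closedPoint R
  obtain ⟨g₁, hg₁⟩ := exists_spec_map_comp_eq (toricChart k Δ (coneOf (l₁ c))) l₁
    mem_toricOpen_coneOf
  obtain ⟨g₂, hg₂⟩ := exists_spec_map_comp_eq (toricChart k Δ (coneOf (l₂ c))) l₂
    mem_toricOpen_coneOf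
  obtain ⟨m, m', hmm', hm, -⟩ := exists_separating_cutsOut (coneOf (l₁ c)) (coneOf (l₂ c))
  have hu : IsUnit (g₁.hom (character k Δ _ m)) := by
    have hs : ∀ {σ : Δ.Cone} (g : CommRingCat.of (coordRing k Δ σ) ⟶ CommRingCat.of R)
        (l : Spec (CommRingCat.of R) ⟶ toricVariety k Δ), Spec.map g ≫ toricChart k Δ σ = l →
        Spec.map (g ≫ CommRingCat.ofHom f) ≫ toricChart k Δ σ =
          Spec.map (CommRingCat.ofHom f) ≫ l := by
      intro σ g l hl
      rw [Spec.map_comp, Category.assoc, hl]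
    let d : Spec (CommRingCat.of K) := IsLocalRing.closedPoint _
    obtain ⟨l, hl₁, hl₂, hl⟩ := exists_mem_toricOpen_le
      (x := (Spec.map (CommRingCat.ofHom f) ≫ l₁) d)
      ⟨Spec.map (g₁ ≫ CommRingCat.ofHom f) d, by rw [← hs _ _ hg₁]; rfl⟩
      ⟨Spec.map (g₂ ≫ CommRingCat.ofHom f) d, by rw [h, ← hs _ _ hg₂]; rfl⟩
    obtain ⟨q, hq⟩ := exists_spec_map_comp_eq (toricChart k Δ l) _ hl
    have e₁ : CommRingCat.ofHom (coordMap k Δ hl₁).toRingHom ≫ q = g₁ ≫ CommRingCat.ofHom f :=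
      eq_of_spec_map_comp_eq (j := toricChart k Δ _) (by
        rw [hs _ _ hg₁, Spec.map_comp, Category.assoc, spec_coordMap_toricChart, hq])
    have e₂ : CommRingCat.ofHom (coordMap k Δ hl₂).toRingHom ≫ q = g₂ ≫ CommRingCat.ofHom f :=
      eq_of_spec_map_comp_eq (j := toricChart k Δ _) (by
        rw [hs _ _ hg₂, Spec.map_comp, Category.assoc, spec_coordMap_toricChart, hq, h])
    have f₁ : f (g₁.hom (character k Δ _ m)) = q.hom (character k Δ l (Δ.incl hl₁ m)) :=
      (congrArg (fun g : _ ⟶ CommRingCat.of K => g.hom (character k Δ _ m)) e₁).symm.trans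
        (congrArg q.hom (coordMap_character hl₁ m))
    have f₂ : f (g₂.hom (character k Δ _ m')) = q.hom (character k Δ l (Δ.incl hl₂ m')) :=
      (congrArg (fun g : _ ⟶ CommRingCat.of K => g.hom (character k Δ _ m')) e₂).symm.trans
        (congrArg q.hom (coordMap_character hl₂ m'))
    have hsum : Δ.incl hl₁ m + Δ.incl hl₂ m' = 0 := by
      refine Subtype.ext ?_
      change (m : M) + m' = 0
      rw [hmm', add_neg_cancel]
    refine IsUnit.of_mul_eq_one (g₂.hom (character k Δ _ m')) (hf ?_)
    rw [map_one]
    refine (map_mul f _ _).trans ?_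
    rw [f₁, f₂, ← map_mul, ← character_add, hsum, character_zero, map_one]
  have h1 := (isUnit_chartGerm_iff_isUnit_hom hg₁ mem_toricOpen_coneOf _).2 hu
  have h2 := (mem_toricOpen_iff_of_cutsOut hm mem_toricOpen_coneOf).2 h1
  exact (mem_toricOpen_iff.1 h2).trans (Δ.inf_le_right _ _)

instance : IsSeparated (toricStructure k Δ) := by
  refine IsSeparated.of_valuativeCriterion _ fun S => ⟨?_⟩
  rintro ⟨l₁, h₁, -⟩ ⟨l₂, h₂, -⟩
  ext : 1
  dsimp only at *
  -- both lifts factor through the affine chart at the closed point of `l₂`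
  have hle := coneOf_le_of_generic_eq (algebraMap S.R S.K) (IsFractionRing.injective S.R S.K)
    l₁ l₂ (h₁.trans h₂.symm)
  obtain ⟨g₁, hg₁⟩ := exists_spec_map_comp_eq (toricChart k Δ _) l₁ (mem_toricOpen_iff.2 hle)
  obtain ⟨g₂, hg₂⟩ := exists_spec_map_comp_eq (toricChart k Δ _) l₂ mem_toricOpen_coneOf
  have h3 : g₁ ≫ CommRingCat.ofHom (algebraMap S.R S.K) =
      g₂ ≫ CommRingCat.ofHom (algebraMap S.R S.K) := by
    refine eq_of_spec_map_comp_eq (j := toricChart k Δ _) ?_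
    rw [Spec.map_comp, Spec.map_comp, Category.assoc, Category.assoc, hg₁, hg₂, h₁, h₂]
  have h4 : g₁ = g₂ := by
    refine CommRingCat.hom_ext (RingHom.ext fun a => ?_)
    exact IsFractionRing.injective S.R S.K (congrArg (fun g : _ ⟶ CommRingCat.of S.K => g.hom a) h3)
  exact hg₁.symm.trans ((congrArg (fun g => Spec.map g ≫ toricChart k Δ _) h4).trans hg₂)

end Structure

end TropLog

/-! ### Real valuations dominated by a given valuation ring -/

namespace TropLog

section Krull

variable {R : Type*} [CommRing R] [IsDomain R] [IsNoetherianRing R]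

/-- Krull's principal ideal theorem, in the form that the local ring at a prime `Q` which is minimal
over a principal ideal `(g)` has dimension one: every nonzero `c` divides a power of `g` locally
at `Q`. -/
lemma exists_dvd_mul_pow_of_mem_minimalPrimes {g : R} {Q : Ideal R}
    (hQ : Q ∈ (Ideal.span {g}).minimalPrimes) {c : R} (hc : c ≠ 0) :
    ∃ s ∉ Q, ∃ n : ℕ, c ∣ s * g ^ n := by
  have hQp : Q.IsPrime := hQ.1.1
  have hgQ : g ∈ Q := hQ.1.2 (Ideal.mem_span_singleton_self g)
  by_contra! H
  have hd : Disjoint (Ideal.span {c} : Set R)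
      (Q.primeCompl ⊔ Submonoid.powers g : Submonoid R) := by
    refine Set.disjoint_left.2 fun a ha hs => ?_
    obtain ⟨s, hsQ, _, ⟨n, rfl⟩, rfl⟩ := Submonoid.mem_sup.1 hs
    exact H s hsQ n (Ideal.mem_span_singleton.1 ha)
  obtain ⟨P, hP, hcP, hPd⟩ := Ideal.exists_le_prime_disjoint _ _ hd
  -- the chain `0 < P < Q` contradicts `height Q ≤ 1`
  have hPQ : P < Q := by
    refine lt_of_le_of_ne (fun a ha => ?_) ?_
    · by_contra haQ
      exact Set.disjoint_left.1 hPd ha (Submonoid.mem_sup_left haQ)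
    · rintro rfl
      exact Set.disjoint_left.1 hPd hgQ (Submonoid.mem_sup_right (Submonoid.mem_powers g))
  have hP0 : ⊥ < P := bot_lt_iff_ne_bot.2 fun h => hc (by
    have := hcP (Ideal.mem_span_singleton_self c)
    rwa [h, Ideal.mem_bot] at this)
  have h1 := Ideal.height_le_one_of_isPrincipal_of_mem_minimalPrimes _ Q hQ
  have h2 := Ideal.height_strict_mono_of_isPrime_of_isPrime hPQ
  have h3 := Ideal.height_strict_mono_of_isPrime_of_isPrime hP0
  have h4 : P.height < 1 := h2.trans_le h1
  rw [Order.lt_one_iff] at h4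
  simp [h4] at h3

end Krull

section RankOne

variable {L : Type*} [Field L]

/-- A valuation ring is given by a real valuation if every nonzero element divides some power of
every nonunit. -/
lemma exists_real_valuation_of_archimedean (W : ValuationSubring L)
    (h0 : ∃ z : L, z ≠ 0 ∧ z ∈ W.nonunits)
    (h : ∀ z ∈ W.nonunits, ∀ t : L, t ≠ 0 → ∃ n : ℕ, z ^ n * t⁻¹ ∈ W) :
    ∃ w : Valuation L ℝ≥0, W.valuation.IsEquiv w := by
  have : W.valuation.IsNontrivial := by
    obtain ⟨z, hz, hz'⟩ := h0
    exact ⟨z, by simpa using hz, (W.mem_nonunits_iff.1 hz').ne⟩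
  have ha : MulArchimedean W.ValueGroup := by
    refine ⟨fun x y hy => ?_⟩
    obtain ⟨a, rfl⟩ := W.valuation_surjective x
    obtain ⟨b, rfl⟩ := W.valuation_surjective y
    rcases eq_or_ne a 0 with rfl | ha
    · exact ⟨0, by simp⟩
    obtain ⟨n, hn⟩ := h b⁻¹ (W.mem_nonunits_iff.2 (by
      rw [map_inv₀]; exact inv_lt_one_of_one_lt₀ hy)) a⁻¹ (inv_ne_zero ha)
    refine ⟨n, ?_⟩
    rw [inv_inv, ← W.valuation_le_one_iff, map_mul, map_pow, map_inv₀, inv_pow, mul_comm,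
      ← div_eq_mul_inv] at hn
    exact (div_le_one₀ (pow_pos (zero_lt_one.trans hy) n)).1 hn
  have hm : MulArchimedean (MonoidWithZeroHom.ValueGroup₀ (.ofClass W.valuation)) :=
    MulArchimedean.comap
      (MonoidWithZeroHom.ValueGroup₀.embedding (f := .ofClass W.valuation)).toMonoidHom
      MonoidWithZeroHom.ValueGroup₀.embedding_strictMono
  obtain ⟨hr⟩ := Valuation.nonempty_rankOne_iff_mulArchimedean.2 hm
  refine ⟨W.valuation.restrict.map (Valuation.RankOne.hom W.valuation)
    (Valuation.RankOne.strictMono W.valuation).monotone, fun a b => ?_⟩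
  exact (W.valuation.restrict_le_iff).symm.trans
    (Valuation.RankOne.strictMono W.valuation).le_iff_le.symm

/-- In a valuation ring, the radical of a principal ideal is prime. -/
lemma isPrime_radical_span_singleton {R : Type*} [CommRing R] [IsDomain R] [ValuationRing R]
    {g : R} (hg : ¬ IsUnit g) : (Ideal.span {g}).radical.IsPrime := by
  refine ⟨?_, ?_⟩
  · rwa [Ne, Ideal.radical_eq_top, Ideal.span_singleton_eq_top]
  · rintro a b ⟨n, hn⟩
    rw [Ideal.mem_span_singleton] at hn
    obtain ⟨c, hc⟩ := ValuationRing.cond a b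
    rcases hc with rfl | rfl
    · refine Or.inr ⟨n + n, Ideal.mem_span_singleton.2 (hn.trans ⟨c ^ n, ?_⟩)⟩
      ring
    · refine Or.inl ⟨n + n, Ideal.mem_span_singleton.2 (hn.trans ⟨c ^ n, ?_⟩)⟩
      ring

/-- A nonunit `g` of a Noetherian ring with quotient field `L` has absolute value less than `1` for
some real valuation of `L` which is bounded by `1` on the ring: a valuation ring dominating the
local ring at a minimal prime over `g`, coarsened at the radical of `g`, has rank one. -/
lemma exists_real_valuation_of_isNoetherianRing (A : Subring L) [IsNoetherianRing A]
    (hA : ∀ z : L, ∃ b ∈ A, b ≠ 0 ∧ z * b ∈ A) {g : L} (hgA : g ∈ A) (hg0 : g ≠ 0)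
    (hg : g⁻¹ ∉ A) : ∃ w : Valuation L ℝ≥0, (∀ a ∈ A, w a ≤ 1) ∧ w g < 1 := by
  let g' : A := ⟨g, hgA⟩
  have hg' : ¬ IsUnit g' := by
    rintro ⟨u, hu⟩
    refine hg ?_
    have h1 : (u : A) * ((u⁻¹ : Aˣ) : A) = 1 := u.mul_inv
    have h2 : g * (((u⁻¹ : Aˣ) : A) : L) = 1 := by
      rw [hu] at h1
      exact congrArg Subtype.val h1
    rw [inv_eq_of_mul_eq_one_right h2]
    exact Subtype.property _
  obtain ⟨Q, hQ⟩ := Ideal.nonempty_minimalPrimes (I := Ideal.span {g'})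
    (by rwa [Ne, Ideal.span_singleton_eq_top])
  have hQp : Q.IsPrime := hQ.1.1
  have hgQ : g' ∈ Q := hQ.1.2 (Ideal.mem_span_singleton_self g')
  -- a valuation ring `W` which dominates `A_Q`
  obtain ⟨W, hAW, hW⟩ := (LocalSubring.ofPrime A Q).exists_le_valuationSubring
  have hle : ∀ a ∈ A, a ∈ W := fun a ha => hAW (LocalSubring.le_ofPrime A Q ha)
  have hinv : ∀ s : A, s ∉ Q → (s : L)⁻¹ ∈ W := by
    intro s hs
    obtain ⟨u, hu⟩ := IsLocalization.map_units (LocalSubring.ofPrime A Q).toSubring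
      (⟨s, hs⟩ : Q.primeCompl)
    have h1 : (s : L) * ((u⁻¹ : Units _) : (LocalSubring.ofPrime A Q).toSubring) = 1 := by
      have h2 := u.mul_inv
      rw [hu] at h2
      exact congrArg Subtype.val h2
    rw [inv_eq_of_mul_eq_one_right h1]
    exact hAW (Subtype.property _)
  have hgW : g⁻¹ ∉ W := by
    intro hgW
    have h1 : algebraMap A (LocalSubring.ofPrime A Q).toSubring g' ∈
        IsLocalRing.maximalIdeal (LocalSubring.ofPrime A Q).toSubring := by
      rw [← IsLocalization.AtPrime.map_eq_maximalIdeal Q]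
      exact Ideal.mem_map_of_mem _ hgQ
    refine (IsLocalRing.mem_maximalIdeal _).1 h1 (hW.map_nonunit _ ?_)
    exact IsUnit.of_mul_eq_one (⟨g⁻¹, hgW⟩ : W.toSubring) (Subtype.ext (mul_inv_cancel₀ hg0))
  let gW : W := ⟨g, hle g hgA⟩
  have hgu : ¬ IsUnit gW := by
    rintro ⟨u, hu⟩
    refine hgW ?_
    have h1 : (u : W) * ((u⁻¹ : Wˣ) : W) = 1 := u.mul_inv
    have h2 : g * (((u⁻¹ : Wˣ) : W) : L) = 1 := by
      rw [hu] at h1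
      exact congrArg Subtype.val h1
    rw [inv_eq_of_mul_eq_one_right h2]
    exact Subtype.property _
  -- the localization of `W` at the radical of `g`, in which `g` is still a nonunit
  have hP := isPrime_radical_span_singleton hgu
  let P : Ideal W := (Ideal.span {gW}).radical
  let W' := W.ofPrime P
  have hWW' : W ≤ W' := W.le_ofPrime P
  have hmem : ∀ z : W, (z : L) ∈ W'.nonunits ↔ z ∈ P := by
    intro z
    rw [← W.idealOfLE_ofPrime P]
    exact W'.coe_mem_nonunits_iff (a := ⟨z, hWW' z.2⟩)
  have hgn : g ∈ W'.nonunits := (hmem gW).2 (Ideal.le_radical (Ideal.mem_span_singleton_self gW))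
  -- every nonzero element of `L` divides a power of `g`, since `A_Q` has dimension one
  have hdvd : ∀ t : L, t ≠ 0 → ∃ n : ℕ, g ^ n * t⁻¹ ∈ W := by
    intro t ht
    obtain ⟨b, hb, hb0, htb⟩ := hA t
    have hc : (⟨t * b, htb⟩ : A) ≠ 0 := fun h => mul_ne_zero ht hb0 (congrArg Subtype.val h)
    obtain ⟨s, hs, n, ⟨d, hd⟩⟩ := exists_dvd_mul_pow_of_mem_minimalPrimes hQ hc
    have hd' : (s : L) * g ^ n = t * b * d := congrArg Subtype.val hd
    have hs0 : (s : L) ≠ 0 := by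
      rintro h
      refine hs ?_
      rw [show s = 0 from Subtype.ext h]
      exact Q.zero_mem
    refine ⟨n, ?_⟩
    have h1 : g ^ n * t⁻¹ = (s : L)⁻¹ * (b * d) := by
      field_simp
      linear_combination hd'
    rw [h1]
    exact W.mul_mem _ _ (hinv s hs) (W.mul_mem _ _ (hle b hb) (hle d d.2))
  obtain ⟨w, hw⟩ := exists_real_valuation_of_archimedean W' ⟨g, hg0, hgn⟩ (by
    intro z hz t ht
    have hzW : z ∈ W := by
      rcases W'.mem_nonunits_iff_or.1 hz with rfl | h
      · exact W.zero_mem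
      · exact (W.mem_or_inv_mem z).resolve_right fun h' => h (hWW' h')
    obtain ⟨N, hN⟩ := (hmem ⟨z, hzW⟩).1 hz
    obtain ⟨c, hc⟩ := Ideal.mem_span_singleton.1 hN
    have hc' : z ^ N = g * c := congrArg Subtype.val hc
    obtain ⟨n, hn⟩ := hdvd t ht
    refine ⟨N * n, hWW' ?_⟩
    have h1 : z ^ (N * n) * t⁻¹ = c ^ n * (g ^ n * t⁻¹) := by
      rw [pow_mul, hc']
      ring
    rw [h1]
    exact W.mul_mem _ _ (pow_mem c.2 n) hn)
  refine ⟨w, fun a ha => ?_, ?_⟩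
  · rw [← hw.le_one_iff_le_one, W'.valuation_le_one_iff]
    exact hWW' (hle a ha)
  · rw [← hw.lt_one_iff_lt_one]
    exact W'.mem_nonunits_iff.1 hgn

/-- Let `L` be the quotient field of a finitely generated `k`-algebra, and let `g₁, …, g_r` be
nonunits of a valuation ring `V` of `L` over `k`. Then there is a real valuation of `L` over `k`
which is less than `1` at `g₁, …, g_r`, even though `V` itself may have higher rank. -/
lemma exists_real_valuation_lt_one {k : Type*} [Field k] [Algebra k L] (V : ValuationSubring L)
    (hk : ∀ a : k, algebraMap k L a ∈ V) (S : Finset L)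
    (hS : ∀ z : L, ∃ b ∈ Algebra.adjoin k (S : Set L), b ≠ 0 ∧ z * b ∈ Algebra.adjoin k (S : Set L))
    (G : Finset L) (hG : G.Nonempty) (hG' : ∀ g ∈ G, g ≠ 0 ∧ g ∈ V.nonunits) :
    ∃ w : Valuation L ℝ≥0, (∀ a : k, a ≠ 0 → w (algebraMap k L a) = 1) ∧ ∀ g ∈ G, w g < 1 := by
  classical
  -- if `g₁` has the largest value, then `g₁` and all `g / g₁` belong to `V`
  obtain ⟨g₁, hg₁, hmax⟩ := G.exists_max_image V.valuation hG
  have hg0 := (hG' g₁ hg₁).1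
  -- these elements, and one of `s`, `s⁻¹` for each `s ∈ S`, generate a subalgebra `C` of `V` with
  -- quotient field `L`
  let T : Finset L := insert g₁ (G.image (fun g => g * g₁⁻¹) ∪
    S.image (fun s => if s ∈ V then s else s⁻¹))
  let C : Subalgebra k L := Algebra.adjoin k (T : Set L)
  have hTC : ∀ t ∈ T, t ∈ C := fun t ht => Algebra.subset_adjoin ht
  have hCV : ∀ c ∈ C, c ∈ V := by
    let V' : Subalgebra k L := { V.toSubring with algebraMap_mem' := hk }
    have h1 : C ≤ V' := by
      refine Algebra.adjoin_le fun t ht => ?_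
      change t ∈ V
      rcases Finset.mem_insert.1 ht with rfl | ht
      · exact V.nonunits_le (hG' _ hg₁).2
      rcases Finset.mem_union.1 ht with ht | ht
      · obtain ⟨g, hg, rfl⟩ := Finset.mem_image.1 ht
        rw [← V.valuation_le_one_iff, map_mul, map_inv₀, ← div_eq_mul_inv]
        exact div_le_one_of_le₀ (hmax g hg) zero_le
      · obtain ⟨s, hs, rfl⟩ := Finset.mem_image.1 ht
        split_ifs with h
        · exact h
        · exact (V.mem_or_inv_mem s).resolve_left h
    exact fun c hc => h1 hc
  have hfrac : ∀ z ∈ Algebra.adjoin k (S : Set L), ∃ b ∈ C, b ≠ 0 ∧ z * b ∈ C := by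
    intro z hz
    induction hz using Algebra.adjoin_induction with
    | mem s hs =>
      have h1 : (if s ∈ V then s else s⁻¹) ∈ C :=
        hTC _ (Finset.mem_insert_of_mem (Finset.mem_union_right _ (Finset.mem_image_of_mem _ hs)))
      split_ifs at h1 with h
      · exact ⟨1, one_mem C, one_ne_zero, by rwa [mul_one]⟩
      · have hs0 : s ≠ 0 := by rintro rfl; exact h V.zero_mem
        exact ⟨s⁻¹, h1, inv_ne_zero hs0, by rw [mul_inv_cancel₀ hs0]; exact one_mem C⟩
    | algebraMap r => exact ⟨1, one_mem C, one_ne_zero, by rw [mul_one]; exact C.algebraMap_mem r⟩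
    | add x y _ _ hx hy =>
      obtain ⟨b, hb, hb0, hxb⟩ := hx
      obtain ⟨c, hc, hc0, hyc⟩ := hy
      refine ⟨b * c, mul_mem hb hc, mul_ne_zero hb0 hc0, ?_⟩
      rw [show (x + y) * (b * c) = x * b * c + y * c * b by ring]
      exact add_mem (mul_mem hxb hc) (mul_mem hyc hb)
    | mul x y _ _ hx hy =>
      obtain ⟨b, hb, hb0, hxb⟩ := hx
      obtain ⟨c, hc, hc0, hyc⟩ := hy
      refine ⟨b * c, mul_mem hb hc, mul_ne_zero hb0 hc0, ?_⟩
      rw [mul_mul_mul_comm]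
      exact mul_mem hxb hyc
  have hfrac' : ∀ z : L, ∃ b ∈ C.toSubring, b ≠ 0 ∧ z * b ∈ C.toSubring := by
    intro z
    obtain ⟨b, hb, hb0, hzb⟩ := hS z
    obtain ⟨c, hc, hc0, hbc⟩ := hfrac b hb
    obtain ⟨d, hd, hd0, hzd⟩ := hfrac _ hzb
    refine ⟨b * c * d, mul_mem hbc hd, mul_ne_zero (mul_ne_zero hb0 hc0) hd0, ?_⟩
    rw [show z * (b * c * d) = z * b * d * c by ring]
    exact mul_mem hzd hc
  have : Algebra.FiniteType k C :=
    (Subalgebra.fg_iff_finiteType C).1 (Subalgebra.fg_adjoin_finset T)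
  have hN : IsNoetherianRing C := Algebra.FiniteType.isNoetherianRing k C
  have hN' : IsNoetherianRing C.toSubring := hN
  obtain ⟨w, hw, hwg⟩ := exists_real_valuation_of_isNoetherianRing C.toSubring hfrac'
    (hTC g₁ (Finset.mem_insert_self _ _)) hg0 (fun h => by
      have h1 := hCV _ h
      rcases V.mem_nonunits_iff_or.1 (hG' g₁ hg₁).2 with h2 | h2
      · exact hg0 h2
      · exact h2 h1)
  refine ⟨w, fun a ha => ?_, fun g hg => ?_⟩
  · have h1 : ∀ a : k, w (algebraMap k L a) ≤ 1 := fun a => hw _ (C.algebraMap_mem a)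
    refine le_antisymm (h1 a) ?_
    have h2 : w (algebraMap k L a) * w (algebraMap k L a⁻¹) = 1 := by
      rw [← map_mul, ← map_mul, mul_inv_cancel₀ ha, map_one, map_one]
    rw [← h2]
    exact mul_le_of_le_one_right' (h1 _)
  · have h1 : w (g * g₁⁻¹) ≤ 1 := hw _ (hTC _ (Finset.mem_insert_of_mem
      (Finset.mem_union_left _ (Finset.mem_image_of_mem _ hg))))
    have h2 : g = g * g₁⁻¹ * g₁ := by rw [mul_assoc, inv_mul_cancel₀ hg0, mul_one]
    rw [h2, map_mul]
    exact (mul_le_of_le_one_left' h1).trans_lt hwg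

end RankOne

end TropLog

/-! ### Properness -/

namespace TropLog

section Scalars

variable {k : Type u} [Field k] {X : Scheme.{u}} (f : X ⟶ Spec (CommRingCat.of k))

lemma spec_map_residueScalars (ξ : X) :
    Spec.map (CommRingCat.ofHom (residueScalars f ξ)) = X.fromSpecResidueField ξ ≫ f :=
  Spec.map_preimage _

variable {f}

/-- On a subscheme which is proper over `k`, every point of the analytification extends to the
valuation ring, by the valuative criterion. -/
lemma exists_beth_of_isProper {Y : Scheme.{u}} (i : Y ⟶ X) [hp : IsProper (i ≫ f)]
    {x : Analytification f} (hx : x ∈ subAn f i) : ∃ y : Beth f, y.toAn = x := by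
  obtain ⟨g, hg⟩ := hx
  have hv : ValuativeCriterion (i ≫ f) := by
    rw [IsProper.eq_valuativeCriterion] at hp
    exact hp.1.1.1
  let S : ValuativeCommSq (i ≫ f) :=
    { R := x.integers
      K := X.residueField x.point
      i₁ := g
      i₂ := Spec.map (CommRingCat.ofHom ((residueScalars f x.point).codRestrict
        x.integers.toSubring x.residueScalars_mem_integers))
      commSq := ⟨by
        rw [reassoc_of% hg, ← spec_map_residueScalars, ← Spec.map_comp]
        rfl⟩ }
  obtain ⟨l, hl, -⟩ := (hv.existence S).exists_lift.some
  refine ⟨⟨x, l ≫ i, ?_⟩, rfl⟩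
  rw [← hg, ← Category.assoc]
  exact congrArg (· ≫ i) hl

end Scalars

section Proper

variable {k : Type u} [Field k] {M : Type u} [AddCommGroup M] [Module.Finite ℤ M] {Δ : Fan M}

lemma Beth.tropToric_mem_closureFan [Module.Free ℤ M] (x : Beth (toricStructure k Δ)) :
    tropToric k x.toAn ∈ closureFan Δ := by
  obtain ⟨u, hu, -⟩ := existsUnique_isTropicalization x
  rw [← toNRDelta_eq_tropToric x hu, ← range_toNRDelta]
  exact ⟨u, rfl⟩

variable (ξ : toricVariety k Δ)

/-- If the valuation ring `V` of `κ(ξ)` over `k` contains none of the images of the `k[S_σ]`, then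
there is a real valuation with this property. -/
lemma exists_real_valuation_of_forall_notMem
    (V : ValuationSubring ((toricVariety k Δ).residueField ξ))
    (hk : ∀ c, residueScalars (toricStructure k Δ) ξ c ∈ V)
    (H : ∀ (σ : Δ.Cone) (hσ : ξ ∈ toricOpen k Δ σ),
      ∃ s : Δ.S σ, (chartEval hσ).hom (character k Δ σ s) ∉ V) :
    ∃ w : Valuation ((toricVariety k Δ).residueField ξ) ℝ≥0,
      (∀ c : k, c ≠ 0 → w (residueScalars (toricStructure k Δ) ξ c) = 1) ∧
      ∀ (σ : Δ.Cone) (hσ : ξ ∈ toricOpen k Δ σ),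
        ∃ s : Δ.S σ, 1 < w ((chartEval hσ).hom (character k Δ σ s)) := by
  classical
  let L : Type u := (toricVariety k Δ).residueField ξ
  let : Algebra k L := (residueScalars (toricStructure k Δ) ξ).toAlgebra
  have hξ : ξ ∈ toricOpen k Δ (coneOf ξ) := mem_toricOpen_coneOf
  let ev : coordRing k Δ (coneOf ξ) →ₐ[k] L :=
    { (chartEval hξ).hom with commutes' := chartEval_algebraMap hξ }
  obtain ⟨S, hS⟩ := (finiteType_coordRing (k := k) (coneOf ξ)).out
  have hadj : Algebra.adjoin k ((S.image ev : Finset L) : Set L) = ev.range := by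
    rw [Finset.coe_image, ← AlgHom.map_adjoin, hS, Algebra.map_top]
  have : Finite Δ.Cone := Δ.finite
  let : Fintype {σ : Δ.Cone // ξ ∈ toricOpen k Δ σ} := Fintype.ofFinite _
  choose s hs using H
  -- the inverses of the characters outside `V` are nonunits of `V`
  let G : Finset L := Finset.univ.image fun σ : {σ : Δ.Cone // ξ ∈ toricOpen k Δ σ} =>
    ((chartEval σ.2).hom (character k Δ σ.1 (s σ.1 σ.2)) : L)⁻¹
  have hne : ∀ (σ : Δ.Cone) (hσ : ξ ∈ toricOpen k Δ σ),
      ((chartEval hσ).hom (character k Δ σ (s σ hσ)) : L) ≠ 0 := fun σ hσ h =>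
    hs σ hσ (h ▸ V.zero_mem)
  obtain ⟨w, hw, hG⟩ := exists_real_valuation_lt_one (k := k) (L := L) V hk (S.image ev) (by
    intro z
    obtain ⟨c, rfl⟩ := (toricVariety k Δ).residue_surjective ξ z
    obtain ⟨a, b, hb, hab⟩ := exists_mul_chartGerm_eq hξ c
    rw [hadj]
    refine ⟨ev b, ⟨b, rfl⟩, (chartEval_ne_zero_iff hξ b).2 hb, ⟨a, ?_⟩⟩
    refine Eq.trans ?_ (map_mul ((toricVariety k Δ).residue ξ).hom _ _)
    exact congrArg ((toricVariety k Δ).residue ξ).hom hab.symm) G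
    ⟨_, Finset.mem_image_of_mem _ (Finset.mem_univ ⟨_, hξ⟩)⟩ (by
      intro g hg
      obtain ⟨σ, -, rfl⟩ := Finset.mem_image.1 hg
      exact ⟨inv_ne_zero (hne σ.1 σ.2), V.inv_mem_nonunits_iff.2 (Or.inr (hs σ.1 σ.2))⟩)
  refine ⟨w, hw, fun σ hσ => ⟨s σ hσ, ?_⟩⟩
  have h1 := hG _ (Finset.mem_image_of_mem _ (Finset.mem_univ ⟨σ, hσ⟩))
  rw [map_inv₀] at h1
  have h2 := (Valuation.ne_zero_iff w).2 (hne σ hσ)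
  exact (inv_lt_one₀ (pos_iff_ne_zero.2 h2)).1 h1

/-- If the tropicalization of a closed subscheme `Y` is contained in the closure of the fan, then
`Y` satisfies the existence part of the valuative criterion. -/
lemma existence_of_tropToric_subset {Y : Scheme.{u}} (i : Y ⟶ toricVariety k Δ)
    [IsClosedImmersion i] (h : TropToric k i ⊆ closureFan Δ) :
    ValuativeCriterion.Existence (i ≫ toricStructure k Δ) := by
  intro S
  let ξ : toricVariety k Δ := (S.i₁ ≫ i) (IsLocalRing.closedPoint S.K)
  let θ : (toricVariety k Δ).residueField ξ ⟶ CommRingCat.of S.K :=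
    Scheme.descResidueField (Scheme.stalkClosedPointTo (S.i₁ ≫ i))
  have hθ : Spec.map θ ≫ (toricVariety k Δ).fromSpecResidueField ξ = S.i₁ ≫ i :=
    Scheme.descResidueField_stalkClosedPointTo_fromSpecResidueField _ _ _
  have hinj : Function.Injective (algebraMap S.R S.K) := IsFractionRing.injective S.R S.K
  let e : k →+* S.R := (Spec.preimage S.i₂).hom
  have he : Spec.map (CommRingCat.ofHom e) = S.i₂ := Spec.map_preimage _
  have hsc : ∀ c, θ.hom (residueScalars (toricStructure k Δ) ξ c) = algebraMap S.R S.K (e c) := by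
    have h1 : CommRingCat.ofHom (residueScalars (toricStructure k Δ) ξ) ≫ θ =
        CommRingCat.ofHom e ≫ CommRingCat.ofHom (algebraMap S.R S.K) := by
      refine Spec.map_injective ?_
      rw [Spec.map_comp, Spec.map_comp, he, spec_map_residueScalars, reassoc_of% hθ]
      exact S.commSq.w
    exact fun c => congrArg (fun g : CommRingCat.of k ⟶ CommRingCat.of S.K => g.hom c) h1
  let V : ValuationSubring ((toricVariety k Δ).residueField ξ) :=
    (ValuationRing.valuation S.R S.K).valuationSubring.comap θ.hom
  have hV : ∀ a, a ∈ V ↔ ∃ r, algebraMap S.R S.K r = θ.hom a := fun a =>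
    ValuationRing.mem_integer_iff S.R S.K _
  have hk : ∀ c, residueScalars (toricStructure k Δ) ξ c ∈ V := fun c =>
    (hV _).2 ⟨e c, (hsc c).symm⟩
  obtain ⟨σ, hσ, H⟩ : ∃ (σ : Δ.Cone) (hσ : ξ ∈ toricOpen k Δ σ),
      ∀ s : Δ.S σ, (chartEval hσ).hom (character k Δ σ s) ∈ V := by
    -- otherwise a real valuation gives a point of `Y^an` with tropicalization outside the closure
    by_contra! H
    obtain ⟨w, hw, hw'⟩ := exists_real_valuation_of_forall_notMem ξ V hk H
    let x : Analytification (toricStructure k Δ) := ⟨ξ, w, hw⟩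
    have hx : x ∈ subAn (toricStructure k Δ) i :=
      exists_lift_of_isClosedImmersion i θ (RingHom.injective _) _ S.i₁ hθ
    obtain ⟨σ, hσ, h1⟩ := (tropToric_mem_closureFan_iff x).1 (h ⟨x, hx, rfl⟩)
    obtain ⟨s, hs⟩ := hw' σ hσ
    exact absurd (h1 s) (not_le.2 hs)
  have hr : ∀ a, ∃ r, algebraMap S.R S.K r = θ.hom ((chartEval hσ).hom a) := fun a =>
    (hV _).1 (chartEval_mem hσ V.toSubring hk H a)
  -- the values of the functions on `U_σ` lie in `S.R`, so the generic point extends to `Spec S.R`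
  choose q hq using hr
  let q' : coordRing k Δ σ →+* S.R :=
    { toFun := q
      map_one' := hinj (by rw [hq, map_one, map_one, map_one])
      map_zero' := hinj (by rw [hq, map_zero, map_zero, map_zero])
      map_mul' := fun a b => hinj (by rw [hq, map_mul, map_mul, map_mul, hq, hq])
      map_add' := fun a b => hinj (by rw [hq, map_add, map_add, map_add, hq, hq]) }
  have hq' : CommRingCat.ofHom q' ≫ CommRingCat.ofHom (algebraMap S.R S.K) = chartEval hσ ≫ θ :=
    CommRingCat.hom_ext (RingHom.ext hq)
  obtain ⟨g, hg⟩ := exists_lift_of_isClosedImmersion i (CommRingCat.ofHom (algebraMap S.R S.K)) hinj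
    (Spec.map (CommRingCat.ofHom q') ≫ toricChart k Δ σ) S.i₁ (by
      rw [← Category.assoc, ← Spec.map_comp, hq', Spec.map_comp, Category.assoc,
        map_chartEval_comp, hθ])
  refine ⟨⟨⟨g, ?_, ?_⟩⟩⟩
  · rw [← cancel_mono i, Category.assoc, hg, ← Category.assoc, ← Spec.map_comp, hq', Spec.map_comp,
      Category.assoc, map_chartEval_comp, hθ]
  · rw [reassoc_of% hg, toricChart_toricStructure, ← Spec.map_comp, ← he]
    congr 1
    refine CommRingCat.hom_ext (RingHom.ext fun c => hinj ?_)
    refine (hq _).trans ((congrArg θ.hom (chartEval_algebraMap hσ c)).trans (hsc c))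

/-- If `Y` is proper, all points of `Y^an` extend to points of `Y^ℶ` by the valuative criterion, and
these have tropicalization in the closure of the fan. Conversely, `Y` is separated and of finite
type because `X` is, and the existence part of the criterion has been verified. -/
theorem isProper_iff_tropToric_subset [Module.Free ℤ M] {Y : Scheme.{u}}
    (i : Y ⟶ toricVariety k Δ) [IsClosedImmersion i] :
    IsProper (i ≫ toricStructure k Δ) ↔ TropToric k i ⊆ closureFan Δ := by
  constructor
  · rintro hp _ ⟨x, hx, rfl⟩
    obtain ⟨y, rfl⟩ := exists_beth_of_isProper i hx
    exact y.tropToric_mem_closureFan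
  · intro h
    exact IsProper.of_valuativeCriterion _
      (ValuativeCriterion.iff.2 ⟨existence_of_tropToric_subset i h,
        IsSeparated.valuativeCriterion _⟩)

end Proper

end TropLog

/-! ### The comparison of the two tropicalizations -/

namespace TropLog

section Comparison

variable {k : Type u} [Field k] {M : Type u} [AddCommGroup M] [Module.Free ℤ M]
  [Module.Finite ℤ M] {Δ : Fan M}

lemma ExtendedConeComplex.map_map_of_comp_eq_id {F G : MonoidalSpace.{u}}
    {h : MonoidalSpace.Hom F G} {h' : MonoidalSpace.Hom G F}
    (hh : h.comp h' = MonoidalSpace.Hom.id F) (u : ExtendedConeComplex F) :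
    (u.map h).map h' = u :=
  congrArg (MonoidalSpace.Hom.comp u) hh

/-- A map `ι` which is compatible with the two tropicalization maps sends `Trop_X(Y)` onto
`Trop(Y, Δ) ∩ closureFan Δ`, since the points of `Y^an` with tropicalization in `closureFan Δ`
extend to points of `Y^ℶ`. -/
lemma image_tropLogVariety {F : MonoidalSpace.{u}}
    {φ : MonoidalSpace.Hom (charSpace (toricVariety k Δ) (bigTorus k Δ)) F}
    (hφ : ∀ x : Beth (toricStructure k Δ), ∃ u, IsTropicalization φ x u)
    {ι : ExtendedConeComplex F → NRDelta Δ}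
    (hι : ∀ (x : Beth (toricStructure k Δ)) (u : ExtendedConeComplex F),
      IsTropicalization φ x u → ι u = tropToric k x.toAn)
    {Y : Scheme.{u}} (i : Y ⟶ toricVariety k Δ) [IsClosedImmersion i] :
    ι '' TropLogVariety (toricStructure k Δ) φ i = TropToric k i ∩ closureFan Δ := by
  ext p
  constructor
  · rintro ⟨u, ⟨x, hx, hu⟩, rfl⟩
    rw [hι x u hu]
    exact ⟨⟨x.toAn, (mem_subBeth_iff i x).1 hx, rfl⟩, x.tropToric_mem_closureFan⟩
  · rintro ⟨⟨x, hx, rfl⟩, hp⟩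
    obtain ⟨y, rfl⟩ := exists_beth x hp
    obtain ⟨u, hu⟩ := hφ y
    exact ⟨u, ⟨y, (mem_subBeth_iff i y).2 hx, hu⟩, hι y u hu⟩

end Comparison

end TropLog

theorem mainTheorem8 {k : Type u} [Field k] {M : Type u} [AddCommGroup M] [Module.Free ℤ M]
    [Module.Finite ℤ M] (Δ : Fan M) :
    (∃ (F : MonoidalSpace.{u})
      (φ : MonoidalSpace.Hom (charSpace (toricVariety k Δ) (bigTorus k Δ)) F),
        IsCharacteristicMorphism φ) ∧
    ∀ (F : MonoidalSpace.{u})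
      (φ : MonoidalSpace.Hom (charSpace (toricVariety k Δ) (bigTorus k Δ)) F),
      IsCharacteristicMorphism φ →
      (∀ x : Beth (toricStructure k Δ), ∃! u, IsTropicalization φ x u) ∧
      ∃ ι : ExtendedConeComplex F → NRDelta Δ,
        Function.Injective ι ∧ Set.range ι = closureFan Δ ∧
        (∀ (x : Beth (toricStructure k Δ)) (u : ExtendedConeComplex F),
          IsTropicalization φ x u → ι u = tropToric k x.toAn) ∧
        ∀ (Y : Scheme.{u}) (i : Y ⟶ toricVariety k Δ) [IsClosedImmersion i],
          ι '' TropLogVariety (toricStructure k Δ) φ i = TropToric k i ∩ closureFan Δ ∧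
          (IsProper (i ≫ toricStructure k Δ) ↔
            ι '' TropLogVariety (toricStructure k Δ) φ i = TropToric k i) := by
  have hψ := isCharacteristicMorphism_toricCharMorphism (k := k) (Δ := Δ)
  refine ⟨⟨_, _, hψ⟩, fun F φ hφ => ?_⟩
  -- a characteristic morphism is unique up to isomorphism, so `φ` may be compared with the morphism
  -- to the Kato fan of `Δ`
  obtain ⟨h, h', hh, hh', e, e'⟩ := hφ.exists_inverse hψ
  have hT : ∀ x : Beth (toricStructure k Δ), ∃! u, IsTropicalization φ x u := by
    intro x
    obtain ⟨u, hu, huniq⟩ := existsUnique_isTropicalization x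
    refine ⟨u.map h', hh' ▸ hu.map h', fun v hv => ?_⟩
    have h1 : v.map h = u := huniq _ (hh ▸ hv.map h)
    rw [← h1, ExtendedConeComplex.map_map_of_comp_eq_id e]
  have hι : ∀ (x : Beth (toricStructure k Δ)) (u : ExtendedConeComplex F),
      IsTropicalization φ x u → toNRDelta (u.map h) = tropToric k x.toAn := fun x u hu =>
    toNRDelta_eq_tropToric x (hh ▸ hu.map h)
  refine ⟨hT, fun u => toNRDelta (u.map h), ?_, ?_, hι, fun Y i _ => ?_⟩
  · intro u v huv
    rw [← ExtendedConeComplex.map_map_of_comp_eq_id e u, toNRDelta_injective huv,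
      ExtendedConeComplex.map_map_of_comp_eq_id e]
  · rw [← range_toNRDelta]
    ext p
    constructor
    · rintro ⟨u, rfl⟩
      exact ⟨u.map h, rfl⟩
    · rintro ⟨u, rfl⟩
      exact ⟨u.map h', congrArg toNRDelta (ExtendedConeComplex.map_map_of_comp_eq_id e' u)⟩
  · have hY := image_tropLogVariety (fun x => (hT x).exists) hι i
    refine ⟨hY, ?_⟩
    rw [isProper_iff_tropToric_subset, hY, Set.inter_eq_left]
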